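/- Let $q\equiv 1 \pmod 4$ be a prime power, $n\ge 1$ an integer, $V$ a $2n$-dimensional vector space over $\mathbb F_q$, and $B$ a nondegenerate alternating bilinear form on $V$. Let $\mathcal V$ be the set of subspaces $X\le V$ with $X^\perp=X$ (they all have dimension $n$). For $X,Y\in\mathcal V$ let $d(X,Y)$ be the codimension of $X\cap Y$ in $X$ (equivalently, in $Y$). Let $\chi:\mathbb F_q^\times\to\{\pm1\}$ be the quadratic character. For every $X\in\mathcal V$ fix a nonzero alternating $n$-linear form $\delta_X:X^n\to\mathbb F_q$. For $X,Y\in\mathcal V$ with $d(X,Y)=k$ put $$\sigma(X,Y)=\chi\bigl(\delta_X(x_1,\dots,x_n)\,\delta_Y(y_1,\dots,y_n)\det[B(x_i,y_j)]_{1\le i,j\le k}\bigr),$$ where $x_1,\dots,x_n$ and $y_1,\dots,y_n$ are bases of $X$ and $Y$ such that $x_i=y_i$ $(k<i\le n)$ form a basis of $X\cap Y$; the value does not depend on the choice of these bases, and $\sigma(X,X)=1$. Let $\widehat{\mathcal V}=\mathcal V\times\{\pm1\}$, and for $0\le k\le n$ let $$R_k=\{((X,\varepsilon),(Y,\varepsilon')):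 d(X,Y)=k,\ \varepsilon\varepsilon'=\sigma(X,Y)\},\qquad R_{2n+1-k}=\{((X,\varepsilon),(Y,\varepsilon')): d(X,Y)=k,\ \varepsilon\varepsilon'=-\sigma(X,Y)\}.$$ Let $Sp(2n,q)$ be the group of linear isometries of $B$, let $\Sigma Sp(2n,q)$ be the group of semilinear bijections $g$ of $V$ for which there is $\tau\in\operatorname{Aut}\mathbb F_q$ with $B(gx,gy)=B(x,y)^{\tau}$ for all $x,y\in V$, and let $PSp(2n,q)=Sp(2n,q)/\langle -I\rangle$ and $P\Sigma Sp(2n,q)=\Sigma Sp(2n,q)/\langle -I\rangle$. An element $g\in\Sigma Sp(2n,q)$, with associated field automorphism $\tau_g$, acts on $\widehat{\mathcal V}$ by $(U,\varepsilon)\mapsto(gU,\chi(\lambda_{g,U})\varepsilon)$, where $\lambda_{g,U}\in\mathbb F_q^\times$ is the scalar with $\delta_{gU}(gu_1,\dots,gu_n)=\lambda_{g,U}\,\delta_U(u_1,\dots,u_n)^{\tau_g}$ for all $u_1,\dots,u_n\in U$; the element $-I$ acts trivially. Together with the group of order $2$ generated by $\zeta:(U,\varepsilon)\mapsto(U,-\varepsilon)$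 this gives actions of $2\times PSp(2n,q)$ and of $2\times P\Sigma Sp(2n,q)$ on $\widehat{\mathcal V}$. **Theorem.** The sets $R_0,\dots,R_{2n+1}$ are pairwise distinct, and they are exactly the orbits of $2\times PSp(2n,q)$ in its diagonal action on $\widehat{\mathcal V}\times\widehat{\mathcal V}$. They are also exactly the orbits of $2\times P\Sigma Sp(2n,q)$ on $\widehat{\mathcal V}\times\widehat{\mathcal V}$. These sets are the relations of a $(2n+1)$-class Schurian association scheme on $\widehat{\mathcal V}$; that is, they form a symmetric association scheme with $R_0$ the identity relation, and they are the orbits on $\widehat{\mathcal V}\times\widehat{\mathcal V}$ of a transitive permutation group of $\widehat{\mathcal V}$. The group $2\times P\Sigma Sp(2n,q)$ acts faithfully on $\widehat{\mathcal V}$, and the permutation group it induces is the full automorphism group of the scheme, i.e. the group of all permutations of $\widehat{\mathcal V}$ that preserve each of the relations $R_i$. -/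

import Mathlib

namespace SympCover

noncomputable section

/-! ## Association schemes and permutation groups -/

/-- `R 0, …, R d` are the relations of a (symmetric) `d`-class association scheme on the finite
set `Ω`. -/
structure IsAssociationScheme {Ω : Type*} (d : ℕ) (R : Fin (d + 1) → Set (Ω × Ω)) : Prop where
  finite : Finite Ω
  nonempty : ∀ i, (R i).Nonempty
  disjoint : ∀ i j, i ≠ j → Disjoint (R i) (R j)
  cover : ⋃ i, R i = Set.univ
  zero_eq_id : R 0 = {p | p.1 = p.2}
  symm : ∀ i x y, (x, y) ∈ R i → (y, x) ∈ R i
  intersection_numbers : ∃ p : Fin (d + 1) → Fin (d + 1) → Fin (d + 1) → ℕ,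
    ∀ i j k x y, (x, y) ∈ R k → Set.ncard {z | (x, z) ∈ R i ∧ (z, y) ∈ R j} = p i j k

/-- `R 0, …, R d` (pairwise distinct) are exactly the orbits of the permutation group `G` of `Ω` in
its diagonal action on `Ω × Ω`. -/
def AreOrbitals {Ω : Type*} {d : ℕ} (G : Subgroup (Equiv.Perm Ω))
    (R : Fin (d + 1) → Set (Ω × Ω)) : Prop :=
  Function.Injective R ∧ Set.range R = {O | ∃ p : Ω × Ω, O = MulAction.orbit G p}

/-- A Schurian scheme: an association scheme whose relations are the orbits on `Ω × Ω` of some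
transitive permutation group of `Ω` (generously transitive, as the relations of a scheme are
symmetric). -/
def IsSchurianScheme {Ω : Type*} (d : ℕ) (R : Fin (d + 1) → Set (Ω × Ω)) : Prop :=
  IsAssociationScheme d R ∧
    ∃ G : Subgroup (Equiv.Perm Ω), MulAction.IsPretransitive G Ω ∧ AreOrbitals G R

/-- The full automorphism group of a scheme: all permutations of the points that preserve each of
the relations. -/
def schemeAut {Ω : Type*} {d : ℕ} (R : Fin (d + 1) → Set (Ω × Ω)) :
    Subgroup (Equiv.Perm Ω) where
  carrier := {π | ∀ i x y, (π x, π y) ∈ R i ↔ (x, y) ∈ R i}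
  one_mem' := fun _ _ _ => Iff.rfl
  mul_mem' := fun {a b} ha hb i x y => (ha i (b x) (b y)).trans (hb i x y)
  inv_mem' := fun {a} ha i x y => by
    have h := ha i (a⁻¹ x) (a⁻¹ y)
    simpa using h.symm

/-! ## The quadratic character -/

/-- The quadratic character of a field, as a sign (only used at nonzero arguments). -/
def chi {F : Type*} [Field F] (a : F) : ℤˣ :=
  open Classical in if IsSquare a then 1 else -1

theorem chi_mul {F : Type*} [Field F] [Finite F] {a b : F} (ha : a ≠ 0) (hb : b ≠ 0) :
    chi (a * b) = chi a * chi b := by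
  classical
  have := Fintype.ofFinite F
  have key : ∀ c : F, c ≠ 0 → ((chi c : ℤˣ) : ℤ) = quadraticChar F c := by
    intro c hc
    rw [quadraticChar_apply, quadraticCharFun, if_neg hc, chi]
    split_ifs <;> rfl
  apply Units.ext
  rw [Units.val_mul, key _ ha, key _ hb, key _ (mul_ne_zero ha hb), map_mul]

theorem chi_map {F : Type*} [Field F] (τ : F ≃+* F) (a : F) : chi (τ a) = chi a := by
  have : IsSquare (τ a) ↔ IsSquare a :=
    ⟨fun h => by simpa using h.map τ.symm, fun h => h.map τ⟩
  unfold chi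
  by_cases h : IsSquare a
  · rw [if_pos h, if_pos (this.2 h)]
  · rw [if_neg h, if_neg (fun h' => h (this.1 h'))]

/-! ## Symplectic forms, semilinear groups and generators -/

/-- A symplectic form (nondegenerate alternating bilinear form) on a `2n`-dimensional space. -/
structure SymplecticForm (F V : Type*) [Field F] [AddCommGroup V] [Module F V] (n : ℕ) where
  form : LinearMap.BilinForm F V
  alt : form.IsAlt
  nondegenerate : form.Nondegenerate
  finrank_eq : Module.finrank F V = 2 * n

/-- The group `ΓL(V)` of all semilinear transformations of `V`. -/
def gammaL (F V : Type*) [Field F] [AddCommGroup V] [Module F V] : Subgroup (Equiv.Perm V) where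
  carrier := {g | (∀ u v, g (u + v) = g u + g v) ∧
    ∃ τ : F ≃+* F, ∀ (a : F) (v : V), g (a • v) = τ a • g v}
  one_mem' := ⟨fun _ _ => rfl, RingEquiv.refl F, fun _ _ => rfl⟩
  mul_mem' := by
    rintro g h ⟨hg, τ, hτ⟩ ⟨hh, ρ, hρ⟩
    exact ⟨fun u v => by simp [hg, hh], ρ.trans τ, fun a v => by simp [hρ, hτ]⟩
  inv_mem' := by
    rintro g ⟨hg, τ, hτ⟩
    exact ⟨fun u v => g.injective (by simp [hg]), τ.symm, fun a v => g.injective (by simp [hτ])⟩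

variable {F V : Type*} [Field F] [AddCommGroup V] [Module F V] {n : ℕ}

/-- The image of a subspace under a semilinear transformation. -/
def semiMap (g : Equiv.Perm V) (hg : g ∈ gammaL F V) (U : Submodule F V) : Submodule F V where
  carrier := {v | ∃ u ∈ U, g u = v}
  zero_mem' := ⟨0, U.zero_mem, by simpa using hg.1 0 0⟩
  add_mem' := by
    rintro _ _ ⟨u, hu, rfl⟩ ⟨v, hv, rfl⟩
    exact ⟨u + v, U.add_mem hu hv, hg.1 u v⟩
  smul_mem' := by
    rintro c _ ⟨u, hu, rfl⟩
    obtain ⟨_, τ, hτ⟩ := hg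
    exact ⟨τ.symm c • u, U.smul_mem _ hu, by simp [hτ]⟩

namespace SymplecticForm

variable (S : SymplecticForm F V n)

/-- `ΣSp(2n,q)`: the semi-isometries, i.e. the semilinear `g` such that for some field
automorphism `τ`, `B(gx, gy) = τ(B(x,y))` for all `x, y`. -/
def sigmaSp : Subgroup (Equiv.Perm V) where
  carrier := {g | g ∈ gammaL F V ∧ ∃ τ : F ≃+* F, ∀ x y, S.form (g x) (g y) = τ (S.form x y)}
  one_mem' := ⟨Subgroup.one_mem _, RingEquiv.refl F, fun _ _ => rfl⟩
  mul_mem' := by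
    rintro g h ⟨hg, τ, hτ⟩ ⟨hh, ρ, hρ⟩
    exact ⟨Subgroup.mul_mem _ hg hh, ρ.trans τ, fun x y => by simp [hρ, hτ]⟩
  inv_mem' := by
    rintro g ⟨hg, τ, hτ⟩
    refine ⟨Subgroup.inv_mem _ hg, τ.symm, fun x y => τ.injective ?_⟩
    rw [← hτ]
    simp

/-- `Sp(2n,q)`: the linear isometries. -/
def sp : Subgroup (Equiv.Perm V) where
  carrier := {g | (∀ u v, g (u + v) = g u + g v) ∧ (∀ (a : F) (v : V), g (a • v) = a • g v) ∧
    ∀ x y, S.form (g x) (g y) = S.form x y}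
  one_mem' := ⟨fun _ _ => rfl, fun _ _ => rfl, fun _ _ => rfl⟩
  mul_mem' := by
    rintro g h ⟨ag, hg, hg'⟩ ⟨ah, hh, hh'⟩
    exact ⟨fun u v => by simp [ag, ah], fun a v => by simp [hg, hh],
      fun x y => by simp [hg', hh']⟩
  inv_mem' := by
    rintro g ⟨ag, hg, hg'⟩
    refine ⟨fun u v => g.injective (by simp [ag]), fun a v => g.injective (by simp [hg]),
      fun x y => ?_⟩
    rw [← hg']
    simp

theorem sp_le_sigmaSp : S.sp ≤ S.sigmaSp := fun _ hg =>
  ⟨⟨hg.1, RingEquiv.refl F, hg.2.1⟩, RingEquiv.refl F, hg.2.2⟩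

/-- The transformation `-I`. -/
def negI : Equiv.Perm V := Equiv.neg V

theorem negI_mem : (negI : Equiv.Perm V) ∈ S.sp :=
  ⟨fun u v => neg_add u v, fun a v => by simp [negI], fun x y => by simp [negI]⟩

theorem negI_comm (g : Equiv.Perm V) (hg : g ∈ gammaL F V) : negI * g = g * negI := by
  ext v
  have h0 : g 0 = 0 := by simpa using hg.1 0 0
  have h := hg.1 v (-v)
  rw [add_neg_cancel, h0] at h
  exact (eq_neg_of_add_eq_zero_right h.symm).symm

theorem normal_zpowers_of_comm {G : Type*} [Group G] (z : G) (hz : ∀ g, z * g = g * z) :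
    (Subgroup.zpowers z).Normal := by
  refine ⟨fun x hx g => ?_⟩
  obtain ⟨k, rfl⟩ := hx
  have h : Commute g (z ^ k) := Commute.zpow_right (hz g).symm k
  rw [show g * z ^ k = z ^ k * g from h, mul_inv_cancel_right]
  exact ⟨k, rfl⟩

/-- The subgroup `⟨-I⟩` of `Sp(2n,q)`. -/
def spNegI : Subgroup S.sp := Subgroup.zpowers ⟨negI, S.negI_mem⟩

/-- The subgroup `⟨-I⟩` of `ΣSp(2n,q)`. -/
def sigmaSpNegI : Subgroup S.sigmaSp :=
  Subgroup.zpowers ⟨negI, S.sp_le_sigmaSp S.negI_mem⟩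

instance spNegI_normal : S.spNegI.Normal :=
  normal_zpowers_of_comm _ fun g => Subtype.ext (negI_comm g.1 (S.sp_le_sigmaSp g.2).1)

instance sigmaSpNegI_normal : S.sigmaSpNegI.Normal :=
  normal_zpowers_of_comm _ fun g => Subtype.ext (negI_comm g.1 g.2.1)

/-- `PSp(2n,q) = Sp(2n,q) / ⟨-I⟩`. -/
abbrev PSp : Type _ := S.sp ⧸ S.spNegI

/-- `PΣSp(2n,q) = ΣSp(2n,q) / ⟨-I⟩`. -/
abbrev PSigmaSp : Type _ := S.sigmaSp ⧸ S.sigmaSpNegI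

/-- The natural homomorphism `PSp(2n,q) → PΣSp(2n,q)`. -/
def pspToPSigmaSp : S.PSp →* S.PSigmaSp :=
  QuotientGroup.map _ _ (Subgroup.inclusion S.sp_le_sigmaSp) (by
    rw [spNegI, Subgroup.zpowers_le]
    exact Subgroup.mem_zpowers _)

/-- The set `𝒱` of generators, i.e. of the subspaces `X` of `V` with `X^⊥ = X`. -/
abbrev Gen : Type _ := {X : Submodule F V // S.form.orthogonal X = X}

/-- The action of `ΣSp(2n,q)` on generators. -/
def genMap (g : S.sigmaSp) (U : S.Gen) : S.Gen :=
  ⟨semiMap g.1 g.2.1 U.1, by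
    obtain ⟨τ, hτ⟩ := g.2.2
    ext v
    rw [LinearMap.BilinForm.mem_orthogonal_iff]
    constructor
    · intro h
      refine ⟨g.1.symm v, ?_, by simp⟩
      rw [← U.2, LinearMap.BilinForm.mem_orthogonal_iff]
      intro u hu
      apply τ.injective
      have h1 := h (g.1 u) ⟨u, hu, rfl⟩
      rw [map_zero, ← hτ]
      simpa using h1
    · rintro ⟨u, hu, rfl⟩ _ ⟨w, hw, rfl⟩
      rw [hτ]
      rw [← U.2, LinearMap.BilinForm.mem_orthogonal_iff] at hu
      rw [hu w hw, map_zero]⟩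

theorem genMap_one (U : S.Gen) : S.genMap 1 U = U := by
  apply Subtype.ext
  ext v
  exact ⟨fun ⟨u, hu, h⟩ => h ▸ hu, fun h => ⟨v, h, rfl⟩⟩

theorem genMap_mul (g h : S.sigmaSp) (U : S.Gen) :
    S.genMap (g * h) U = S.genMap g (S.genMap h U) := by
  apply Subtype.ext
  ext v
  constructor
  · rintro ⟨u, hu, rfl⟩
    exact ⟨h.1 u, ⟨u, hu, rfl⟩, rfl⟩
  · rintro ⟨_, ⟨u, hu, rfl⟩, rfl⟩
    exact ⟨u, hu, rfl⟩

theorem gen_finrank [FiniteDimensional F V] (X : S.Gen) : Module.finrank F X.1 = n := by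
  have h := LinearMap.BilinForm.finrank_orthogonal S.nondegenerate X.1
  rw [X.2, S.finrank_eq] at h
  have h2 := Submodule.finrank_le X.1
  rw [S.finrank_eq] at h2
  omega

/-- `d(X,Y)`: the codimension of `X ∩ Y` in `X` (and in `Y`). -/
def dist (X Y : S.Gen) : ℕ := n - Module.finrank F (X.1 ⊓ Y.1 : Submodule F V)

theorem dist_le (X Y : S.Gen) : S.dist X Y ≤ n := Nat.sub_le _ _

/-- Bases `x₁,…,xₙ` of `X` and `y₁,…,yₙ` of `Y` such that the `xᵢ = yᵢ` for `i > k = d(X,Y)` form a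
basis of `X ∩ Y` (with indices starting at `0` in the code). -/
structure AdaptedBases (X Y : S.Gen) where
  x : Module.Basis (Fin n) F X.1
  y : Module.Basis (Fin n) F Y.1
  common : ∀ i : Fin n, S.dist X Y ≤ i → (x i : V) = y i
  span_eq : Submodule.span F {v | ∃ i : Fin n, S.dist X Y ≤ i ∧ (x i : V) = v} = X.1 ⊓ Y.1

theorem exists_extend_basis {k m : ℕ} (hkm : k + m = n) (W X : Submodule F V) (hWX : W ≤ X)
    (hX : Module.finrank F X = n) [FiniteDimensional F V] (w : Module.Basis (Fin m) F W) :
    ∃ x : Module.Basis (Fin n) F X, ∀ i : Fin m,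
      (x (Fin.cast hkm (Fin.natAdd k i)) : V) = w i := by
  obtain ⟨C, hC⟩ := Submodule.exists_isCompl (W.comap X.subtype)
  let w' := w.map (Submodule.comapSubtypeEquivOfLe hWX).symm
  have hc : Module.finrank F C = k := by
    have h1 := Submodule.finrank_add_eq_of_isCompl hC
    have h2 := Module.finrank_eq_card_basis w'
    rw [Fintype.card_fin] at h2
    omega
  let c := Module.finBasisOfFinrankEq F C hc
  refine ⟨(((c.prod w').map (Submodule.prodEquivOfIsCompl _ _ hC.symm)).reindex
    finSumFinEquiv).reindex (finCongr hkm), fun i => ?_⟩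
  simp [w']

theorem nonempty_adaptedBases [FiniteDimensional F V] (X Y : S.Gen) :
    Nonempty (S.AdaptedBases X Y) := by
  have hle : Module.finrank F (X.1 ⊓ Y.1 : Submodule F V) ≤ n :=
    (Submodule.finrank_mono inf_le_left).trans_eq (S.gen_finrank X)
  have hkm : S.dist X Y + Module.finrank F (X.1 ⊓ Y.1 : Submodule F V) = n := by
    rw [dist]; omega
  let w := Module.finBasis F (X.1 ⊓ Y.1 : Submodule F V)
  obtain ⟨x, hx⟩ := exists_extend_basis hkm _ X.1 inf_le_left (S.gen_finrank X) w
  obtain ⟨y, hy⟩ := exists_extend_basis hkm _ Y.1 inf_le_right (S.gen_finrank Y) w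
  have idx : ∀ i : Fin n, S.dist X Y ≤ i → ∃ j, Fin.cast hkm (Fin.natAdd (S.dist X Y) j) = i :=
    fun i hi => ⟨⟨i - S.dist X Y, by omega⟩, by ext; simp; omega⟩
  refine ⟨⟨x, y, fun i hi => ?_, ?_⟩⟩
  · obtain ⟨j, rfl⟩ := idx i hi
    rw [hx, hy]
  · have : {v | ∃ i : Fin n, S.dist X Y ≤ i ∧ (x i : V) = v} =
        (X.1 ⊓ Y.1).subtype '' Set.range w := by
      ext v
      constructor
      · rintro ⟨i, hi, rfl⟩
        obtain ⟨j, rfl⟩ := idx i hi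
        exact ⟨w j, ⟨j, rfl⟩, (hx j).symm⟩
      · rintro ⟨_, ⟨j, rfl⟩, rfl⟩
        exact ⟨_, by simp, hx j⟩
    rw [this, Submodule.span_image, w.span_eq, Submodule.map_top, Submodule.range_subtype]

/-- A choice of a determinant function (nonzero alternating `n`-linear form) `δ_X` on every
generator `X`. -/
structure DetFamily where
  det : ∀ X : S.Gen, X.1 [⋀^Fin n]→ₗ[F] F
  det_ne_zero : ∀ X, det X ≠ 0

variable {S}
variable (δ : S.DetFamily)

/-- `χ(δ_X(x₁,…,xₙ) δ_Y(y₁,…,yₙ) det[B(xᵢ,yⱼ)]_{1≤i,j≤k})` for given adapted bases. -/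
def maslovOf {X Y : S.Gen} (b : S.AdaptedBases X Y) : ℤˣ :=
  chi (δ.det X b.x * δ.det Y b.y *
    Matrix.det (Matrix.of fun i j : Fin (S.dist X Y) =>
      S.form (b.x (Fin.castLE (S.dist_le X Y) i)) (b.y (Fin.castLE (S.dist_le X Y) j))))

/-- The Maslov index `σ(X,Y)`, computed from some choice of adapted bases (its value does not
depend on that choice; for `X = Y` it is `1`). -/
def maslov [FiniteDimensional F V] (X Y : S.Gen) : ℤˣ :=
  maslovOf δ (Classical.choice (S.nonempty_adaptedBases X Y))

variable (S) in
/-- The vertex set `𝒱 × {±1}` of the double cover. -/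
abbrev Cover : Type _ := S.Gen × ℤˣ

/-- The relations `R_0, …, R_{2n+1}` on `𝒱 × {±1}`: for `0 ≤ k ≤ n`, `R_k` is given by `d(X,Y) = k`
and `εε' = σ(X,Y)`, and `R_{2n+1-k}` by `d(X,Y) = k` and `εε' = -σ(X,Y)`. -/
def rel [FiniteDimensional F V] (i : Fin (2 * n + 1 + 1)) : Set (Cover S × Cover S) :=
  {p | if (i : ℕ) ≤ n
    then S.dist p.1.1 p.2.1 = i ∧ p.1.2 * p.2.2 = maslov δ p.1.1 p.2.1
    else S.dist p.1.1 p.2.1 = 2 * n + 1 - i ∧ p.1.2 * p.2.2 = -maslov δ p.1.1 p.2.1}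

/-! ## The lifted action -/

/-- The field automorphism `τ_g` associated with a semi-isometry `g`. -/
def tau (g : S.sigmaSp) : F ≃+* F := Classical.choose g.2.1.2

theorem tau_spec (g : S.sigmaSp) (a : F) (v : V) : g.1 (a • v) = tau g a • g.1 v :=
  Classical.choose_spec g.2.1.2 a v

/-- The map `U → gU` induced by `g`. -/
def restr (g : S.sigmaSp) (U : S.Gen) (u : U.1) : (S.genMap g U).1 := ⟨g.1 u, u, u.2, rfl⟩

theorem restr_update (g : S.sigmaSp) (U : S.Gen) [DecidableEq (Fin n)] (u : Fin n → U.1)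
    (i : Fin n) (a : U.1) : (fun j => restr g U (Function.update u i a j)) =
      Function.update (fun j => restr g U (u j)) i (restr g U a) := by
  funext j
  by_cases h : j = i
  · subst h; simp
  · simp [h]

theorem restr_add (g : S.sigmaSp) (U : S.Gen) (a b : U.1) :
    restr g U (a + b) = restr g U a + restr g U b := Subtype.ext (g.2.1.1 _ _)

theorem restr_smul (g : S.sigmaSp) (U : S.Gen) (c : F) (a : U.1) :
    restr g U (c • a) = tau g c • restr g U a := Subtype.ext (tau_spec g c _)

/-- The determinant function `(u₁,…,uₙ) ↦ τ_g⁻¹(δ_{gU}(gu₁,…,guₙ))` on `U`. -/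
def pullback (g : S.sigmaSp) (U : S.Gen) : U.1 [⋀^Fin n]→ₗ[F] F where
  toFun u := (tau g).symm (δ.det (S.genMap g U) fun i => restr g U (u i))
  map_update_add' u i a b := by
    simp only [restr_update, restr_add, AlternatingMap.map_update_add, map_add]
  map_update_smul' u i c a := by
    simp only [restr_update, restr_smul, AlternatingMap.map_update_smul, smul_eq_mul, map_mul,
      RingEquiv.symm_apply_apply]
  map_eq_zero_of_eq' u i j h hij := by
    rw [AlternatingMap.map_eq_zero_of_eq _ (fun k => restr g U (u k)) (congrArg (restr g U) h) hij,
      map_zero]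

theorem exists_multiplier [FiniteDimensional F V] (g : S.sigmaSp) (U : S.Gen) :
    ∃ c : F, c ≠ 0 ∧ ∀ u : Fin n → U.1,
      δ.det (S.genMap g U) (fun i => restr g U (u i)) = c * tau g (δ.det U u) := by
  let e : Module.Basis (Fin n) F U.1 := Module.finBasisOfFinrankEq F U.1 (S.gen_finrank U)
  have h1 := (δ.det U).eq_smul_basis_det e
  have h2 := (pullback δ g U).eq_smul_basis_det e
  have h1' : δ.det U e ≠ 0 := fun h => δ.det_ne_zero U (by rw [h1, h, zero_smul])
  have h2' : pullback δ g U e ≠ 0 := by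
    intro h
    rw [h, zero_smul] at h2
    apply δ.det_ne_zero (S.genMap g U)
    ext v
    have hv : ∀ i, ∃ u : U.1, restr g U u = v i := fun i => by
      obtain ⟨u, hu, h⟩ := (v i).2
      exact ⟨⟨u, hu⟩, Subtype.ext h⟩
    choose u hu using hv
    have h3 := congrArg (fun f => tau g (f u)) h2
    simpa [pullback, hu] using h3
  refine ⟨tau g (pullback δ g U e / δ.det U e), ?_, fun u => ?_⟩
  · rw [Ne, map_eq_zero_iff _ (tau g).injective]
    exact div_ne_zero h2' h1'
  · have h3 : pullback δ g U u = pullback δ g U e / δ.det U e * δ.det U u := by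
      have e1 := congrArg (fun f => f u) h1
      have e2 := congrArg (fun f => f u) h2
      simp only [AlternatingMap.smul_apply, smul_eq_mul] at e1 e2
      rw [e2, e1]
      field_simp
    rw [← map_mul, ← h3]
    simp [pullback]

/-- The scalar `λ_{g,U}`, determined by
`δ_{gU}(gu₁,…,guₙ) = λ_{g,U} τ_g(δ_U(u₁,…,uₙ))` for all `u₁,…,uₙ ∈ U`. -/
def multiplier [FiniteDimensional F V] (g : S.sigmaSp) (U : S.Gen) : F :=
  Classical.choose (exists_multiplier δ g U)

theorem multiplier_ne_zero [FiniteDimensional F V] (g : S.sigmaSp) (U : S.Gen) :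
    multiplier δ g U ≠ 0 := (Classical.choose_spec (exists_multiplier δ g U)).1

theorem multiplier_spec [FiniteDimensional F V] (g : S.sigmaSp) (U : S.Gen) (u : Fin n → U.1) :
    δ.det (S.genMap g U) (fun i => restr g U (u i)) = multiplier δ g U * tau g (δ.det U u) :=
  (Classical.choose_spec (exists_multiplier δ g U)).2 u

theorem exists_det_ne_zero (U : S.Gen) : ∃ u : Fin n → U.1, δ.det U u ≠ 0 := by
  by_contra! h
  exact δ.det_ne_zero U (AlternatingMap.ext h)

theorem det_congr {X Y : S.Gen} (h : X = Y) (u : Fin n → X.1) (v : Fin n → Y.1)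
    (huv : ∀ i, (u i : V) = v i) : δ.det X u = δ.det Y v := by
  subst h
  congr 1
  funext i
  exact Subtype.ext (huv i)

theorem chi_multiplier [Finite F] [FiniteDimensional F V] (g : S.sigmaSp) (U : S.Gen)
    (u : Fin n → U.1) (hu : δ.det U u ≠ 0) :
    chi (δ.det (S.genMap g U) fun i => restr g U (u i)) =
      chi (multiplier δ g U) * chi (δ.det U u) := by
  rw [multiplier_spec, chi_mul (multiplier_ne_zero δ g U) (by simpa using hu), chi_map]

theorem restr_det_ne_zero [FiniteDimensional F V] (g : S.sigmaSp) (U : S.Gen)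
    (u : Fin n → U.1) (hu : δ.det U u ≠ 0) :
    (δ.det (S.genMap g U) fun i => restr g U (u i)) ≠ 0 := by
  rw [multiplier_spec]
  exact mul_ne_zero (multiplier_ne_zero δ g U) (by simpa using hu)

theorem chi_multiplier_one [Finite F] [FiniteDimensional F V] (U : S.Gen) :
    chi (multiplier δ 1 U) = 1 := by
  obtain ⟨u, hu⟩ := exists_det_ne_zero δ U
  have h := chi_multiplier δ 1 U u hu
  rw [det_congr δ (S.genMap_one U) _ u (fun _ => rfl)] at h
  exact (mul_eq_right.mp h.symm)

theorem chi_multiplier_mul [Finite F] [FiniteDimensional F V] (g h : S.sigmaSp) (U : S.Gen) :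
    chi (multiplier δ (g * h) U) =
      chi (multiplier δ g (S.genMap h U)) * chi (multiplier δ h U) := by
  obtain ⟨u, hu⟩ := exists_det_ne_zero δ U
  have h1 := chi_multiplier δ (g * h) U u hu
  have h2 := chi_multiplier δ g _ _ (restr_det_ne_zero δ h U u hu)
  rw [chi_multiplier δ h U u hu] at h2
  rw [det_congr δ (S.genMap_mul g h U) _
    (fun i => restr g (S.genMap h U) (restr h U (u i))) (fun _ => rfl), h2, ← mul_assoc] at h1
  exact (mul_right_cancel h1).symm

/-- The lifted map `(U, ε) ↦ (gU, χ(λ_{g,U}) ε)` on `𝒱 × {±1}`. -/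
def liftMap [FiniteDimensional F V] (g : S.sigmaSp) (p : Cover S) : Cover S :=
  (S.genMap g p.1, chi (multiplier δ g p.1) * p.2)

theorem liftMap_one [Finite F] [FiniteDimensional F V] (p : Cover S) : liftMap δ 1 p = p := by
  simp [liftMap, chi_multiplier_one, genMap_one]

theorem liftMap_mul [Finite F] [FiniteDimensional F V] (g h : S.sigmaSp) (p : Cover S) :
    liftMap δ (g * h) p = liftMap δ g (liftMap δ h p) := by
  simp [liftMap, chi_multiplier_mul, genMap_mul, mul_assoc]

/-- The action of `ΣSp(2n,q)` on `𝒱 × {±1}`. -/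
def sigmaSpHom [Finite F] [FiniteDimensional F V] : S.sigmaSp →* Equiv.Perm (Cover S) where
  toFun g :=
    { toFun := liftMap δ g
      invFun := liftMap δ g⁻¹
      left_inv := fun p => by rw [← liftMap_mul, inv_mul_cancel, liftMap_one]
      right_inv := fun p => by rw [← liftMap_mul, mul_inv_cancel, liftMap_one] }
  map_one' := Equiv.ext (liftMap_one δ)
  map_mul' g h := Equiv.ext (liftMap_mul δ g h)

theorem sigmaSpHom_negI [Finite F] [FiniteDimensional F V] (hq : Nat.card F % 4 = 1) :
    sigmaSpHom δ ⟨negI, S.sp_le_sigmaSp S.negI_mem⟩ = 1 := by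
  have := Fintype.ofFinite F
  have hsq : IsSquare (-1 : F) := by
    rw [FiniteField.isSquare_neg_one_iff, ← Nat.card_eq_fintype_card]
    omega
  set z : S.sigmaSp := ⟨negI, S.sp_le_sigmaSp S.negI_mem⟩
  have hz : ∀ U : S.Gen, S.genMap z U = U := fun U => by
    apply Subtype.ext
    ext v
    constructor
    · rintro ⟨u, hu, rfl⟩
      exact U.1.neg_mem hu
    · intro hv
      exact ⟨-v, U.1.neg_mem hv, neg_neg v⟩
  have hchi : ∀ U : S.Gen, chi (multiplier δ z U) = 1 := fun U => by
    obtain ⟨u, hu⟩ := exists_det_ne_zero δ U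
    have h := chi_multiplier δ z U u hu
    rw [det_congr δ (hz U) _ (fun i => (-1 : F) • u i) (fun i => by simp [restr, z, negI]),
      AlternatingMap.map_smul_univ, smul_eq_mul, Finset.prod_const,
      chi_mul (pow_ne_zero _ (by simp)) hu] at h
    rw [← mul_right_cancel h, chi, if_pos (hsq.pow _)]
  refine Equiv.ext fun p => ?_
  change liftMap δ z p = p
  simp [liftMap, hz, hchi]

/-- The action of `PΣSp(2n,q)` on `𝒱 × {±1}`, where `q ≡ 1 mod 4`. -/
def pSigmaSpHom [Finite F] [FiniteDimensional F V] (hq : Nat.card F % 4 = 1) :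
    S.PSigmaSp →* Equiv.Perm (Cover S) :=
  QuotientGroup.lift S.sigmaSpNegI (sigmaSpHom δ) (by
    rw [sigmaSpNegI, Subgroup.zpowers_le]
    exact sigmaSpHom_negI δ hq)

variable (S) in
/-- The group of order `2` acting on `𝒱 × {±1}`; its nontrivial element acts as the antipodal map
`ζ : (U, ε) ↔ (U, -ε)`. -/
def zetaHom : ℤˣ →* Equiv.Perm (Cover S) where
  toFun s :=
    { toFun := fun p => (p.1, s * p.2)
      invFun := fun p => (p.1, s⁻¹ * p.2)
      left_inv := fun p => Prod.ext rfl (inv_mul_cancel_left s p.2)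
      right_inv := fun p => Prod.ext rfl (mul_inv_cancel_left s p.2) }
  map_one' := by ext p <;> simp
  map_mul' s t := by ext p <;> simp [mul_assoc]

/-- The action of `2 × PΣSp(2n,q)` on `𝒱 × {±1}`, where `q ≡ 1 mod 4`. -/
def twoPSigmaSpHom [Finite F] [FiniteDimensional F V] (hq : Nat.card F % 4 = 1) :
    ℤˣ × S.PSigmaSp →* Equiv.Perm (Cover S) :=
  MonoidHom.noncommCoprod (zetaHom S) (pSigmaSpHom δ hq) (by
    intro s g
    obtain ⟨g, rfl⟩ := QuotientGroup.mk_surjective g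
    refine Equiv.ext fun p => Prod.ext rfl ?_
    exact mul_left_comm _ _ _)

/-- The action of `2 × PSp(2n,q)` on `𝒱 × {±1}`, where `q ≡ 1 mod 4`. -/
def twoPSpHom [Finite F] [FiniteDimensional F V] (hq : Nat.card F % 4 = 1) :
    ℤˣ × S.PSp →* Equiv.Perm (Cover S) :=
  (twoPSigmaSpHom δ hq).comp ((MonoidHom.id ℤˣ).prodMap S.pspToPSigmaSp)

end SymplecticForm

end

end SympCover

namespace SympCover

/-! ## Carlitz's theorem on permutations of a finite field -/

open Polynomial

/-! Orbits. In suitable symplectic coordinates all pairs of generators at a given distance look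
alike, so `Sp` is transitive on such pairs (`exists_sp_genMap`). A semi-isometry `g` multiplies
`σ(X,Y)` by `χ(λ_{g,X}) χ(λ_{g,Y})` (`maslov_genMap`), which is exactly what the lifted action
compensates, and the antipodal map supplies the remaining sign. Hence every group lying between the
image of `2 × PSp` and the automorphism group of the scheme has the relations as its orbitals
(`areOrbitals_of_le`).

Automorphisms. An automorphism permutes the fibres of the cover, and its signs on the fibres cancel
in the products `σ(X,Y) σ(X,Z) σ(Y,Z)`. So it induces a permutation of the generators preserving
distances and these triple signs. Up to an isometry it fixes two opposite generators `E` and `Y₀`.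
The generators opposite to `E` are the graphs of symmetric matrices `A`, and the neighbours of `E`
are given by pairs `(u, c)`, `u ≠ 0`, up to scaling. Such a pair is opposite to `A` when `uᵀAu ≠ c`,
and then its triple sign with `E` and `A` is `χ(uᵀAu - c)` (`maslov_triple`).

The permutation therefore becomes a bijection `f` of the symmetric matrices, with `f 0 = 0`, under
which each function `χ(uᵀ f(A) u - c)` is some `χ(u'ᵀ A u' - c')`. Carlitz's theorem turns this into
`uᵀ f(A) u = τ(u'ᵀ A u')` for a field automorphism `τ` (`exists_ringEquiv_qform`). So `f` is
additive and takes each `x xᵀ` to a form with square values, hence to some `y yᵀ`. This forces `f(A)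
= W θ(A) Wᵀ` (`exists_eq_mul_map_mul`), the action of a semi-isometry. What is left fixes `E` and
everything opposite to it, and is trivial by `eq_one_of_fixes_opposite`.

Carlitz's theorem itself compares degrees: the condition on `χ` makes certain powers of `f`
polynomials of degree at most `(q-1)/2`, and the base `p` digits of the exponents leave room for a
monomial only. -/

theorem sum_pow_eq_ite {K : Type*} [Field K] [Fintype K] {i : ℕ} (hi : 0 < i)
    (hi2 : i < 2 * (Fintype.card K - 1)) :
    ∑ x : K, x ^ i = if i = Fintype.card K - 1 then -1 else 0 := by
  classical
  have hq : 2 ≤ Fintype.card K := Fintype.one_lt_card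
  rcases lt_trichotomy i (Fintype.card K - 1) with h | h | h
  · rw [if_neg h.ne, FiniteField.sum_pow_lt_card_sub_one K i h]
  · rw [if_pos h, h]
    have h1 : ∀ x : K, x ^ (Fintype.card K - 1) = 1 - if x = 0 then 1 else 0 := fun x => by
      split_ifs with hx
      · rw [hx, zero_pow (by omega), sub_self]
      · rw [FiniteField.pow_card_sub_one_eq_one x hx, sub_zero]
    simp [h1]
  · rw [if_neg h.ne']
    obtain ⟨j, rfl⟩ : ∃ j, i = Fintype.card K + j := ⟨i - Fintype.card K, by omega⟩
    rw [← FiniteField.sum_pow_lt_card_sub_one K (j + 1) (by omega)]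
    refine Finset.sum_congr rfl fun x _ => ?_
    rw [pow_add, FiniteField.pow_card, pow_succ']

theorem polynomial_ext_of_eval {K : Type*} [Field K] [Fintype K] {P Q : K[X]}
    (hP : P.natDegree < Fintype.card K) (hQ : Q.natDegree < Fintype.card K)
    (h : ∀ s, P.eval s = Q.eval s) : P = Q :=
  Polynomial.eq_of_natDegree_lt_card_of_eval_eq P Q (f := id) Function.injective_id h
    (max_lt hP hQ)

section PowPreserving

variable {K : Type*} [Field K] [Fintype K] {m : ℕ} (hm : Fintype.card K = 2 * m + 1)
  {f g : K → K} (hfg : ∀ t, f (g t) = t) (hf : ∀ s c, (f s - f c) ^ m = (s - c) ^ m)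

include hm hfg hf

/-- Expanding `∑ t, t^(m+j) (f s - t)^m` leaves only a multiple of `(f s)^j`, because power sums
vanish unless the exponent is `q - 1`. Writing `t = f (g t)` replaces each factor by `(s - g t)^m`,
visibly a polynomial of degree `m` in `s`. -/
theorem exists_polynomial_pow {j : ℕ} (hj : j ≤ m) (hc : ((m.choose j : ℕ) : K) ≠ 0) :
    ∃ P : K[X], P.natDegree ≤ m ∧ ∀ s, P.eval s = f s ^ j := by
  have hm0 : 0 < m := by
    have : 2 ≤ Fintype.card K := Fintype.one_lt_card
    omega
  set κ : K := -((-1) ^ (m - j) * (m.choose j : K)) with hκ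
  have hκ0 : κ ≠ 0 := neg_ne_zero.2 (mul_ne_zero (pow_ne_zero _ (by simp)) hc)
  refine ⟨C κ⁻¹ * ∑ t : K, C (t ^ (m + j)) * (X - C (g t)) ^ m, ?_, fun s => ?_⟩
  · refine (natDegree_C_mul_le _ _).trans (natDegree_sum_le_of_forall_le _ _ fun t _ => ?_)
    refine (natDegree_C_mul_le _ _).trans ((natDegree_pow_le).trans ?_)
    rw [natDegree_X_sub_C, mul_one]
  · have h1 : ∀ t, (s - g t) ^ m = ∑ l ∈ Finset.range (m + 1),
        (f s) ^ l * (-t) ^ (m - l) * (m.choose l : K) := fun t => by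
      rw [← hf, hfg, sub_eq_add_neg, add_pow]
    simp only [eval_mul, eval_C, eval_finsetSum, eval_pow, eval_sub, eval_X, h1, Finset.mul_sum]
    rw [Finset.sum_comm]
    have h2 : ∀ l ∈ Finset.range (m + 1), ∑ t : K,
        κ⁻¹ * (t ^ (m + j) * ((f s) ^ l * (-t) ^ (m - l) * (m.choose l : K))) =
        if l = j then (f s) ^ j else 0 := fun l hl => by
      have hl' : l ≤ m := Nat.lt_succ_iff.1 (Finset.mem_range.1 hl)
      have h3 : ∀ t : K, κ⁻¹ * (t ^ (m + j) * ((f s) ^ l * (-t) ^ (m - l) * (m.choose l : K))) =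
          κ⁻¹ * (f s) ^ l * (-1) ^ (m - l) * (m.choose l : K) * t ^ (m + j + (m - l)) :=
        fun t => by rw [neg_pow, pow_add]; ring
      simp only [h3]
      -- The exponent lies strictly between `0` and `2(q-1) = 4m`, and it equals `q - 1 = 2m`
      -- exactly when `l = j`.
      rw [← Finset.mul_sum, sum_pow_eq_ite (by omega) (by omega)]
      by_cases h : l = j
      · subst h
        rw [if_pos (by omega), if_pos rfl]
        have : κ⁻¹ * κ = 1 := inv_mul_cancel₀ hκ0
        calc _ = (κ⁻¹ * κ) * f s ^ l := by rw [hκ]; ring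
          _ = _ := by rw [this, one_mul]
      · rw [if_neg (by omega), if_neg h, mul_zero]
    rw [Finset.sum_congr rfl h2, Finset.sum_ite_eq' , if_pos (Finset.mem_range.2 (by omega))]

end PowPreserving

/-! ### Binomial coefficients of (q-1)/2 modulo p -/

/-- The number all of whose `r` digits in base `p` are `h`. -/
def repDigit (p h : ℕ) : ℕ → ℕ
  | 0 => 0
  | r + 1 => h + p * repDigit p h r

theorem repDigit_succ' (p h r : ℕ) : repDigit p h (r + 1) = repDigit p h r + h * p ^ r := by
  induction r with
  | zero => simp [repDigit]
  | succ r ih =>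
    conv_lhs => rw [repDigit, ih]
    conv_rhs => rw [repDigit]
    ring

theorem repDigit_zero (p r : ℕ) : repDigit p 0 r = 0 := by
  induction r with
  | zero => rfl
  | succ r ih => rw [repDigit, ih]; simp

/-- Identifies `repDigit p h e`, with `h = (p-1)/2`, as `(q-1)/2`, the exponent in Euler's
criterion. -/
theorem two_mul_repDigit {p h : ℕ} (hp : p = 2 * h + 1) (r : ℕ) :
    2 * repDigit p h r + 1 = p ^ r := by
  induction r with
  | zero => simp [repDigit]
  | succ r ih =>
    rw [repDigit, pow_succ, ← ih]
    rw [hp]; ring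

/-- Lucas's theorem: the lower entry has `r` digits `a` followed by one digit `l`, none exceeding
the digit `h` above it. The extra place `r` must be below `e`, unless its digit is `0`. -/
theorem choose_repDigit_ne_zero {p h : ℕ} [Fact p.Prime] (hp : p = 2 * h + 1) {a l : ℕ}
    (ha : a ≤ h) (hl : l ≤ h) : ∀ r e : ℕ, (r < e ∨ (r ≤ e ∧ l = 0)) →
      ¬ p ∣ (repDigit p h e).choose (repDigit p a r + l * p ^ r) := by
  have hpp : p.Prime := Fact.out
  have small : ∀ l ≤ h, ¬ p ∣ h.choose l := fun l hl hd => by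
    have h1 : h.choose l ∣ h.factorial :=
      ⟨_, by rw [← mul_assoc]; exact (Nat.choose_mul_factorial_mul_factorial hl).symm⟩
    have := (hpp.dvd_factorial).1 (hd.trans h1)
    omega
  have step : ∀ a b x, a ≤ h → ¬ p ∣ x.choose b → ¬ p ∣ (h + p * x).choose (a + p * b) := by
    intro a b x ha hx hd
    have h1 := Choose.choose_modEq_choose_mod_mul_choose_div_nat (n := h + p * x) (k := a + p * b)
      (p := p)
    rw [Nat.add_mul_mod_self_left, Nat.add_mul_mod_self_left, Nat.mod_eq_of_lt (by omega),
      Nat.mod_eq_of_lt (by omega), Nat.add_mul_div_left _ _ hpp.pos,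
      Nat.add_mul_div_left _ _ hpp.pos, Nat.div_eq_of_lt (by omega), Nat.div_eq_of_lt (by omega),
      zero_add, zero_add] at h1
    rcases (hpp.dvd_mul).1 ((h1.dvd_iff dvd_rfl).1 hd) with h2 | h2
    · exact small a ha h2
    · exact hx h2
  intro r
  induction r with
  | zero =>
    rintro e he
    cases e with
    | zero =>
      have : l = 0 := by omega
      simp [repDigit, this, hpp.one_lt.ne']
    | succ e =>
      have := step l 0 (repDigit p h e) hl (by simp [hpp.one_lt.ne'])
      simpa [repDigit] using this
  | succ r ih =>
    intro e he
    obtain ⟨e, rfl⟩ : ∃ e', e = e' + 1 := ⟨e - 1, by omega⟩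
    have := step a _ _ ha (ih e (by omega))
    have h1 : repDigit p a (r + 1) + l * p ^ (r + 1) =
        a + p * (repDigit p a r + l * p ^ r) := by
      rw [repDigit]; ring
    rw [h1]
    exact this

/-! ### Exponents in the reduced polynomials of the functions f^(p^i) -/

section PrimePower

variable {K : Type*} [Field K] [Fintype K] {p e h : ℕ} [Fact p.Prime] [CharP K p]
  (hp : p = 2 * h + 1) (hK : Fintype.card K = p ^ e)
  {f g : K → K} (hfg : ∀ t, f (g t) = t)  (hf : ∀ s c, (f s - f c) ^ repDigit p h e = (s - c) ^ repDigit p h e)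

include hp hK

/-- The coefficients of the reduced polynomial of `s ↦ f s ^ p ^ i` are the Frobenius images of
those of the reduced polynomial of `f`. -/
theorem coeff_frobenius {P Q : K[X]} {i j r : ℕ}
    (hP : P.natDegree ≤ repDigit p h e) (hPf : ∀ s, P.eval s = f s)
    (hQ : Q.natDegree ≤ repDigit p h e) (hQf : ∀ s, Q.eval s = f s ^ p ^ i)
    (hj : 0 < j) (hj' : j < p ^ e - 1) (hr : 0 < r) (hr' : r < p ^ e - 1)
    (hjr : p ^ i * j ≡ r [MOD (p ^ e - 1)]) : Q.coeff r = P.coeff j ^ p ^ i := by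
  have hm := two_mul_repDigit hp e
  -- A power sum reads off a coefficient: `j + (q-1-k)` stays below `2(q-1)` and equals `q - 1` only
  -- for `j = k`.
  have key : ∀ (R : K[X]), R.natDegree ≤ repDigit p h e → ∀ k, 0 < k → k < p ^ e - 1 →
      ∑ s : K, R.eval s * s ^ (p ^ e - 1 - k) = -R.coeff k := by
    intro R hR k hk hk'
    have h1 : ∀ s : K, R.eval s * s ^ (p ^ e - 1 - k) =
        ∑ j ∈ Finset.range (repDigit p h e + 1), R.coeff j * s ^ (j + (p ^ e - 1 - k)) := by
      intro s
      rw [eval_eq_sum_range' (Nat.lt_succ_of_le hR), Finset.sum_mul]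
      exact Finset.sum_congr rfl fun j _ => by rw [pow_add]; ring
    simp only [h1]
    rw [Finset.sum_comm]
    have h2 : ∀ j ∈ Finset.range (repDigit p h e + 1),
        ∑ s : K, R.coeff j * s ^ (j + (p ^ e - 1 - k)) = if j = k then -R.coeff k else 0 := by
      intro j hj
      have hj' : j ≤ repDigit p h e := Nat.lt_succ_iff.1 (Finset.mem_range.1 hj)
      rw [← Finset.mul_sum, sum_pow_eq_ite (by omega) (by rw [hK]; omega), hK]
      by_cases h : j = k
      · subst h
        rw [if_pos (by omega), if_pos rfl, mul_neg_one]
      · rw [if_neg (by omega), if_neg h, mul_zero]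
    rw [Finset.sum_congr rfl h2, Finset.sum_ite_eq']
    split_ifs with h
    · rfl
    · rw [coeff_eq_zero_of_natDegree_lt, neg_zero]
      rw [Finset.mem_range] at h
      omega
  have h1 := key P hP j hj hj'
  have h2 := key Q hQ r hr hr'
  -- Frobenius passes through the sum; the resulting exponent of `s` agrees with `q - 1 - r` modulo
  -- `q - 1`, which suffices for `s ≠ 0`.
  have h3 : (∑ s : K, P.eval s * s ^ (p ^ e - 1 - j)) ^ p ^ i =
      ∑ s : K, Q.eval s * s ^ (p ^ e - 1 - r) := by
    rw [sum_pow_char_pow]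
    refine Finset.sum_congr rfl fun s _ => ?_
    rw [mul_pow, hQf, hPf, ← pow_mul]
    by_cases hs : s = 0
    · subst hs
      rw [zero_pow (show p ^ e - 1 - r ≠ 0 by omega), zero_pow]
      exact mul_ne_zero (by omega) (pow_ne_zero _ (Fact.out : p.Prime).ne_zero)
    · congr 1
      have hs1 : s ^ (p ^ e - 1) = 1 := by
        rw [← hK]; exact FiniteField.pow_card_sub_one_eq_one s hs
      refine pow_eq_pow_of_modEq (n := p ^ e - 1) ?_ hs1
      refine Nat.ModEq.add_right_cancel (hjr.trans rfl : p ^ i * j ≡ r [MOD (p ^ e - 1)]) ?_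
      rw [mul_comm (p ^ i) j, ← add_mul, Nat.sub_add_cancel hj'.le, Nat.sub_add_cancel hr'.le]
      exact ((Nat.modEq_zero_iff_dvd).2 (dvd_mul_right _ _)).trans
        ((Nat.modEq_zero_iff_dvd).2 dvd_rfl).symm
  have hodd : Odd (p ^ i) := Odd.pow ⟨h, hp⟩
  rw [h1, h2, hodd.neg_pow] at h3
  exact (neg_injective h3).symm

include hfg hf

theorem exists_polynomial_repDigit {r l : ℕ} (hl : l ≤ h) (hr : r < e ∨ (r ≤ e ∧ l = 0)) :
    ∃ P : K[X], P.natDegree ≤ repDigit p h e ∧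
      ∀ s, P.eval s = f s ^ (repDigit p h r + l * p ^ r) := by
  have h1 := choose_repDigit_ne_zero hp le_rfl hl r e hr
  refine exists_polynomial_pow (by rw [hK, two_mul_repDigit hp]) hfg hf (not_lt.1 fun hlt => ?_)
    (by rwa [Ne, CharP.cast_eq_zero_iff K p])
  rw [Nat.choose_eq_zero_of_lt hlt] at h1
  exact h1 (dvd_zero p)

/-- As functions, `f^((q-1)/2)` is the product of the `(P i)^h`, and it has a polynomial of degree
at most `(q-1)/2`. The inequality is the comparison of degrees, once the identity of functions is
known to be one of polynomials. -/
theorem exists_frobenius_polynomials : ∃ P : ℕ → K[X],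
    (∀ i < e, (P i).natDegree ≤ repDigit p h e ∧ ∀ s, (P i).eval s = f s ^ p ^ i) ∧
    h * ∑ i ∈ Finset.range e, (P i).natDegree ≤ repDigit p h e := by
  have hpp : p.Prime := Fact.out
  have hh : 1 ≤ h := by have := hpp.two_le; omega
  have hm := two_mul_repDigit hp e
  have hex : ∀ i, ∃ P : K[X], i < e → P.natDegree ≤ repDigit p h e ∧
      ∀ s, P.eval s = f s ^ p ^ i := fun i => by
    by_cases hi : i < e
    · have h1 := choose_repDigit_ne_zero hp (Nat.zero_le h) hh i e (Or.inl hi)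
      rw [repDigit_zero, zero_add, one_mul] at h1
      obtain ⟨P, hP⟩ := exists_polynomial_pow (by rw [hK, hm]) hfg hf
        (not_lt.1 fun hlt => h1 (by rw [Nat.choose_eq_zero_of_lt hlt]; exact dvd_zero p))
        (by rwa [Ne, CharP.cast_eq_zero_iff K p])
      exact ⟨P, fun _ => hP⟩
    · exact ⟨0, fun h => absurd h hi⟩
  choose P hP using hex
  refine ⟨P, hP, ?_⟩
  -- The product is built one factor at a time. Every partial exponent has admissible digits, so the
  -- partial product has degree at most `(q-1)/2`; one more factor keeps the degree below `q`, where
  -- functions determine polynomials.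
  have key : ∀ r l, l ≤ h → (r < e ∨ (r ≤ e ∧ l = 0)) → ∃ Q : K[X], Q ≠ 0 ∧
      Q.natDegree ≤ repDigit p h e ∧ (∀ s, Q.eval s = f s ^ (repDigit p h r + l * p ^ r)) ∧
      Q.natDegree = h * ∑ i ∈ Finset.range r, (P i).natDegree + l * (P r).natDegree := by
    have hlt : ∀ P : K[X], P.natDegree ≤ 2 * repDigit p h e → P.natDegree < Fintype.card K :=
      fun P hP => by rw [hK, ← hm]; omega
    have h0 : ∀ Q : K[X], ∀ j, (∀ s, Q.eval s = f s ^ j) → Q ≠ 0 := fun Q j hQ hQ0 => by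
      have := hQ (g 1)
      simp [hQ0, hfg] at this
    have base : ∃ Q : K[X], Q ≠ 0 ∧
        Q.natDegree ≤ repDigit p h e ∧ (∀ s, Q.eval s = f s ^ (repDigit p h 0 + 0 * p ^ 0)) ∧
        Q.natDegree = h * ∑ i ∈ Finset.range 0, (P i).natDegree + 0 * (P 0).natDegree :=
      ⟨1, one_ne_zero, by simp, by simp [repDigit], by simp⟩
    have step : ∀ r, (∃ Q : K[X], Q ≠ 0 ∧
        Q.natDegree ≤ repDigit p h e ∧ (∀ s, Q.eval s = f s ^ (repDigit p h r + 0 * p ^ r)) ∧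
        Q.natDegree = h * ∑ i ∈ Finset.range r, (P i).natDegree + 0 * (P r).natDegree) →
        ∀ l, l ≤ h → (r < e ∨ (r ≤ e ∧ l = 0)) → ∃ Q : K[X], Q ≠ 0 ∧
        Q.natDegree ≤ repDigit p h e ∧ (∀ s, Q.eval s = f s ^ (repDigit p h r + l * p ^ r)) ∧
        Q.natDegree = h * ∑ i ∈ Finset.range r, (P i).natDegree + l * (P r).natDegree := by
      intro r hr l
      induction l with
      | zero => exact fun _ _ => hr
      | succ l ih =>
        intro hl hre
        have hre' : r < e := by omega
        obtain ⟨Q, hQ0, hQ1, hQ2, hQ3⟩ := ih (by omega) (Or.inl hre')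
        obtain ⟨hP1, hP2⟩ := hP r hre'
        obtain ⟨R, hR1, hR2⟩ := exists_polynomial_repDigit hp hK hfg hf hl hre
        have hRQ : R = Q * P r := by
          refine polynomial_ext_of_eval (hlt _ (by omega))
            (hlt _ (natDegree_mul_le.trans (by omega))) fun s => ?_
          rw [hR2, eval_mul, hQ2, hP2, ← pow_add]
          congr 1; ring
        refine ⟨R, h0 R _ hR2, hR1, hR2, ?_⟩
        rw [hRQ, natDegree_mul hQ0 (h0 _ _ hP2), hQ3]
        ring
    intro r
    induction r with
    | zero => exact step 0 base
    | succ r ih =>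
      intro l hl hre
      refine step (r + 1) ?_ l hl hre
      obtain ⟨Q, hQ0, hQ1, hQ2, hQ3⟩ := ih h le_rfl (Or.inl (by omega))
      refine ⟨Q, hQ0, hQ1, fun s => ?_, ?_⟩
      · rw [hQ2, repDigit_succ', zero_mul, add_zero]
      · rw [hQ3, Finset.sum_range_succ]; ring
  obtain ⟨Q, -, h1, -, h2⟩ := key e 0 (Nat.zero_le _) (Or.inr ⟨le_rfl, rfl⟩)
  rw [zero_mul, add_zero] at h2
  exact h2 ▸ h1


/-- If `j` is an exponent of `P 0`, its cyclic shift `r i = p^i j mod (q-1)` is an exponent of `P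
i`, so `r i ≤ deg P i`. Summing `p r_i = r_{i+1} + (q-1) t_i` around the cycle gives `2h ∑ r_i ≥ q -
1 ≥ 2h ∑ deg P_i`. Equality holds throughout, and `j = deg P 0` is the only exponent. -/
theorem exists_eq_monomial (h0 : f 0 = 0) :
    ∃ (c : K) (D : ℕ), c ≠ 0 ∧ 0 < D ∧ D ≤ repDigit p h e ∧ ∀ s, f s = c * s ^ D := by
  have hpp : p.Prime := Fact.out
  have hm := two_mul_repDigit hp e
  have he : 0 < e := by
    rcases Nat.eq_zero_or_pos e with he | he
    · have := Fintype.one_lt_card (α := K)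
      rw [hK, he] at this
      simp at this
    · exact he
  obtain ⟨P, hP, hsum⟩ := exists_frobenius_polynomials hp hK hfg hf
  have hPf : ∀ s, (P 0).eval s = f s := fun s => by simpa using (hP 0 he).2 s
  set N := p ^ e - 1 with hN
  have hcop : ∀ i, Nat.Coprime N (p ^ i) := fun i => by
    apply Nat.Coprime.pow_right
    have h1 : Nat.Coprime (p ^ e - 1) (p ^ e) := by
      have := Nat.coprime_self_add_right (m := p ^ e - 1) (n := 1)
      rw [Nat.sub_add_cancel (by omega)] at this
      simpa using this
    exact Nat.Coprime.coprime_dvd_right (dvd_pow_self p he.ne') h1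
  have main : ∀ j, (P 0).coeff j ≠ 0 → 0 < j ∧ j = (P 0).natDegree := by
    intro j hj
    have hj0 : 0 < j := Nat.pos_of_ne_zero fun hj0 => hj (by
      rw [hj0, coeff_zero_eq_eval_zero, hPf, h0])
    have hjD : j ≤ (P 0).natDegree := le_natDegree_of_ne_zero hj
    have hjN : j < N := by
      have := (hP 0 he).1
      omega
    refine ⟨hj0, ?_⟩
    set r : ℕ → ℕ := fun i => p ^ i * j % N with hr
    have hr0 : r 0 = j := by simp [hr, Nat.mod_eq_of_lt hjN]
    -- The cycle closes because `p^e = N + 1`.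
    have hre : r e = r 0 := by
      have h1 : p ^ e = N + 1 := by omega
      simp only [hr, h1, pow_zero, add_mul, Nat.mul_add_mod]
    have hrpos : ∀ i, 0 < r i := fun i => Nat.pos_of_ne_zero fun hi => by
      have h1 := (hcop i).dvd_of_dvd_mul_left (Nat.dvd_of_mod_eq_zero hi)
      exact absurd (Nat.le_of_dvd hj0 h1) (by omega)
    have hrD : ∀ i ∈ Finset.range e, r i ≤ (P i).natDegree := fun i hi => by
      have hi' := Finset.mem_range.1 hi
      apply le_natDegree_of_ne_zero
      rw [coeff_frobenius hp hK (hP 0 he).1 hPf (hP i hi').1 (hP i hi').2 hj0 hjN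
        (hrpos i) (Nat.mod_lt _ (by omega)) (Nat.mod_modEq _ _).symm]
      exact pow_ne_zero _ hj
    have hstep : ∀ i, ∃ t, p * r i = r (i + 1) + N * t := fun i => by
      have h1 : p * r i ≡ r (i + 1) [MOD N] := by
        refine ((Nat.mod_modEq _ _).mul_left p).trans ?_
        rw [← mul_assoc, ← pow_succ']
        exact (Nat.mod_modEq _ _).symm
      refine ⟨p * r i / N, ?_⟩
      have h2 : p * r i % N = r (i + 1) := by
        rw [h1, Nat.mod_eq_of_lt (Nat.mod_lt _ (by omega))]
      rw [← h2, Nat.mod_add_div]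
    choose t ht using hstep
    have h1 : p * ∑ i ∈ Finset.range e, r i =
        ∑ i ∈ Finset.range e, r i + N * ∑ i ∈ Finset.range e, t i := by
      have h2 : ∑ i ∈ Finset.range e, r (i + 1) = ∑ i ∈ Finset.range e, r i := by
        have h3 := Finset.sum_range_succ r e
        rw [Finset.sum_range_succ', hre] at h3
        omega
      rw [Finset.mul_sum, Finset.sum_congr rfl fun i _ => ht i, Finset.sum_add_distrib, h2,
        ← Finset.mul_sum]
    have hle := Finset.sum_le_sum hrD
    have hpos : 0 < ∑ i ∈ Finset.range e, r i :=
      Finset.sum_pos (fun i _ => hrpos i) ⟨0, Finset.mem_range.2 he⟩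
    have ht1 : 1 ≤ ∑ i ∈ Finset.range e, t i := Nat.one_le_iff_ne_zero.2 fun h3 => by
      rw [h3, mul_zero, add_zero] at h1
      have := hpp.two_le
      nlinarith
    have h4 : 2 * h * ∑ i ∈ Finset.range e, (P i).natDegree ≤
        2 * h * ∑ i ∈ Finset.range e, r i := by
      have h5 : 2 * h * ∑ i ∈ Finset.range e, r i = N * ∑ i ∈ Finset.range e, t i := by
        rw [hp, add_mul, one_mul] at h1
        omega
      rw [h5]
      calc _ = 2 * (h * ∑ i ∈ Finset.range e, (P i).natDegree) := by ring
        _ ≤ N := by omega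
        _ ≤ _ := Nat.le_mul_of_pos_right _ ht1
    have hh : 0 < 2 * h := by have := hpp.two_le; omega
    have h5 := Nat.le_of_mul_le_mul_left h4 hh
    have h6 := (Finset.sum_eq_sum_iff_of_le hrD).1 (le_antisymm hle h5) 0 (Finset.mem_range.2 he)
    rw [← hr0, h6]
  have hP0 : P 0 ≠ 0 := fun h1 => by
    have := hPf (g 1)
    simp [h1, hfg] at this
  have hlc : (P 0).coeff (P 0).natDegree ≠ 0 := leadingCoeff_ne_zero.2 hP0
  refine ⟨_, _, hlc, (main _ hlc).1, (hP 0 he).1, fun s => ?_⟩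
  rw [← hPf, eval_eq_sum_range, Finset.sum_eq_single (P 0).natDegree]
  · intro j _ hj
    by_cases h1 : (P 0).coeff j = 0
    · rw [h1, zero_mul]
    · exact absurd (main j h1).2 hj
  · intro h1
    exact absurd (Finset.mem_range.2 (Nat.lt_succ_self _)) h1

end PrimePower

/-- **Carlitz's theorem**: a permutation of a finite field of odd order fixing `0` and preserving
the quadratic character of differences is a scalar multiple of a field automorphism. -/
theorem carlitz {K : Type*} [Field K] [Fintype K] [DecidableEq K] (hK : ringChar K ≠ 2)
    {f g : K → K} (hfg : ∀ t, f (g t) = t)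
    (h0 : f 0 = 0) (hf : ∀ s c, quadraticChar K (f s - f c) = quadraticChar K (s - c)) :
    ∃ (a : K) (τ : K ≃+* K), a ≠ 0 ∧ ∀ s, f s = a * τ s := by
  obtain ⟨p, hchar⟩ := CharP.exists K
  obtain ⟨e, hpp, hcard⟩ := FiniteField.card K p
  have : Fact p.Prime := ⟨hpp⟩
  obtain ⟨h, hp⟩ : Odd p := hpp.odd_of_ne_two fun h2 => hK (by rw [ringChar.eq K p, h2])
  have hm := two_mul_repDigit hp (e : ℕ)
  have hm' : Fintype.card K / 2 = repDigit p h e := by omega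
  have hpow : ∀ x y : K, quadraticChar K x = quadraticChar K y →
      x ^ repDigit p h e = y ^ repDigit p h e := fun x y hxy => by
    rw [← hm', ← quadraticChar_eq_pow_of_char_ne_two' hK, hxy,
      quadraticChar_eq_pow_of_char_ne_two' hK]
  obtain ⟨c, D, hc, hD, hDm, hfc⟩ := exists_eq_monomial hp hcard hfg
    (fun s c => hpow _ _ (hf s c)) h0
  -- The translate `s ↦ f (s + 1) - f 1` satisfies the same hypotheses, so it is a monomial as well.
  obtain ⟨c', D', hc', hD', hDm', hfc'⟩ := exists_eq_monomial (f := fun s => f (s + 1) - f 1)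
    (g := fun t => g (t + f 1) - 1) hp hcard (fun t => by simp [hfg])
    (fun s c => hpow _ _ (by rw [sub_sub_sub_cancel_right, hf, add_sub_add_right_eq_sub]))
    (by simp)
  have hinj : Function.Injective f := fun x y hxy => by
    have := hf x y
    rw [hxy, sub_self, quadraticChar_zero, eq_comm, quadraticChar_eq_zero_iff] at this
    exact sub_eq_zero.1 this
  have hpoly : C c * (X + C 1) ^ D - C c = C c' * X ^ D' := by
    have hd : ((C c * (X + C 1) ^ D - C c : K[X])).natDegree ≤ D := by
      refine (natDegree_sub_le _ _).trans (max_le ?_ (by simp))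
      refine (natDegree_C_mul_le _ _).trans (natDegree_pow_le.trans ?_)
      rw [natDegree_X_add_C, mul_one]
    refine polynomial_ext_of_eval (by omega)
      ((natDegree_C_mul_X_pow_le _ _).trans_lt (by omega)) fun s => ?_
    have := hfc' s
    simp only [hfc] at this
    simpa using this
  -- The coefficient of degree `D` in `c (X+1)^D - c = c' X^D'` is `c ≠ 0`; this forces `D = D'` and
  -- `c = c'`.
  have hadd1 : ∀ s : K, (s + 1) ^ D = s ^ D + 1 := by
    have hcoeff := congrArg (fun P => coeff P D) hpoly
    simp only [coeff_sub, coeff_C_mul, coeff_C, hD.ne', if_false, sub_zero, coeff_X_pow] at hcoeff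
    have h1 : ((X + C 1 : K[X]) ^ D).coeff D = 1 := by
      have := (monic_X_add_C (1 : K)).pow D
      have h2 := this.coeff_natDegree
      rwa [natDegree_pow, natDegree_X_add_C, mul_one] at h2
    rw [h1] at hcoeff
    by_cases hDD : D = D'
    · subst hDD
      rw [if_pos rfl, mul_one, mul_one] at hcoeff
      subst hcoeff
      intro s
      have := congrArg (eval s) hpoly
      simp only [eval_sub, eval_mul, eval_C, eval_pow, eval_add, eval_X] at this
      apply mul_left_cancel₀ hc
      linear_combination this
    · rw [if_neg hDD, mul_zero, mul_one] at hcoeff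
      exact absurd hcoeff hc
  have hadd : ∀ s t : K, (s + t) ^ D = s ^ D + t ^ D := fun s t => by
    by_cases ht : t = 0
    · rw [ht, add_zero, zero_pow hD.ne', add_zero]
    · have h1 := hadd1 (s / t)
      have h2 : s + t = t * (s / t + 1) := by field_simp
      rw [h2, mul_pow, h1, div_pow]
      field_simp
  let τ : K →+* K :=
    { toFun := fun s => s ^ D
      map_one' := one_pow D
      map_mul' := fun s t => mul_pow s t D
      map_zero' := zero_pow hD.ne'
      map_add' := hadd }
  exact ⟨c, RingEquiv.ofBijective τ (Finite.injective_iff_bijective.1 τ.injective), hc, hfc⟩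

end SympCover

namespace SympCover

/-! ## Quadratic forms over finite fields of order `1 mod 4` -/

open Matrix

section Squares

variable {K : Type*} [Field K] [Finite K]

theorem isSquare_neg_one_of_card (hq : Nat.card K % 4 = 1) : IsSquare (-1 : K) := by
  have := Fintype.ofFinite K
  rw [FiniteField.isSquare_neg_one_iff, ← Nat.card_eq_fintype_card]
  omega

theorem two_ne_zero_of_card (hq : Nat.card K % 4 = 1) : (2 : K) ≠ 0 := by
  have := Fintype.ofFinite K
  intro h
  have h1 : ringChar K = 2 := (CharP.ringChar_of_prime_eq_zero Nat.prime_two (by exact_mod_cast h))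
  have h2 := FiniteField.even_card_of_char_two h1
  rw [← Nat.card_eq_fintype_card] at h2
  omega

theorem ringChar_ne_two_of_card (hq : Nat.card K % 4 = 1) : ringChar K ≠ 2 := fun h => by
  have h1 := ringChar.Nat.cast_ringChar (R := K)
  rw [h] at h1
  exact two_ne_zero_of_card hq (by exact_mod_cast h1)

theorem exists_not_isSquare (hq : Nat.card K % 4 = 1) : ∃ x : K, ¬ IsSquare x :=
  have := Fintype.ofFinite K
  FiniteField.exists_nonsquare (ringChar_ne_two_of_card hq)

/-- If `d ≠ 0`, then `d` is a nonzero square and every sum of two squares is a square. Since `-1` is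
a square, every element is a sum of two squares, contradicting the existence of nonsquares. -/
theorem eq_zero_of_isSquare_sq_add (hq : Nat.card K % 4 = 1) {d : K}
    (hd : ∀ z : K, IsSquare (z ^ 2 + d)) : d = 0 := by
  by_contra hd0
  have h2 := two_ne_zero_of_card hq
  obtain ⟨i, hi⟩ := isSquare_neg_one_of_card hq
  obtain ⟨x, hx⟩ := exists_not_isSquare hq
  obtain ⟨e, he⟩ := hd 0
  have he' : d = e * e := by simpa using he
  have he0 : e ≠ 0 := fun h => hd0 (by rw [he', h, mul_zero])
  have hadd : ∀ a b : K, IsSquare (a ^ 2 + b ^ 2) := fun a b => by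
    by_cases hb : b = 0
    · exact ⟨a, by rw [hb]; ring⟩
    · obtain ⟨c, hc⟩ := hd (a * e / b)
      refine ⟨c * b / e, ?_⟩
      rw [he'] at hc
      field_simp at hc ⊢
      linear_combination hc
  apply hx
  -- The identity `x = ((x+1)/2)² - ((x-1)/2)²`, with the minus sign absorbed by `i² = -1`.
  have := hadd ((x + 1) / 2) (i * (x - 1) / 2)
  convert this using 1
  field_simp
  linear_combination ((x - 1) ^ 2) * hi

/-- A quadratic polynomial with square values only has zero discriminant: complete the square, or,
if `a = 0`, use that a nonconstant linear polynomial takes every value. -/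
theorem sq_eq_of_isSquare_quadratic (hq : Nat.card K % 4 = 1) {a b c : K}
    (h : ∀ s : K, IsSquare (a ^ 2 * s ^ 2 + 2 * b * s + c ^ 2)) : b ^ 2 = a ^ 2 * c ^ 2 := by
  have h2 := two_ne_zero_of_card hq
  by_cases ha : a = 0
  · have hb : b = 0 := by
      by_contra hb
      obtain ⟨x, hx⟩ := exists_not_isSquare hq
      apply hx
      convert h ((x - c ^ 2) / (2 * b)) using 1
      rw [ha]
      field_simp
      ring
    rw [ha, hb]; ring
  · have h1 : c ^ 2 - b ^ 2 / a ^ 2 = 0 := eq_zero_of_isSquare_sq_add hq fun z => by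
      convert h ((z - b / a) / a) using 1
      field_simp
      ring
    field_simp at h1
    linear_combination -h1

end Squares

section Vectors

variable {K : Type*} [Field K] {ι : Type*}

theorem isSymm_vecMulVec_self (x : ι → K) : (vecMulVec x x).IsSymm := by
  rw [IsSymm, transpose_vecMulVec]

theorem isSymm_vecMulVec_add (x z : ι → K) : (vecMulVec x z + vecMulVec z x).IsSymm := by
  rw [IsSymm, transpose_add, transpose_vecMulVec, transpose_vecMulVec, add_comm]

variable [Fintype ι]

theorem exists_smul_eq_of_dotProduct {a b : ι → K} (ha : a ≠ 0)
    (h : ∀ x : ι → K, a ⬝ᵥ x = 0 → b ⬝ᵥ x = 0) : ∃ r : K, b = r • a := by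
  classical
  obtain ⟨i, hi⟩ := Function.ne_iff.1 ha
  refine ⟨b i / a i, funext fun j => ?_⟩
  have h1 := h (Pi.single j (a i) - Pi.single i (a j)) (by
    simp [dotProduct_sub]; ring)
  simp only [dotProduct_sub, dotProduct_single] at h1
  simp only [Pi.zero_apply] at hi
  simp only [Pi.smul_apply, smul_eq_mul]
  field_simp
  linear_combination h1

theorem exists_dotProduct_ne_zero {a : ι → K} (ha : a ≠ 0) : ∃ x : ι → K, a ⬝ᵥ x ≠ 0 := by
  by_contra! h
  exact ha (dotProduct_eq_zero a h)

theorem exists_dotProduct_ne_zero₂ {a b : ι → K} (ha : a ≠ 0) (hb : b ≠ 0) :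
    ∃ x : ι → K, a ⬝ᵥ x ≠ 0 ∧ b ⬝ᵥ x ≠ 0 := by
  obtain ⟨x, hx⟩ := exists_dotProduct_ne_zero ha
  obtain ⟨y, hy⟩ := exists_dotProduct_ne_zero hb
  by_cases h1 : b ⬝ᵥ x = 0
  · by_cases h2 : a ⬝ᵥ y = 0
    · exact ⟨x + y, by simpa [dotProduct_add, h2] using hx, by simpa [dotProduct_add, h1] using hy⟩
    · exact ⟨y, h2, hy⟩
  · exact ⟨x, hx, h1⟩

/-- The value at `u` of the quadratic form with matrix `A`. -/
def qform (A : Matrix ι ι K) (u : ι → K) : K := u ⬝ᵥ A *ᵥ u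

theorem qform_add (A B : Matrix ι ι K) (u : ι → K) : qform (A + B) u = qform A u + qform B u := by
  simp [qform, add_mulVec, dotProduct_add]

theorem qform_sub (A B : Matrix ι ι K) (u : ι → K) : qform (A - B) u = qform A u - qform B u := by
  simp [qform, sub_mulVec, dotProduct_sub]

theorem qform_smul_matrix (c : K) (A : Matrix ι ι K) (u : ι → K) :
    qform (c • A) u = c * qform A u := by
  simp [qform, smul_mulVec]

theorem qform_smul (c : K) (A : Matrix ι ι K) (u : ι → K) :
    qform A (c • u) = c ^ 2 * qform A u := by
  simp [qform, mulVec_smul]; ring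

@[simp] theorem qform_zero (u : ι → K) : qform (0 : Matrix ι ι K) u = 0 := by
  simp [qform]

@[simp] theorem qform_zero_right (A : Matrix ι ι K) : qform A 0 = 0 := by
  simp [qform]

theorem qform_vecMulVec (x z u : ι → K) :
    qform (vecMulVec x z) u = (x ⬝ᵥ u) * (z ⬝ᵥ u) := by
  rw [qform, vecMulVec_mulVec]
  simp [dotProduct_comm u x, mul_comm]

theorem qform_add_smul {A : Matrix ι ι K} (hA : A.IsSymm) (u v : ι → K) (s : K) :
    qform A (u + s • v) = qform A v * s ^ 2 + 2 * (v ⬝ᵥ A *ᵥ u) * s + qform A u := by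
  have h1 : u ⬝ᵥ A *ᵥ v = v ⬝ᵥ A *ᵥ u := by
    rw [dotProduct_mulVec, ← mulVec_transpose, hA.eq, dotProduct_comm]
  simp only [qform, mulVec_add, mulVec_smul, dotProduct_add, add_dotProduct, dotProduct_smul,
    smul_dotProduct, smul_eq_mul, h1]
  ring

theorem eq_zero_of_qform_eq_zero (h2 : (2 : K) ≠ 0) {A : Matrix ι ι K} (hA : A.IsSymm)
    (h : ∀ u, qform A u = 0) : A = 0 := by
  classical
  ext i j
  have h1 := qform_add_smul hA (Pi.single j 1) (Pi.single i 1) 1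
  simp only [h, zero_mul, mul_one, zero_add, add_zero] at h1
  have h3 := (mul_eq_zero.1 h1.symm).resolve_left h2
  simpa using h3

theorem eq_of_qform_eq (h2 : (2 : K) ≠ 0) {A B : Matrix ι ι K} (hA : A.IsSymm) (hB : B.IsSymm)
    (h : ∀ u, qform A u = qform B u) : A = B :=
  sub_eq_zero.1 (eq_zero_of_qform_eq_zero h2 (hA.sub hB) fun u => by
    rw [qform_sub, h, sub_self])

open Polynomial in
/-- A product of two nonzero quadratic forms over a field with at least five elements does not
vanish identically. -/
theorem eq_zero_or_eq_zero_of_qform_mul [Fintype K] (hq : 5 ≤ Fintype.card K) (h2 : (2 : K) ≠ 0)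
    {A B : Matrix ι ι K} (hA : A.IsSymm) (hB : B.IsSymm) (h : ∀ u, qform A u * qform B u = 0) :
    A = 0 ∨ B = 0 := by
  by_contra! hAB
  obtain ⟨u, hu⟩ : ∃ u, qform A u ≠ 0 := by
    by_contra! h1
    exact hAB.1 (eq_zero_of_qform_eq_zero h2 hA h1)
  obtain ⟨v, hv⟩ : ∃ v, qform B v ≠ 0 := by
    by_contra! h1
    exact hAB.2 (eq_zero_of_qform_eq_zero h2 hB h1)
  let P : K[X] := C (qform A v) * X ^ 2 + C (2 * (v ⬝ᵥ A *ᵥ u)) * X + C (qform A u)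
  let Q : K[X] := C (qform B v) * X ^ 2 + C (2 * (v ⬝ᵥ B *ᵥ u)) * X + C (qform B u)
  have hP : P ≠ 0 := fun h1 => hu (by simpa [P] using congrArg (Polynomial.eval 0) h1)
  have hQ : Q ≠ 0 := fun h1 => hv (by
    have h3 := congrArg (fun R => coeff R 2) h1
    simpa [Q, coeff_X, coeff_C] using h3)
  have hdeg : (P * Q).natDegree ≤ 2 + 2 :=
    natDegree_mul_le_of_le natDegree_quadratic_le natDegree_quadratic_le
  -- On the line `u + s v` the product is a polynomial of degree at most `4 < q` with all values
  -- zero.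
  refine mul_ne_zero hP hQ (polynomial_ext_of_eval (by omega) (by simp; omega) fun s => ?_)
  have h1 := h (u + s • v)
  rw [qform_add_smul hA, qform_add_smul hB] at h1
  simpa [P, Q] using h1

end Vectors

end SympCover

namespace SympCover

open Matrix

/-! ## Maps of symmetric matrices compatible with the quadratic character -/

section SymmetricMaps

variable {K : Type*} [Field K] {ι : Type*} [Fintype ι]

/-- Independence gives `x` orthogonal to `a` but not to `b`, and `y` orthogonal to `b` but not to
`a`; a combination of `y yᵀ` and `x xᵀ` then has the two prescribed values. -/
theorem exists_isSymm_qform_eq {a b : ι → K} (ha : a ≠ 0) (hb : b ≠ 0)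
    (h : ∀ r : K, b ≠ r • a) (α β : K) :
    ∃ A : Matrix ι ι K, A.IsSymm ∧ qform A a = α ∧ qform A b = β := by
  obtain ⟨x, hx, hx'⟩ : ∃ x, a ⬝ᵥ x = 0 ∧ b ⬝ᵥ x ≠ 0 := by
    by_contra! h1
    obtain ⟨r, hr⟩ := exists_smul_eq_of_dotProduct ha h1
    exact h r hr
  obtain ⟨y, hy, hy'⟩ : ∃ y, b ⬝ᵥ y = 0 ∧ a ⬝ᵥ y ≠ 0 := by
    by_contra! h1
    obtain ⟨r, hr⟩ := exists_smul_eq_of_dotProduct hb h1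
    have hr0 : r ≠ 0 := fun h0 => ha (by rw [hr, h0, zero_smul])
    exact h r⁻¹ (by rw [hr, smul_smul, inv_mul_cancel₀ hr0, one_smul])
  rw [dotProduct_comm] at hx hx' hy hy'
  refine ⟨(α / (y ⬝ᵥ a) ^ 2) • vecMulVec y y + (β / (x ⬝ᵥ b) ^ 2) • vecMulVec x x,
    ((isSymm_vecMulVec_self y).smul _).add ((isSymm_vecMulVec_self x).smul _), ?_, ?_⟩
  · rw [qform_add, qform_smul_matrix, qform_smul_matrix, qform_vecMulVec, qform_vecMulVec, hx]
    field_simp; ring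
  · rw [qform_add, qform_smul_matrix, qform_smul_matrix, qform_vecMulVec, qform_vecMulVec, hy]
    field_simp; ring

theorem exists_isSymm_qform_eq₁ {a : ι → K} (ha : a ≠ 0) (α : K) :
    ∃ A : Matrix ι ι K, A.IsSymm ∧ qform A a = α := by
  obtain ⟨x, hx⟩ := exists_dotProduct_ne_zero ha
  rw [dotProduct_comm] at hx
  refine ⟨(α / (x ⬝ᵥ a) ^ 2) • vecMulVec x x, (isSymm_vecMulVec_self x).smul _, ?_⟩
  rw [qform_smul_matrix, qform_vecMulVec]
  field_simp

variable [Fintype K] [DecidableEq K]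

/-- If a permutation `f` of the symmetric matrices is compatible with the functions
`A ↦ χ(uᵀ A u - c)`, then each of the quadratic values `uᵀ f(A) u` is the image under a field
automorphism of some quadratic value of `A`. -/
theorem exists_ringEquiv_qform (hq : Nat.card K % 4 = 1) {f : Matrix ι ι K → Matrix ι ι K}
    (h0 : f 0 = 0) (hsurj : ∀ B : Matrix ι ι K, B.IsSymm → ∃ A, A.IsSymm ∧ f A = B)
    (hf : ∀ u : ι → K, u ≠ 0 → ∀ c : K, ∃ u' : ι → K, u' ≠ 0 ∧ ∃ c' : K, ∀ A : Matrix ι ι K,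
      A.IsSymm → quadraticChar K (qform (f A) u - c) = quadraticChar K (qform A u' - c'))
    (u : ι → K) (hu : u ≠ 0) :
    ∃ u' : ι → K, u' ≠ 0 ∧ ∃ τ : K ≃+* K, ∀ A : Matrix ι ι K, A.IsSymm →
      qform (f A) u = τ (qform A u') := by
  have h0iff : ∀ x y : K, quadraticChar K x = quadraticChar K y → (x = 0 ↔ y = 0) :=
    fun x y h => by rw [← quadraticChar_eq_zero_iff, h, quadraticChar_eq_zero_iff]
  choose v hv d hd using hf u hu
  -- If `v c` and `v 0` were independent, some `A` would make both right-hand sides vanish, so that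
  -- `qform (f A) u` would equal both `0` and `c`.
  have hprop : ∀ c, ∃ r : K, v c = r • v 0 := fun c => by
    by_contra! h1
    by_cases hc : c = 0
    · exact h1 1 (by rw [hc, one_smul])
    obtain ⟨A, hA, hA1, hA2⟩ := exists_isSymm_qform_eq (hv 0) (hv c) h1 (d 0) (d c)
    have h2 := (h0iff _ _ (hd 0 A hA)).2 (sub_eq_zero.2 hA1)
    have h3 := (h0iff _ _ (hd c A hA)).2 (sub_eq_zero.2 hA2)
    exact hc (sub_right_injective (h3.trans h2.symm))
  choose r hr using hprop
  have hr0 : ∀ c, r c ≠ 0 := fun c h1 => hv c (by rw [hr, h1, zero_smul])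
  -- Rescaling `v c` to `v 0` changes the threshold by a square factor. The resulting `φ` preserves
  -- the quadratic character of differences and is surjective, as Carlitz's theorem requires.
  set φ : K → K := fun c => d c / r c ^ 2 with hφ
  have hchi : ∀ c (A : Matrix ι ι K), A.IsSymm →
      quadraticChar K (qform (f A) u - c) = quadraticChar K (qform A (v 0) - φ c) := fun c A hA => by
    rw [hd c A hA, hr, qform_smul]
    have h1 : r c ^ 2 * qform A (v 0) - d c = r c ^ 2 * (qform A (v 0) - φ c) := by
      have := hr0 c
      rw [hφ]; field_simp
    rw [h1, map_mul, quadraticChar_sq_one' (hr0 c), one_mul]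
  have hval : ∀ A : Matrix ι ι K, A.IsSymm → qform A (v 0) = φ (qform (f A) u) := fun A hA =>
    sub_eq_zero.1 ((h0iff _ _ (hchi _ A hA)).1 (sub_self _))
  have hex : ∀ t, ∃ A : Matrix ι ι K, A.IsSymm ∧ qform A (v 0) = t :=
    exists_isSymm_qform_eq₁ (hv 0)
  choose M hM hMt using hex
  obtain ⟨a, τ, ha, hτ⟩ := carlitz (K := K) (ringChar_ne_two_of_card hq) (f := φ)
    (g := fun t => qform (f (M t)) u) (fun t => by rw [← hval _ (hM t), hMt])
    (by simpa [h0] using (hval 0 (by simp [IsSymm])).symm) (fun s c => by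
      obtain ⟨B, hB, hBs⟩ := exists_isSymm_qform_eq₁ hu s
      obtain ⟨A, hA, rfl⟩ := hsurj B hB
      rw [← hBs, hchi c A hA, hval A hA])
  -- Comparing the values `1` and `0` gives `χ(a) = χ(1)`; the square root of `a` is then absorbed
  -- into the vector.
  have hasq : IsSquare a := by
    obtain ⟨B, hB, hBs⟩ := exists_isSymm_qform_eq₁ hu 1
    obtain ⟨A, hA, rfl⟩ := hsurj B hB
    have h1 := hchi 0 A hA
    rw [hval A hA, hBs, hτ, hτ, map_zero, mul_zero, sub_zero, sub_zero, map_one τ, mul_one,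
      map_one, eq_comm, quadraticChar_one_iff_isSquare ha] at h1
    exact h1
  obtain ⟨b, rfl⟩ := hasq
  have hb : b ≠ 0 := fun h => ha (by rw [h, mul_zero])
  refine ⟨b⁻¹ • v 0, smul_ne_zero (inv_ne_zero hb) (hv 0), τ.symm, fun A hA => ?_⟩
  rw [qform_smul, hval A hA, hτ, RingEquiv.eq_symm_apply]
  field_simp

end SymmetricMaps

end SympCover

namespace SympCover

open Matrix

section SymmetricMaps

variable {K : Type*} [Field K] {ι : Type*} [Fintype ι]

/-- A map of symmetric matrices each of whose quadratic values is the image under a field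
automorphism of a quadratic value of the argument. -/
structure IsFormMap (f : Matrix ι ι K → Matrix ι ι K) : Prop where
  isSymm : ∀ A, A.IsSymm → (f A).IsSymm
  exists_qform : ∀ u : ι → K, u ≠ 0 → ∃ u' : ι → K, u' ≠ 0 ∧ ∃ τ : K ≃+* K,
    ∀ A : Matrix ι ι K, A.IsSymm → qform (f A) u = τ (qform A u')

namespace IsFormMap

variable {f : Matrix ι ι K → Matrix ι ι K} (hf : IsFormMap f)

include hf

theorem map_add (h2 : (2 : K) ≠ 0) {A B : Matrix ι ι K} (hA : A.IsSymm) (hB : B.IsSymm) :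
    f (A + B) = f A + f B := by
  refine eq_of_qform_eq h2 (hf.isSymm _ (hA.add hB)) ((hf.isSymm _ hA).add (hf.isSymm _ hB))
    fun u => ?_
  by_cases hu : u = 0
  · simp [hu]
  obtain ⟨u', -, τ, hτ⟩ := hf.exists_qform u hu
  rw [qform_add, hτ _ hA, hτ _ hB, hτ _ (hA.add hB), qform_add, _root_.map_add]

theorem map_zero (h2 : (2 : K) ≠ 0) : f 0 = 0 := by
  have h : (0 : Matrix ι ι K).IsSymm := by simp [IsSymm]
  have := hf.map_add h2 h h
  simpa using this

theorem isSquare_qform (x u : ι → K) : IsSquare (qform (f (vecMulVec x x)) u) := by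
  by_cases hu : u = 0
  · simp [hu]
  obtain ⟨u', -, τ, hτ⟩ := hf.exists_qform u hu
  rw [hτ _ (isSymm_vecMulVec_self x), qform_vecMulVec, _root_.map_mul]
  exact ⟨_, rfl⟩

/-- The form `M = f(x xᵀ)` takes only square values, so its restriction to every line has zero
discriminant, and it has rank at most one. -/
theorem exists_vecMulVec [Finite K] (hq : Nat.card K % 4 = 1) (x : ι → K) :
    ∃ y : ι → K, f (vecMulVec x x) = vecMulVec y y := by
  have h2 := two_ne_zero_of_card hq
  have hM := hf.isSymm _ (isSymm_vecMulVec_self x)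
  set M := f (vecMulVec x x) with hMdef
  by_cases hM0 : M = 0
  · exact ⟨0, by rw [hM0]; simp⟩
  obtain ⟨u, hu⟩ : ∃ u, qform M u ≠ 0 := by
    by_contra! h
    exact hM0 (eq_zero_of_qform_eq_zero h2 hM h)
  obtain ⟨a, ha⟩ := hf.isSquare_qform x u
  rw [← hMdef] at ha
  have ha0 : a ≠ 0 := fun h => hu (by rw [ha, h, mul_zero])
  -- For `a² = uᵀMu ≠ 0`, vanishing of the discriminant on the span of `u` and `v` says `vᵀMv =
  -- (uᵀMv / a)²`.
  refine ⟨a⁻¹ • (M *ᵥ u), eq_of_qform_eq h2 hM (isSymm_vecMulVec_self _) fun v => ?_⟩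
  obtain ⟨c, hc⟩ := hf.isSquare_qform x v
  rw [← hMdef] at hc
  have h1 := sq_eq_of_isSquare_quadratic hq (a := a) (b := u ⬝ᵥ M *ᵥ v) (c := c) fun s => by
    have h3 := hf.isSquare_qform x (v + s • u)
    rw [← hMdef, qform_add_smul hM, ha, hc] at h3
    convert h3 using 1; ring
  have h4 : (a⁻¹ • (M *ᵥ u)) ⬝ᵥ v = a⁻¹ * (u ⬝ᵥ M *ᵥ v) := by
    rw [smul_dotProduct, dotProduct_mulVec, ← mulVec_transpose, hM.eq, smul_eq_mul]
  rw [qform_vecMulVec, h4, hc]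
  field_simp
  linear_combination -h1

/-- The field automorphisms attached to the different vectors coincide. -/
theorem exists_uniform [Finite K] (hq : Nat.card K % 4 = 1) :
    ∃ θ : K ≃+* K, ∀ u : ι → K, u ≠ 0 → ∃ u' : ι → K, u' ≠ 0 ∧
      ∀ A : Matrix ι ι K, A.IsSymm → qform (f A) u = θ (qform A u') := by
  have h2 := two_ne_zero_of_card hq
  choose y hy using hf.exists_vecMulVec hq
  choose! u' hu' τ hτ using hf.exists_qform
  have hval : ∀ u ≠ 0, ∀ x, (y x ⬝ᵥ u) ^ 2 = τ u (x ⬝ᵥ u' u) ^ 2 := fun u hu x => by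
    have := hτ u hu _ (isSymm_vecMulVec_self x)
    rw [hy, qform_vecMulVec, qform_vecMulVec, _root_.map_mul] at this
    rw [sq, this, sq]
  have hzero : ∀ u ≠ 0, ∀ x, y x ⬝ᵥ u = 0 ↔ x ⬝ᵥ u' u = 0 := fun u hu x => by
    rw [← pow_eq_zero_iff two_ne_zero, hval u hu, pow_eq_zero_iff two_ne_zero,
      map_eq_zero_iff _ (τ u).injective]
  have huniq : ∀ u v, u ≠ 0 → v ≠ 0 → ∀ t, τ u t = τ v t := fun u v hu hv => by
    obtain ⟨x, hxu, hxv⟩ := exists_dotProduct_ne_zero₂ (hu' u hu) (hu' v hv)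
    rw [dotProduct_comm] at hxu hxv
    have hy0 : y x ≠ 0 := fun h => hxu ((hzero u hu x).1 (by rw [h, zero_dotProduct]))
    -- `y (t x)` and `y x` annihilate the same vectors, so `y (t x) = r (y x)`, and `r² = τ_w(t)²`
    -- for every `w` with `x ⬝ᵥ u' w ≠ 0`.
    have hsq : ∀ t, τ u t ^ 2 = τ v t ^ 2 := fun t => by
      obtain ⟨r, hr⟩ := exists_smul_eq_of_dotProduct (a := y x) (b := y (t • x)) hy0
        fun w hw => by
          by_cases hw0 : w = 0
          · rw [hw0, dotProduct_zero]
          · rw [hzero w hw0, smul_dotProduct, (hzero w hw0 x).1 hw, smul_zero]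
      have key : ∀ w ≠ 0, x ⬝ᵥ u' w ≠ 0 → τ w t ^ 2 = r ^ 2 := fun w hw hxw => by
        have h3 := hval w hw (t • x)
        rw [hr, smul_dotProduct, smul_dotProduct, smul_eq_mul, smul_eq_mul, _root_.map_mul,
          mul_pow, mul_pow, hval w hw x] at h3
        exact (mul_right_cancel₀ (pow_ne_zero 2 ((map_ne_zero_iff _ (τ w).injective).2 hxw))
          h3).symm
      rw [key u hu hxu, key v hv hxv]
    intro t
    -- Equality of squares at `t` and at `t + 1` gives `2 τ_u(t) = 2 τ_v(t)`.
    have h3 := hsq (t + 1)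
    rw [_root_.map_add, _root_.map_add, map_one, map_one] at h3
    apply mul_left_cancel₀ h2
    linear_combination h3 - hsq t
  by_cases h : ∃ u : ι → K, u ≠ 0
  · obtain ⟨v, hv⟩ := h
    exact ⟨τ v, fun u hu => ⟨u' u, hu' u hu, fun A hA => by rw [hτ u hu A hA, huniq u v hu hv]⟩⟩
  · push Not at h
    exact ⟨RingEquiv.refl K, fun u hu => absurd (h u) hu⟩

/-- An injective form map of symmetric matrices is `A ↦ W θ(A) Wᵀ` for some field automorphism
`θ` and some invertible matrix `W`. -/
theorem exists_eq_mul_map_mul [Finite K] [DecidableEq ι] [Nonempty ι] (hq : Nat.card K % 4 = 1)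
    (hinj : ∀ A B : Matrix ι ι K, A.IsSymm → B.IsSymm → f A = f B → A = B) :
    ∃ (W : Matrix ι ι K) (θ : K ≃+* K), IsUnit W ∧
      ∀ A : Matrix ι ι K, A.IsSymm → f A = W * A.map θ * Wᵀ := by
  have := Fintype.ofFinite K
  have h2 := two_ne_zero_of_card hq
  have hcard : 5 ≤ Fintype.card K := by
    rw [Nat.card_eq_fintype_card] at hq
    have : 1 < Fintype.card K := Fintype.one_lt_card
    omega
  choose y hy using hf.exists_vecMulVec hq
  obtain ⟨θ, hθ⟩ := hf.exists_uniform hq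
  have hsmul : ∀ (t : K) (A : Matrix ι ι K), A.IsSymm → f (t • A) = θ t • f A := fun t A hA => by
    refine eq_of_qform_eq h2 (hf.isSymm _ (hA.smul _)) ((hf.isSymm _ hA).smul _) fun u => ?_
    by_cases hu : u = 0
    · simp [hu]
    obtain ⟨u', -, hτ⟩ := hθ u hu
    rw [hτ _ (hA.smul _), qform_smul_matrix, qform_smul_matrix, hτ _ hA, _root_.map_mul]
  have hy0 : ∀ x ≠ 0, y x ≠ 0 := fun x hx h => by
    have h3 : f (vecMulVec x x) = f 0 := by rw [hy, h, hf.map_zero h2]; simp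
    have h4 := hinj _ _ (isSymm_vecMulVec_self x) (by simp [IsSymm]) h3
    rw [vecMulVec_eq_zero] at h4
    exact hx (h4.elim id id)
  -- mixed terms
  have hmix : ∀ x z, f (vecMulVec x z + vecMulVec z x) = vecMulVec (y x) (y z) +
      vecMulVec (y z) (y x) ∨ f (vecMulVec x z + vecMulVec z x) = -(vecMulVec (y x) (y z) +
      vecMulVec (y z) (y x)) := fun x z => by
    have hMs := hf.isSymm _ (isSymm_vecMulVec_add x z)
    set M := f (vecMulVec x z + vecMulVec z x) with hM
    set N := vecMulVec (y x) (y z) + vecMulVec (y z) (y x) with hN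
    have hNs : N.IsSymm := isSymm_vecMulVec_add _ _
    have hline : ∀ s, vecMulVec (y (z + s • x)) (y (z + s • x)) =
        θ (s ^ 2) • vecMulVec (y x) (y x) + θ s • M + vecMulVec (y z) (y z) := fun s => by
      rw [← hy, ← hy, ← hy, hM, ← hsmul _ _ (isSymm_vecMulVec_self x),
        ← hsmul _ _ (isSymm_vecMulVec_add x z), ← hf.map_add h2 ((isSymm_vecMulVec_self x).smul _)
        ((isSymm_vecMulVec_add x z).smul _), ← hf.map_add h2 (((isSymm_vecMulVec_self x).smul _).add
        ((isSymm_vecMulVec_add x z).smul _)) (isSymm_vecMulVec_self z)]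
      congr 1
      ext i j
      simp [vecMulVec_apply]; ring
    -- By `hline` the quadratic `θ(s)² (y_x·u)² + θ(s) uᵀMu + (y_z·u)²` has square values for all
    -- `s`, so its discriminant vanishes; that is `(uᵀMu)² = (uᵀNu)²`.
    have hprod : ∀ u, qform (M - N) u * qform (M + N) u = 0 := fun u => by
      have h3 := sq_eq_of_isSquare_quadratic hq (a := y x ⬝ᵥ u) (b := qform M u / 2)
        (c := y z ⬝ᵥ u) fun s => by
          have h4 := congrArg (fun A => qform A u) (hline (θ.symm s))
          simp only [qform_add, qform_smul_matrix, qform_vecMulVec, map_pow,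
            RingEquiv.apply_symm_apply] at h4
          refine ⟨y (z + θ.symm s • x) ⬝ᵥ u, ?_⟩
          rw [h4]
          field_simp
      have hNu : qform N u = 2 * ((y x ⬝ᵥ u) * (y z ⬝ᵥ u)) := by
        rw [hN, qform_add, qform_vecMulVec, qform_vecMulVec]; ring
      rw [qform_sub, qform_add M N, hNu]
      field_simp at h3
      linear_combination h3
    rcases eq_zero_or_eq_zero_of_qform_mul hcard h2 (hMs.sub hNs) (hMs.add hNs) hprod with h3 | h3
    · exact Or.inl (sub_eq_zero.1 h3)
    · exact Or.inr (eq_neg_of_add_eq_zero_left h3)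
  -- the semilinear map
  obtain ⟨i₀⟩ := ‹Nonempty ι›
  set x₀ : ι → K := Pi.single i₀ 1 with hx₀
  have hy₀ : y x₀ ≠ 0 := hy0 _ (by simp [hx₀])
  -- `y x` is determined only up to sign. The sign is fixed by requiring the correct mixed term with
  -- the base vector `x₀`; linearity in the mixed term then makes `w` semilinear.
  have hw : ∀ x, ∃ w, f (vecMulVec x₀ x + vecMulVec x x₀) =
      vecMulVec (y x₀) w + vecMulVec w (y x₀) ∧ f (vecMulVec x x) = vecMulVec w w := fun x => by
    rcases hmix x₀ x with h | h
    · exact ⟨y x, h, hy x⟩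
    · refine ⟨-y x, by rw [h, vecMulVec_neg, neg_vecMulVec, neg_add], by
        rw [hy, vecMulVec_neg, neg_vecMulVec, neg_neg]⟩
  choose w hw1 hw2 using hw
  have huniq : ∀ a b, vecMulVec (y x₀) a + vecMulVec a (y x₀) =
      vecMulVec (y x₀) b + vecMulVec b (y x₀) → a = b := fun a b hab => by
    by_contra hne
    obtain ⟨u, hu1, hu2⟩ := exists_dotProduct_ne_zero₂ hy₀ (sub_ne_zero.2 hne)
    have h3 := congrArg (fun A => qform A u) hab
    simp only [qform_add, qform_vecMulVec] at h3
    rw [sub_dotProduct] at hu2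
    have h4 : 2 * ((y x₀ ⬝ᵥ u) * (a ⬝ᵥ u - b ⬝ᵥ u)) = 0 := by linear_combination h3
    exact mul_ne_zero h2 (mul_ne_zero hu1 hu2) h4
  have hwadd : ∀ x z, w (x + z) = w x + w z := fun x z => huniq _ _ (by
    have h3 : vecMulVec (y x₀) (w x + w z) + vecMulVec (w x + w z) (y x₀) =
        (vecMulVec (y x₀) (w x) + vecMulVec (w x) (y x₀)) +
        (vecMulVec (y x₀) (w z) + vecMulVec (w z) (y x₀)) := by
      rw [vecMulVec_add, add_vecMulVec]; abel
    rw [h3, ← hw1, ← hw1, ← hw1, ← hf.map_add h2 (isSymm_vecMulVec_add _ _)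
      (isSymm_vecMulVec_add _ _)]
    congr 1
    rw [vecMulVec_add, add_vecMulVec]; abel)
  have hwsmul : ∀ t x, w (t • x) = θ t • w x := fun t x => huniq _ _ (by
    rw [vecMulVec_smul, smul_vecMulVec, ← smul_add, ← hw1, ← hw1,
      ← hsmul _ _ (isSymm_vecMulVec_add _ _), vecMulVec_smul, smul_vecMulVec, smul_add])
  -- Once `w` is additive, expanding `f((x+z)(x+z)ᵀ)` removes the sign ambiguity for all pairs.
  have hwmix : ∀ x z, f (vecMulVec x z + vecMulVec z x) =
      vecMulVec (w x) (w z) + vecMulVec (w z) (w x) := fun x z => by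
    have h3 := hw2 (x + z)
    have h4 : vecMulVec (x + z) (x + z) = vecMulVec x x + vecMulVec z z +
        (vecMulVec x z + vecMulVec z x) := by
      rw [vecMulVec_add, add_vecMulVec, add_vecMulVec]; abel
    rw [h4, hf.map_add h2 ((isSymm_vecMulVec_self x).add (isSymm_vecMulVec_self z))
      (isSymm_vecMulVec_add x z), hf.map_add h2 (isSymm_vecMulVec_self x)
      (isSymm_vecMulVec_self z), hw2, hw2, hwadd, vecMulVec_add, add_vecMulVec, add_vecMulVec] at h3
    have h5 := add_left_cancel (a := vecMulVec (w x) (w x) + vecMulVec (w z) (w z)) (h3.trans (by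
      abel : _ = vecMulVec (w x) (w x) + vecMulVec (w z) (w z) +
        (vecMulVec (w x) (w z) + vecMulVec (w z) (w x))))
    exact h5
  have hw0 : ∀ x, w x = 0 → x = 0 := fun x hx => by
    have h3 := hw2 x
    rw [hx, hy, zero_vecMulVec, vecMulVec_eq_zero] at h3
    by_contra hne
    exact hy0 x hne (h3.elim id id)
  let e : ι → ι → K := fun j => Pi.single j 1
  let W : Matrix ι ι K := Matrix.of fun i j => w (e j) i
  have hwsum : ∀ x, w x = W *ᵥ (fun j => θ (x j)) := fun x => by
    let g : (ι → K) →+ (ι → K) := AddMonoidHom.mk' w hwadd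
    have h3 : x = ∑ j, x j • e j := by
      ext i; simp [e, Finset.sum_apply, Pi.single_apply]
    have h4 : g x = ∑ j, θ (x j) • w (e j) := by
      conv_lhs => rw [h3, map_sum]
      exact Finset.sum_congr rfl fun j _ => hwsmul _ _
    change g x = _
    rw [h4]
    ext i
    simp [Finset.sum_apply, mulVec, dotProduct, W, mul_comm]
  refine ⟨W, θ, ?_, fun A hA => ?_⟩
  · rw [← mulVec_injective_iff_isUnit]
    intro a b hab
    have h3 : w (fun j => θ.symm (a j - b j)) = 0 := by
      rw [hwsum]
      simp only [RingEquiv.apply_symm_apply]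
      have := sub_eq_zero.2 hab
      rw [← mulVec_sub] at this
      exact this
    have h4 := hw0 _ h3
    ext j
    have h5 := congrFun h4 j
    simpa [sub_eq_zero] using h5
  · have hdecomp : A = ∑ i, ∑ j, (A i j / 2) • (vecMulVec (e i) (e j) + vecMulVec (e j) (e i)) := by
      ext a b
      have hs : A b a = A a b := hA.apply a b
      simp only [e, Matrix.sum_apply, Matrix.smul_apply, Matrix.add_apply, vecMulVec_apply,
        Pi.single_apply, smul_eq_mul, mul_add, Finset.sum_add_distrib]
      simp only [mul_ite, mul_one, mul_zero]
      simp [hs]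
      rw [← add_div, eq_div_iff h2]; ring
    have hind : ∀ (s : Finset ι) (g : ι → Matrix ι ι K), (∀ i, (g i).IsSymm ∧
        f (g i) = W * (g i).map θ * Wᵀ) → (∑ i ∈ s, g i).IsSymm ∧
        f (∑ i ∈ s, g i) = W * (∑ i ∈ s, g i).map θ * Wᵀ := fun s g hg => by
      refine Finset.sum_induction g (fun B => B.IsSymm ∧ f B = W * B.map θ * Wᵀ) ?_ ?_
        fun i _ => hg i
      · rintro B C ⟨hB, hB'⟩ ⟨hC, hC'⟩
        refine ⟨hB.add hC, ?_⟩
        rw [hf.map_add h2 hB hC, hB', hC', Matrix.map_add _ (_root_.map_add θ), Matrix.mul_add,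
          Matrix.add_mul]
      · refine ⟨by simp [IsSymm], ?_⟩
        rw [hf.map_zero h2, Matrix.map_zero _ (_root_.map_zero θ)]
        simp
    rw [hdecomp]
    refine (hind _ _ fun i => hind _ _ fun j => ⟨(isSymm_vecMulVec_add _ _).smul _, ?_⟩).2
    rw [hsmul _ _ (isSymm_vecMulVec_add _ _), hwmix]
    ext a b
    simp [e, W, Matrix.mul_apply, vecMulVec_apply, Pi.single_apply, apply_ite θ, mul_add,
      add_mul, Finset.sum_add_distrib]
    ring

end IsFormMap

end SymmetricMaps

end SympCover

namespace SympCover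

open Matrix

theorem chi_mul_sq {F : Type*} [Field F] (a : F) {s : F} (hs : s ≠ 0) :
    chi (a * s ^ 2) = chi a := by
  have : IsSquare (a * s ^ 2) ↔ IsSquare a := by
    constructor
    · rintro ⟨r, hr⟩
      refine ⟨r / s, ?_⟩
      field_simp
      linear_combination hr
    · rintro ⟨r, rfl⟩
      exact ⟨r * s, by ring⟩
  unfold chi
  by_cases h : IsSquare a
  · rw [if_pos h, if_pos (this.2 h)]
  · rw [if_neg h, if_neg (fun h' => h (this.1 h'))]

namespace SymplecticForm

variable {F V : Type*} [Field F] [AddCommGroup V] [Module F V] {n : ℕ}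
  {S : SymplecticForm F V n}

theorem form_eq_zero (X : S.Gen) {u v : V} (hu : u ∈ X.1) (hv : v ∈ X.1) : S.form u v = 0 := by
  rw [← X.2, LinearMap.BilinForm.mem_orthogonal_iff] at hv
  exact hv u hu

theorem mem_gen_iff (X : S.Gen) (v : V) : v ∈ X.1 ↔ ∀ u ∈ X.1, S.form u v = 0 := by
  conv_lhs => rw [← X.2, LinearMap.BilinForm.mem_orthogonal_iff]

theorem form_neg (u v : V) : S.form u v = -S.form v u := (S.alt.neg_eq v u).symm

theorem gen_eq_of_le {X Y : S.Gen} (h : X.1 ≤ Y.1) : X = Y := by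
  refine Subtype.ext (le_antisymm h fun v hv => ?_)
  rw [mem_gen_iff]
  exact fun u hu => form_eq_zero Y (h hu) hv

/-! ### Adapted bases and the Maslov index -/

/-- The value of the Maslov index computed from arbitrary families of vectors. -/
noncomputable def maslovVal (δ : S.DetFamily) {X Y : S.Gen} (k : ℕ) (hk : k ≤ n) (x : Fin n → X.1)
    (y : Fin n → Y.1) : ℤˣ :=
  chi (δ.det X x * δ.det Y y *
    Matrix.det (Matrix.of fun i j : Fin k =>
      S.form (x (Fin.castLE hk i)) (y (Fin.castLE hk j))))

theorem AdaptedBases.repr_eq_zero {X Y : S.Gen} (b : S.AdaptedBases X Y) {v : X.1}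
    (hv : (v : V) ∈ Y.1) {i : Fin n} (hi : ¬ S.dist X Y ≤ i) : b.x.repr v i = 0 := by
  have h1 : (v : V) ∈ X.1 ⊓ Y.1 := ⟨v.2, hv⟩
  have h2 : {w : V | ∃ i : Fin n, S.dist X Y ≤ i ∧ (b.x i : V) = w} =
      X.1.subtype '' (b.x '' {i : Fin n | S.dist X Y ≤ i}) := by
    ext w
    simp [Set.mem_image]
  rw [← b.span_eq, h2, Submodule.span_image] at h1
  obtain ⟨w, hw, hwv⟩ := h1
  obtain rfl : w = v := Subtype.ext hwv
  have h3 := b.x.mem_span_image.1 hw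
  by_contra h4
  exact hi (h3 (Finsupp.mem_support_iff.2 h4))

/-- Exchanging the roles of the two generators. -/
def AdaptedBases.swap {X Y : S.Gen} (b : S.AdaptedBases X Y) : S.AdaptedBases Y X where
  x := b.y
  y := b.x
  common i hi := (b.common i (by rwa [dist, inf_comm] at hi)).symm
  span_eq := by
    rw [inf_comm, ← b.span_eq]
    congr 1
    ext v
    constructor
    · rintro ⟨i, hi, rfl⟩
      rw [dist, inf_comm] at hi
      exact ⟨i, hi, b.common i hi⟩
    · rintro ⟨i, hi, rfl⟩
      exact ⟨i, by rwa [dist, inf_comm], (b.common i hi).symm⟩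

theorem dist_comm (X Y : S.Gen) : S.dist X Y = S.dist Y X := by
  rw [dist, dist, inf_comm]

/-- Indices below `k`. -/
def finLtEquiv {k : ℕ} (hk : k ≤ n) : Fin k ≃ {i : Fin n // ¬ k ≤ (i : ℕ)} where
  toFun i := ⟨Fin.castLE hk i, by simp⟩
  invFun i := ⟨i.1, not_le.1 i.2⟩
  left_inv i := rfl
  right_inv i := rfl

/-- The transition matrices `P`, `Q` to the chosen bases are block triangular with the same block on
the common vectors. The product inside `chi` thus changes by the square of `det P` times the
determinant of the other diagonal block of `Q`. -/
theorem maslov_eq_maslovVal_dist [FiniteDimensional F V] (δ : S.DetFamily) {X Y : S.Gen}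
    {x : Fin n → X.1} {y : Fin n → Y.1} (hx : δ.det X x ≠ 0) (hy : δ.det Y y ≠ 0)
    (hxy : ∀ i : Fin n, S.dist X Y ≤ i → (x i : V) = y i) :
    maslov δ X Y = maslovVal δ (S.dist X Y) (S.dist_le X Y) x y := by
  classical
  rw [maslov]
  set b := Classical.choice (S.nonempty_adaptedBases X Y)
  set k := S.dist X Y with hk
  let p : Fin n → Prop := fun i => k ≤ (i : ℕ)
  let P := b.x.toMatrix x
  let Q := b.y.toMatrix y
  have hP0 : ∀ i, ¬ p i → ∀ j, p j → P i j = 0 := fun i hi j hj =>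
    b.repr_eq_zero (by rw [hxy j hj]; exact (y j).2) hi
  have hQ0 : ∀ i, ¬ p i → ∀ j, p j → Q i j = 0 := fun i hi j hj =>
    b.swap.repr_eq_zero (v := y j) (by rw [← hxy j hj]; exact (x j).2) (by rwa [dist_comm])
  have hxs : ∀ j, x j = ∑ i, P i j • b.x i := fun j => (b.x.sum_repr (x j)).symm
  have hys : ∀ j, y j = ∑ i, Q i j • b.y i := fun j => (b.y.sum_repr (y j)).symm
  have hPQ : ∀ i j, p i → p j → P i j = Q i j := fun i j hi hj => by
    have h1 : x j = ∑ i, Q i j • b.x i := Subtype.ext (by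
      rw [hxy j hj, hys]
      simp only [Submodule.coe_sum, Submodule.coe_smul]
      refine Finset.sum_congr rfl fun i _ => ?_
      by_cases hi : p i
      · rw [b.common i hi]
      · rw [hQ0 i hi j hj, zero_smul, zero_smul])
    change b.x.repr (x j) i = _
    rw [h1, b.x.repr_sum_self]
  have hdP := twoBlockTriangular_det P p hP0
  have hdQ := twoBlockTriangular_det Q p hQ0
  have hblock : Q.toSquareBlockProp p = P.toSquareBlockProp p := by
    ext i j
    exact (hPQ i j i.2 j.2).symm
  rw [hblock] at hdQ
  have hδx : δ.det X x = δ.det X b.x * P.det := by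
    have := congrArg (fun f => f x) ((δ.det X).eq_smul_basis_det b.x)
    simpa [Module.Basis.det_apply] using this
  have hδy : δ.det Y y = δ.det Y b.y * Q.det := by
    have := congrArg (fun f => f y) ((δ.det Y).eq_smul_basis_det b.y)
    simpa [Module.Basis.det_apply] using this
  have hdP0 : P.det ≠ 0 := fun h => hx (by rw [hδx, h, mul_zero])
  have hdQ0 : Q.det ≠ 0 := fun h => hy (by rw [hδy, h, mul_zero])
  let G : Matrix (Fin n) (Fin n) F := Matrix.of fun i j => S.form (b.x i) (b.y j)
  have hG1 : ∀ i j, p i → G i j = 0 := fun i j hi => by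
    change S.form (b.x i) (b.y j) = 0
    rw [b.common i hi]
    exact form_eq_zero Y (b.y i).2 (b.y j).2
  have hG2 : ∀ i j, p j → G i j = 0 := fun i j hj => by
    change S.form (b.x i) (b.y j) = 0
    rw [← b.common j hj]
    exact form_eq_zero X (b.x i).2 (b.x j).2
  have hgram : (Matrix.of fun i j => S.form (x i) (y j) : Matrix (Fin n) (Fin n) F) =
      Pᵀ * G * Q := by
    ext i j
    rw [Matrix.of_apply, hxs, hys, Matrix.mul_assoc, Matrix.mul_apply]
    simp only [Submodule.coe_sum, Submodule.coe_smul, map_sum, LinearMap.sum_apply, map_smul,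
      LinearMap.smul_apply, Matrix.mul_apply, smul_eq_mul, transpose_apply, Finset.mul_sum]
    rw [Finset.sum_comm]
    refine Finset.sum_congr rfl fun a _ => Finset.sum_congr rfl fun c _ => ?_
    simp only [G, Matrix.of_apply]
    ring
  -- `G` vanishes as soon as one index belongs to the common part, so only the corner blocks of `P`
  -- and `Q` contribute to the small Gram matrix.
  have hblk : (Pᵀ * G * Q).toSquareBlockProp (fun i => ¬ p i) =
      (P.toSquareBlockProp fun i => ¬ p i)ᵀ * (G.toSquareBlockProp fun i => ¬ p i) *
      (Q.toSquareBlockProp fun i => ¬ p i) := by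
    have hsum : ∀ f : Fin n → F, (∀ a, p a → f a = 0) →
        ∑ a, f a = ∑ a : {a // ¬ p a}, f a := fun f hf => by
      rw [← Finset.sum_subtype (Finset.univ.filter fun a => ¬ p a) (by simp) f]
      exact (Finset.sum_filter_of_ne (p := fun a => ¬ p a) fun a _ ha hp => ha (hf a hp)).symm
    ext i j
    simp only [toSquareBlockProp_def, Matrix.of_apply, Matrix.mul_apply, transpose_apply]
    rw [hsum _ fun a ha => by
      rw [Finset.sum_eq_zero, zero_mul]; intro c _; rw [hG2 _ _ ha, mul_zero]]
    refine Finset.sum_congr rfl fun a _ => ?_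
    rw [hsum _ fun c hc => by rw [hG1 _ _ hc, mul_zero]]
  have hdet : ∀ M : Matrix (Fin n) (Fin n) F, Matrix.det (Matrix.of fun i j : Fin k =>
      M (Fin.castLE (S.dist_le X Y) i) (Fin.castLE (S.dist_le X Y) j)) =
      (M.toSquareBlockProp fun i => ¬ p i).det := fun M => by
    rw [← det_submatrix_equiv_self (finLtEquiv (S.dist_le X Y))]
    rfl
  have h2 := hdet G
  have h1 := (hdet (Matrix.of fun i j => S.form (x i) (y j))).trans (by
    rw [hgram, hblk, det_mul, det_mul, det_transpose, ← h2])
  simp only [Matrix.of_apply, G] at h1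
  rw [maslovOf, maslovVal, h1, hδx, hδy, hdP, hdQ]
  rw [hdP] at hdP0
  rw [hdQ] at hdQ0
  rw [← chi_mul_sq _ (mul_ne_zero hdP0 (right_ne_zero_of_mul hdQ0))]
  congr 1
  ring

theorem maslov_eq_maslovVal [FiniteDimensional F V] (δ : S.DetFamily) {X Y : S.Gen}
    {k : ℕ} (hk : S.dist X Y = k) (hkn : k ≤ n)
    {x : Fin n → X.1} {y : Fin n → Y.1} (hx : δ.det X x ≠ 0) (hy : δ.det Y y ≠ 0)
    (hxy : ∀ i : Fin n, k ≤ i → (x i : V) = y i) :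
    maslov δ X Y = maslovVal δ k hkn x y := by
  subst hk
  exact maslov_eq_maslovVal_dist δ hx hy hxy

theorem det_basis_ne_zero (δ : S.DetFamily) {X : S.Gen} (b : Module.Basis (Fin n) F X.1) :
    δ.det X b ≠ 0 := fun h => δ.det_ne_zero X (by
  rw [(δ.det X).eq_smul_basis_det b, h, zero_smul])

/-- A null vector would give a combination of the first basis vectors of `X` orthogonal to `Y`,
hence in `Y`; but `X ∩ Y` is spanned by the remaining ones. -/
theorem AdaptedBases.gram_det_ne_zero {X Y : S.Gen} (b : S.AdaptedBases X Y) :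
    Matrix.det (Matrix.of fun i j : Fin (S.dist X Y) =>
      S.form (b.x (Fin.castLE (S.dist_le X Y) i)) (b.y (Fin.castLE (S.dist_le X Y) j))) ≠ 0 := by
  intro h
  obtain ⟨c, hc, hc0⟩ := exists_vecMul_eq_zero_iff.2 h
  let z : X.1 := ∑ i, c i • b.x (Fin.castLE (S.dist_le X Y) i)
  have hz : (z : V) ∈ Y.1 := by
    rw [mem_gen_iff]
    intro u hu
    have h1 : ∀ j, S.form z (b.y j) = 0 := fun j => by
      by_cases hj : S.dist X Y ≤ j
      · rw [← b.common j hj]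
        exact form_eq_zero X z.2 (b.x j).2
      · have := congrFun hc0 ⟨j, not_le.1 hj⟩
        simpa [z, vecMul, dotProduct] using this
    have h2 : S.form z (⟨u, hu⟩ : Y.1) = 0 := by
      rw [← b.y.sum_repr ⟨u, hu⟩]
      simp only [Submodule.coe_sum, Submodule.coe_smul, map_sum, map_smul, h1]
      simp
    rw [form_neg]
    simpa using h2
  apply hc
  funext i
  have h1 := b.repr_eq_zero hz (i := Fin.castLE (S.dist_le X Y) i) (by simp)
  have h2 : Function.Injective (Fin.castLE (S.dist_le X Y)) := Fin.castLE_injective _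
  simpa [z, Finsupp.single_apply, h2.eq_iff] using h1

/-- Adapted families. -/
theorem exists_adapted [FiniteDimensional F V] (δ : S.DetFamily) (X Y : S.Gen) :
    ∃ (x : Fin n → X.1) (y : Fin n → Y.1), δ.det X x ≠ 0 ∧ δ.det Y y ≠ 0 ∧
      (∀ i : Fin n, S.dist X Y ≤ i → (x i : V) = y i) ∧
      Matrix.det (Matrix.of fun i j : Fin (S.dist X Y) =>
        S.form (x (Fin.castLE (S.dist_le X Y) i)) (y (Fin.castLE (S.dist_le X Y) j))) ≠ 0 := by
  obtain ⟨b⟩ := S.nonempty_adaptedBases X Y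
  exact ⟨b.x, b.y, det_basis_ne_zero δ b.x, det_basis_ne_zero δ b.y, b.common,
    b.gram_det_ne_zero⟩

theorem dist_self [FiniteDimensional F V] (X : S.Gen) : S.dist X X = 0 := by
  rw [dist, inf_idem, S.gen_finrank, Nat.sub_self]

theorem maslov_self [FiniteDimensional F V] (δ : S.DetFamily) (X : S.Gen) :
    maslov δ X X = 1 := by
  obtain ⟨x, hx⟩ := exists_det_ne_zero δ X
  rw [maslov_eq_maslovVal δ (dist_self X) (Nat.zero_le n) hx hx fun _ _ => rfl, maslovVal,
    det_isEmpty, mul_one, chi, if_pos ⟨_, rfl⟩]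

/-- Exchanging the generators transposes and negates the Gram matrix, which does not affect `chi`
because `-1` is a square. -/
theorem maslov_comm [Finite F] [FiniteDimensional F V] (hq : Nat.card F % 4 = 1)
    (δ : S.DetFamily) (X Y : S.Gen) : maslov δ X Y = maslov δ Y X := by
  obtain ⟨x, y, hx, hy, hxy, -⟩ := exists_adapted δ X Y
  rw [maslov_eq_maslovVal δ rfl (S.dist_le X Y) hx hy hxy,
    maslov_eq_maslovVal δ (dist_comm Y X) (S.dist_le X Y) hy hx fun i hi => (hxy i hi).symm,
    maslovVal, maslovVal]
  have h1 : (Matrix.of fun i j : Fin (S.dist X Y) =>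
      S.form (y (Fin.castLE (S.dist_le X Y) i)) (x (Fin.castLE (S.dist_le X Y) j))) =
      (-1 : F) • (Matrix.of fun i j : Fin (S.dist X Y) => S.form (x (Fin.castLE (S.dist_le X Y) i))
        (y (Fin.castLE (S.dist_le X Y) j)))ᵀ := by
    ext i j
    simp [form_neg (x (Fin.castLE (S.dist_le X Y) j) : V)]
  obtain ⟨i, hi⟩ := isSquare_neg_one_of_card hq
  have hi0 : i ≠ 0 := fun h => by rw [h] at hi; simp at hi
  rw [h1, det_smul, det_transpose, hi,
    ← chi_mul_sq _ (pow_ne_zero (Fintype.card (Fin (S.dist X Y))) hi0)]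
  congr 1
  rw [← sq, ← pow_mul, ← pow_mul]
  ring

end SymplecticForm

end SympCover

namespace SympCover

open Matrix

namespace SymplecticForm

variable {F V : Type*} [Field F] [AddCommGroup V] [Module F V] {n : ℕ}
  {S : SymplecticForm F V n}

/-! ### Equivariance -/

theorem genMap_apply_mem_iff (g : S.sigmaSp) (X : S.Gen) (v : V) :
    g.1 v ∈ (S.genMap g X).1 ↔ v ∈ X.1 :=
  ⟨fun ⟨_, hu, h⟩ => g.1.injective h ▸ hu, fun h => ⟨v, h, rfl⟩⟩

theorem finrank_semiMap (g : Equiv.Perm V) (hg : g ∈ gammaL F V) (U : Submodule F V) :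
    Module.finrank F (semiMap g hg U) = Module.finrank F U := by
  obtain ⟨τ, hτ⟩ := hg.2
  let j : U ≃+ semiMap g hg U := AddEquiv.mk'
    (Equiv.ofBijective (fun u => (⟨g u, u, u.2, rfl⟩ : semiMap g hg U))
      ⟨fun u v h => Subtype.ext (g.injective (congrArg Subtype.val h)),
        fun ⟨_, u, hu, h⟩ => ⟨⟨u, hu⟩, Subtype.ext h⟩⟩)
    fun u v => Subtype.ext (hg.1 _ _)
  exact (congrArg Cardinal.toNat
    (rank_eq_of_equiv_equiv τ j τ.bijective fun r m => Subtype.ext (hτ r m))).symm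

theorem dist_genMap (g : S.sigmaSp) (X Y : S.Gen) :
    S.dist (S.genMap g X) (S.genMap g Y) = S.dist X Y := by
  have h : ((S.genMap g X).1 ⊓ (S.genMap g Y).1 : Submodule F V) =
      semiMap g.1 g.2.1 (X.1 ⊓ Y.1) := by
    ext v
    constructor
    · rintro ⟨⟨u, hu, rfl⟩, ⟨w, hw, h⟩⟩
      exact ⟨u, ⟨hu, g.1.injective h ▸ hw⟩, rfl⟩
    · rintro ⟨u, ⟨hu, hw⟩, rfl⟩
      exact ⟨⟨u, hu, rfl⟩, ⟨u, hw, rfl⟩⟩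
  rw [dist, dist, h, finrank_semiMap]

theorem maslov_genMap [Finite F] [FiniteDimensional F V] (δ : S.DetFamily) (g : S.sigmaSp)
    (X Y : S.Gen) : maslov δ (S.genMap g X) (S.genMap g Y) =
      chi (multiplier δ g X) * chi (multiplier δ g Y) * maslov δ X Y := by
  obtain ⟨x, y, hx, hy, hxy, hG⟩ := exists_adapted δ X Y
  -- This `τ` belongs to the form, while `tau g` belongs to scalar multiplication. They need not be
  -- identified, as `chi` is invariant under both.
  obtain ⟨τ, hτ⟩ := g.2.2
  rw [maslov_eq_maslovVal δ rfl (S.dist_le X Y) hx hy hxy,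
    maslov_eq_maslovVal δ (dist_genMap g X Y) (S.dist_le X Y) (restr_det_ne_zero δ g X x hx)
      (restr_det_ne_zero δ g Y y hy) fun i hi => congrArg g.1 (hxy i hi), maslovVal, maslovVal]
  have h1 : (Matrix.of fun i j : Fin (S.dist X Y) =>
      S.form (restr g X (x (Fin.castLE (S.dist_le X Y) i)))
        (restr g Y (y (Fin.castLE (S.dist_le X Y) j)))) =
      τ.toRingHom.mapMatrix (Matrix.of fun i j : Fin (S.dist X Y) =>
        S.form (x (Fin.castLE (S.dist_le X Y) i)) (y (Fin.castLE (S.dist_le X Y) j))) := by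
    ext i j
    exact hτ _ _
  rw [h1, ← RingHom.map_det, chi_mul (mul_ne_zero (restr_det_ne_zero δ g X x hx)
    (restr_det_ne_zero δ g Y y hy)) (by
      change τ _ ≠ 0
      rwa [Ne, map_eq_zero_iff _ τ.injective]),
    chi_mul (restr_det_ne_zero δ g X x hx) (restr_det_ne_zero δ g Y y hy),
    chi_mul (mul_ne_zero hx hy) hG, chi_mul hx hy, chi_multiplier δ g X x hx,
    chi_multiplier δ g Y y hy]
  have h2 : ∀ a : F, chi (τ.toRingHom a) = chi a := chi_map τ
  rw [h2]
  simp only [mul_assoc, mul_left_comm]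

/-! ### Symplectic coordinates -/

variable (S) in
/-- Linear coordinates in which the form is the standard symplectic form. -/
def IsSymplCoord (φ : V ≃ₗ[F] (Fin n → F) × (Fin n → F)) : Prop :=
  ∀ v w, S.form v w = (φ v).1 ⬝ᵥ (φ w).2 - (φ v).2 ⬝ᵥ (φ w).1

/-- For `j < d(X,Y)` the dual vector is found inside `Y` by inverting the Gram matrix; for the
others any vector representing the coordinate functional will do. -/
theorem exists_dual [FiniteDimensional F V] {X Y : S.Gen} (b : S.AdaptedBases X Y) :
    ∃ z : Fin n → V, (∀ i j, S.form (b.x i) (z j) = if i = j then 1 else 0) ∧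
      ∀ j : Fin n, (j : ℕ) < S.dist X Y → z j ∈ Y.1 := by
  have h : ∀ j : Fin n, ∃ z : V, (∀ i, S.form (b.x i) z = if i = j then 1 else 0) ∧
      ((j : ℕ) < S.dist X Y → z ∈ Y.1) := by
    intro j
    by_cases hj : (j : ℕ) < S.dist X Y
    · obtain ⟨c, hc⟩ := (mulVec_surjective_iff_isUnit.2 ((isUnit_iff_isUnit_det _).2
        (isUnit_iff_ne_zero.2 b.gram_det_ne_zero))) (Pi.single ⟨j, hj⟩ 1)
      let z : Y.1 := ∑ l, c l • b.y (Fin.castLE (S.dist_le X Y) l)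
      refine ⟨z, fun i => ?_, fun _ => z.2⟩
      by_cases hi : S.dist X Y ≤ i
      · rw [if_neg (by rintro rfl; omega), b.common i hi]
        exact form_eq_zero Y (b.y i).2 z.2
      · have h1 := congrFun hc ⟨i, not_le.1 hi⟩
        have h2 : S.form (b.x i) z = Pi.single (M := fun _ => F) (⟨j, hj⟩ : Fin (S.dist X Y)) 1
            ⟨i, not_le.1 hi⟩ := by
          rw [← h1]
          simp [z, mulVec, dotProduct, mul_comm]
        rw [h2, Pi.single_apply]
        simp [Fin.ext_iff]
    · obtain ⟨ℓ, hℓ⟩ := LinearMap.exists_extend (b.x.coord j)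
      refine ⟨-((S.form.toDual S.nondegenerate).symm ℓ), fun i => ?_, fun h => absurd h hj⟩
      rw [form_neg, map_neg, LinearMap.neg_apply, neg_neg,
        LinearMap.BilinForm.apply_toDual_symm_apply]
      have := LinearMap.congr_fun hℓ (b.x i)
      simpa [Finsupp.single_apply] using this
  choose z hz hz' using h
  exact ⟨z, fun i j => hz j i, hz'⟩

/-- Normal form of a pair of generators: a basis of `X` is completed to a symplectic basis whose
first `d(X,Y)` dual vectors lie in `Y`. It serves in place of Witt's theorem. -/
theorem exists_symplCoord [FiniteDimensional F V] (h2 : (2 : F) ≠ 0) (X Y : S.Gen) :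
    ∃ φ : V ≃ₗ[F] (Fin n → F) × (Fin n → F), S.IsSymplCoord φ ∧
      (∀ v, v ∈ X.1 ↔ (φ v).2 = 0) ∧
      ∀ v, v ∈ Y.1 ↔ ∀ i : Fin n, ((i : ℕ) < S.dist X Y → (φ v).1 i = 0) ∧
        (S.dist X Y ≤ i → (φ v).2 i = 0) := by
  obtain ⟨b⟩ := S.nonempty_adaptedBases X Y
  obtain ⟨z, hz, hzY⟩ := exists_dual b
  set k := S.dist X Y
  let x : Fin n → V := fun i => b.x i
  have hxx : ∀ i j, S.form (x i) (x j) = 0 := fun i j => form_eq_zero X (b.x i).2 (b.x j).2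
  have hxY : ∀ i : Fin n, k ≤ i → x i ∈ Y.1 := fun i hi => by
    change (b.x i : V) ∈ _
    rw [b.common i hi]
    exact (b.y i).2
  -- Adding `∑ c j l • x j` to `z l` makes the dual vectors isotropic when `c j l - c l j = B(z_j,
  -- z_l)`. Taking `c j l = 0` for `l < k` leaves the vectors already in `Y` unchanged.
  let c : Fin n → Fin n → F := fun j l => if (l : ℕ) < k then 0 else
    if (j : ℕ) < k then S.form (z j) (z l) else S.form (z j) (z l) / 2
  have hc : ∀ j l, c j l - c l j = S.form (z j) (z l) := fun j l => by
    have h3 := form_neg (S := S) (z l) (z j)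
    simp only [c]
    by_cases hl : (l : ℕ) < k <;> by_cases hj : (j : ℕ) < k
    · simp only [hl, hj, if_true, sub_zero]
      exact (form_eq_zero Y (hzY j hj) (hzY l hl)).symm
    · simp only [hl, hj, if_true, if_false, h3]; ring
    · simp only [hl, hj, if_true, if_false, h3]; ring
    · simp only [hl, hj, if_false, h3]
      field_simp; ring
  let w : Fin n → V := fun l => z l + ∑ j, c j l • x j
  have hxw : ∀ i j, S.form (x i) (w j) = if i = j then 1 else 0 := fun i j => by
    simp only [w, map_add, map_sum, map_smul, hxx, smul_zero, Finset.sum_const_zero, add_zero]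
    exact hz i j
  have hwx : ∀ i j, S.form (w i) (x j) = if i = j then -1 else 0 := fun i j => by
    rw [form_neg, hxw, eq_comm]
    split_ifs <;> simp_all
  have hzx : ∀ i j, S.form (z i) (x j) = if i = j then -1 else 0 := fun i j => by
    rw [form_neg, hz, eq_comm]
    split_ifs <;> simp_all
  have hww : ∀ i j, S.form (w i) (w j) = 0 := fun i j => by
    have h3 : S.form (w i) (w j) = S.form (z i) (z j) - c i j + c j i := by
      have h4 : S.form (w i) (w j) = S.form (w i) (z j) + ∑ l, c l j * S.form (w i) (x l) := by
        conv_lhs => rw [show w j = z j + ∑ l, c l j • x l from rfl]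
        simp
      have h5 : S.form (w i) (z j) = S.form (z i) (z j) + ∑ l, c l i * S.form (x l) (z j) := by
        simp [w]
      rw [h4, h5]
      simp only [hwx, show ∀ l, S.form (x l) (z j) = if l = j then 1 else 0 from fun l => hz l j]
      simp
      ring
    rw [h3, ← hc]; ring
  have hwY : ∀ j : Fin n, (j : ℕ) < k → w j ∈ Y.1 := fun j hj => by
    have h3 : w j = z j := by simp [w, c, hj]
    rw [h3]
    exact hzY j hj
  let ψ : (Fin n → F) × (Fin n → F) →ₗ[F] V :=
    LinearMap.coprod (Fintype.linearCombination F x) (Fintype.linearCombination F w)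
  have hψ : ∀ m, ψ m = ∑ i, m.1 i • x i + ∑ i, m.2 i • w i := fun m => by
    simp [ψ, Fintype.linearCombination_apply]
  have hxψ : ∀ i m, S.form (x i) (ψ m) = m.2 i := fun i m => by
    rw [hψ]; simp [hxx, hxw]
  have hwψ : ∀ i m, S.form (w i) (ψ m) = -m.1 i := fun i m => by
    rw [hψ]; simp [hww, hwx]
  have hform : ∀ m m', S.form (ψ m) (ψ m') = m.1 ⬝ᵥ m'.2 - m.2 ⬝ᵥ m'.1 := fun m m' => by
    rw [hψ m]
    simp [hxψ, hwψ, dotProduct, sub_eq_add_neg]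
  have hinj : Function.Injective ψ := by
    rw [← LinearMap.ker_eq_bot, LinearMap.ker_eq_bot']
    intro m hm
    refine Prod.ext (funext fun i => ?_) (funext fun i => ?_)
    · have := hwψ i m
      rw [hm, map_zero] at this
      simpa using this.symm
    · have := hxψ i m
      rw [hm, map_zero] at this
      exact this.symm
  let e : ((Fin n → F) × (Fin n → F)) ≃ₗ[F] V := LinearEquiv.ofInjectiveOfFinrankEq ψ hinj (by
    rw [S.finrank_eq, Module.finrank_prod, Module.finrank_fin_fun]; ring)
  have he : ∀ v, ψ (e.symm v) = v := e.apply_symm_apply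
  refine ⟨e.symm, fun v u => ?_, fun v => ⟨fun hv => ?_, fun hv => ?_⟩, fun v =>
    ⟨fun hv i => ⟨fun hi => ?_, fun hi => ?_⟩, fun hv => ?_⟩⟩
  · rw [← hform, he, he]
  · funext i
    rw [← hxψ, he]
    exact form_eq_zero X (b.x i).2 hv
  · rw [← he v, hψ, hv]
    simp only [Pi.zero_apply, zero_smul, Finset.sum_const_zero, add_zero]
    exact X.1.sum_mem fun i _ => X.1.smul_mem _ (b.x i).2
  · rw [← neg_eq_zero, ← hwψ, he]
    exact form_eq_zero Y (hwY i hi) hv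
  · rw [← hxψ, he]
    exact form_eq_zero Y (hxY i hi) hv
  · rw [← he v, hψ]
    refine Y.1.add_mem (Y.1.sum_mem fun i _ => ?_) (Y.1.sum_mem fun i _ => ?_)
    · by_cases hi : (i : ℕ) < k
      · rw [(hv i).1 hi, zero_smul]; exact Y.1.zero_mem
      · exact Y.1.smul_mem _ (hxY i (not_lt.1 hi))
    · by_cases hi : (i : ℕ) < k
      · exact Y.1.smul_mem _ (hwY i hi)
      · rw [(hv i).2 (not_lt.1 hi), zero_smul]; exact Y.1.zero_mem

/-- `Sp(2n,q)` is transitive on the pairs of generators at a given distance. -/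
theorem exists_sp_genMap [FiniteDimensional F V] (h2 : (2 : F) ≠ 0) {X Y X' Y' : S.Gen}
    (h : S.dist X Y = S.dist X' Y') : ∃ g : S.sp,
      S.genMap (Subgroup.inclusion S.sp_le_sigmaSp g) X = X' ∧
      S.genMap (Subgroup.inclusion S.sp_le_sigmaSp g) Y = Y' := by
  obtain ⟨φ, hφ, hX, hY⟩ := exists_symplCoord h2 X Y
  obtain ⟨φ', hφ', hX', hY'⟩ := exists_symplCoord h2 X' Y'
  let e := φ.trans φ'.symm
  have he : ∀ v, φ' (e v) = φ v := fun v => by simp [e]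
  let g : S.sp := ⟨e.toEquiv, map_add e, map_smul e, fun v w => by
    change S.form (e v) (e w) = _
    rw [hφ', hφ, he, he]⟩
  refine ⟨g, gen_eq_of_le ?_, gen_eq_of_le ?_⟩
  · rintro _ ⟨u, hu, rfl⟩
    change e u ∈ _
    rw [hX', he, ← hX]
    exact hu
  · rintro _ ⟨u, hu, rfl⟩
    change e u ∈ _
    rw [hY', he, ← h, ← hY]
    exact hu

/-- A maximal totally isotropic subspace equals its orthogonal: any vector of the orthogonal is
isotropic and could be adjoined. -/
theorem nonempty_gen [FiniteDimensional F V] (S : SymplecticForm F V n) : Nonempty S.Gen := by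
  obtain ⟨X, hX, hmax⟩ := (wellFounded_gt (α := Submodule F V)).has_min
    {X : Submodule F V | X ≤ S.form.orthogonal X} ⟨⊥, show (⊥ : Submodule F V) ≤ _ from bot_le⟩
  refine ⟨⟨X, le_antisymm (fun v hv => ?_) hX⟩⟩
  rw [LinearMap.BilinForm.mem_orthogonal_iff] at hv
  have hvX : ∀ x ∈ X, S.form x v = 0 := hv
  have hXX : ∀ x ∈ X, ∀ y ∈ X, S.form x y = 0 := fun x hx y hy => hX hy x hx
  have hvX' : ∀ x ∈ X, S.form v x = 0 := fun x hx => by rw [form_neg, hvX x hx, neg_zero]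
  have hvv : S.form v v = 0 := S.alt v
  have hle : X ⊔ Submodule.span F {v} ≤ S.form.orthogonal (X ⊔ Submodule.span F {v}) := by
    intro a ha
    rw [LinearMap.BilinForm.mem_orthogonal_iff]
    intro b hb
    obtain ⟨x, hx, _, hv1, rfl⟩ := Submodule.mem_sup.1 ha
    obtain ⟨y, hy, _, hv2, rfl⟩ := Submodule.mem_sup.1 hb
    obtain ⟨s, rfl⟩ := Submodule.mem_span_singleton.1 hv1
    obtain ⟨t, rfl⟩ := Submodule.mem_span_singleton.1 hv2
    change S.form _ _ = 0
    simp [hXX y hy x hx, hvX y hy, hvX' x hx, hvv]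
  have hnot := hmax _ hle
  by_contra hvn
  exact hnot (lt_of_le_of_ne le_sup_left fun h => hvn (by
    rw [h]; exact Submodule.mem_sup_right (Submodule.mem_span_singleton_self v)))

end SymplecticForm

end SympCover

namespace SympCover

open Matrix

namespace SymplecticForm

variable {F V : Type*} [Field F] [AddCommGroup V] [Module F V] {n : ℕ}
  {S : SymplecticForm F V n}

/-! ### Generators in coordinates -/

/-- The generator given in symplectic coordinates `φ` by a subspace of the model. -/
def genOfCoord {φ : V ≃ₗ[F] (Fin n → F) × (Fin n → F)} (hφ : S.IsSymplCoord φ)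
    (W : Submodule F ((Fin n → F) × (Fin n → F)))
    (hW : ∀ m, m ∈ W ↔ ∀ m' ∈ W, m'.1 ⬝ᵥ m.2 - m'.2 ⬝ᵥ m.1 = 0) : S.Gen :=
  ⟨W.comap φ.toLinearMap, by
    ext v
    rw [LinearMap.BilinForm.mem_orthogonal_iff, Submodule.mem_comap, hW]
    constructor
    · intro h m hm
      have := h (φ.symm m) (by simpa using hm)
      change S.form _ _ = 0 at this
      rw [hφ] at this
      simpa using this
    · intro h u hu
      change S.form _ _ = 0
      rw [hφ]
      exact h _ hu⟩

/-- The standard generator of the model at distance `k` from `{(a, 0)}`. -/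
def stdSubmodule (F : Type*) [Field F] (n k : ℕ) : Submodule F ((Fin n → F) × (Fin n → F)) where
  carrier := {m | ∀ i : Fin n, ((i : ℕ) < k → m.1 i = 0) ∧ (k ≤ (i : ℕ) → m.2 i = 0)}
  zero_mem' := fun i => ⟨fun _ => rfl, fun _ => rfl⟩
  add_mem' := fun {a b} ha hb i => ⟨fun h => by simp [(ha i).1 h, (hb i).1 h],
    fun h => by simp [(ha i).2 h, (hb i).2 h]⟩
  smul_mem' := fun c {a} ha i => ⟨fun h => by simp [(ha i).1 h], fun h => by simp [(ha i).2 h]⟩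

theorem stdSubmodule_orthogonal (k : ℕ) (m : (Fin n → F) × (Fin n → F)) :
    m ∈ stdSubmodule F n k ↔
      ∀ m' ∈ stdSubmodule F n k, m'.1 ⬝ᵥ m.2 - m'.2 ⬝ᵥ m.1 = 0 := by
  constructor
  · intro hm m' hm'
    have h1 : m'.1 ⬝ᵥ m.2 = 0 := Finset.sum_eq_zero fun i _ => by
      by_cases hi : (i : ℕ) < k
      · rw [(hm' i).1 hi, zero_mul]
      · rw [(hm i).2 (not_lt.1 hi), mul_zero]
    have h2 : m'.2 ⬝ᵥ m.1 = 0 := Finset.sum_eq_zero fun i _ => by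
      by_cases hi : (i : ℕ) < k
      · rw [(hm i).1 hi, mul_zero]
      · rw [(hm' i).2 (not_lt.1 hi), zero_mul]
    rw [h1, h2, sub_zero]
  · intro h i
    constructor
    · intro hi
      have := h (0, Pi.single i 1) fun j => ⟨fun _ => rfl, fun hj =>
        Pi.single_eq_of_ne (fun hij => by subst hij; omega) _⟩
      simpa using this
    · intro hi
      have := h (Pi.single i 1, 0) fun j => ⟨fun hj =>
        Pi.single_eq_of_ne (fun hij => by subst hij; omega) _, fun _ => rfl⟩
      simpa using this

theorem exists_dist_eq [FiniteDimensional F V] (h2 : (2 : F) ≠ 0) {k : ℕ} (hk : k ≤ n) :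
    ∃ X Y : S.Gen, S.dist X Y = k := by
  obtain ⟨E⟩ := nonempty_gen S
  obtain ⟨φ, hφ, hE, -⟩ := exists_symplCoord h2 E E
  let Y := genOfCoord hφ _ (stdSubmodule_orthogonal k)
  refine ⟨E, Y, ?_⟩
  -- The intersection is parametrised by the last `n - k` coordinates of the first component.
  let s : Fin (n - k) → Fin n := fun j => ⟨k + j, by omega⟩
  have hs : Function.Injective s := fun i j h => by
    simp only [s, Fin.mk.injEq] at h
    exact Fin.ext (by omega)
  let T : (Fin (n - k) → F) →ₗ[F] V := φ.symm.toLinearMap ∘ₗ (LinearMap.inl F _ _) ∘ₗ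
    (Function.ExtendByZero.linearMap F s)
  have hT : Function.Injective T := φ.symm.injective.comp
    (LinearMap.inl_injective.comp (Function.extend_injective hs 0))
  have hφT : ∀ f, φ (T f) = (Function.extend s f 0, 0) := fun f => by
    simp [T]; rfl
  have hrange : LinearMap.range T = E.1 ⊓ Y.1 := by
    ext v
    constructor
    · rintro ⟨f, rfl⟩
      refine ⟨(hE _).2 (by rw [hφT]), fun i => ⟨fun hi => ?_, fun _ => ?_⟩⟩
      · change (φ (T f)).1 i = 0
        rw [hφT]
        refine Function.extend_apply' _ _ _ ?_
        rintro ⟨j, rfl⟩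
        simp [s] at hi
      · change (φ (T f)).2 i = 0
        rw [hφT]; rfl
    · rintro ⟨hvE, hvY⟩
      refine ⟨fun j => (φ v).1 (s j), φ.injective (Prod.ext ?_ ?_)⟩
      · rw [hφT]
        funext i
        by_cases hi : (i : ℕ) < k
        · dsimp only
          refine (Function.extend_apply' _ _ _ ?_).trans ((hvY i).1 hi).symm
          rintro ⟨j, rfl⟩
          simp [s] at hi
        · have : i = s ⟨i - k, by omega⟩ := Fin.ext (by simp [s]; omega)
          rw [this]
          dsimp only
          exact hs.extend_apply _ _ _
      · rw [hφT]
        exact ((hE v).1 hvE).symm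
  rw [dist, ← hrange, LinearMap.finrank_range_of_inj hT, Module.finrank_fin_fun]
  omega

theorem eq_of_dist_eq_zero [FiniteDimensional F V] {X Y : S.Gen} (h : S.dist X Y = 0) : X = Y := by
  have h1 : Module.finrank F (X.1 ⊓ Y.1 : Submodule F V) = Module.finrank F X.1 := by
    refine le_antisymm (Submodule.finrank_mono inf_le_left) ?_
    rw [S.gen_finrank]
    exact Nat.sub_eq_zero_iff_le.1 h
  exact gen_eq_of_le (inf_eq_left.1 (Submodule.eq_of_le_of_finrank_eq inf_le_left h1))

/-! ### The relations -/

/-- The sign of a pair of points, relative to the Maslov index. -/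
noncomputable def relSign [FiniteDimensional F V] (δ : S.DetFamily) (p q : Cover S) : ℤˣ :=
  p.2 * q.2 * maslov δ p.1 q.1

theorem mem_rel_iff [FiniteDimensional F V] (δ : S.DetFamily) (i : Fin (2 * n + 1 + 1))
    (p q : Cover S) : (p, q) ∈ rel δ i ↔
      if (i : ℕ) ≤ n then S.dist p.1 q.1 = i ∧ relSign δ p q = 1
        else S.dist p.1 q.1 = 2 * n + 1 - i ∧ relSign δ p q = -1 := by
  have h : ∀ a b c : ℤˣ, (a * b = c ↔ a * b * c = 1) ∧ (a * b = -c ↔ a * b * c = -1) := by decide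
  simp only [rel, Set.mem_ofPred_eq, relSign]
  split_ifs
  · rw [(h _ _ _).1]
  · rw [(h _ _ _).2]

theorem relSign_self [FiniteDimensional F V] (δ : S.DetFamily) (p : Cover S) : relSign δ p p = 1 := by
  rw [relSign, maslov_self, mul_one, Int.units_mul_self]

theorem exists_mem_rel [FiniteDimensional F V] (δ : S.DetFamily) (p q : Cover S) :
    ∃ i, (p, q) ∈ rel δ i := by
  have h1 := S.dist_le p.1 q.1
  rcases Int.units_eq_one_or (relSign δ p q) with h | h
  · refine ⟨⟨S.dist p.1 q.1, by omega⟩, ?_⟩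
    rw [mem_rel_iff, if_pos h1]
    exact ⟨rfl, h⟩
  · refine ⟨⟨2 * n + 1 - S.dist p.1 q.1, by omega⟩, ?_⟩
    rw [mem_rel_iff, if_neg (by simp only; omega)]
    exact ⟨by simp only; omega, h⟩

/-- Replaces the indexing of the relations by two invariants of a pair, its distance and its
relative sign. -/
theorem mem_rel_iff_of_mem [FiniteDimensional F V] (δ : S.DetFamily) {i : Fin (2 * n + 1 + 1)}
    {p q : Cover S} (h : (p, q) ∈ rel δ i) (p' q' : Cover S) : (p', q') ∈ rel δ i ↔
      S.dist p'.1 q'.1 = S.dist p.1 q.1 ∧ relSign δ p' q' = relSign δ p q := by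
  rw [mem_rel_iff] at h ⊢
  split_ifs with hi
  · rw [if_pos hi] at h
    rw [h.1, h.2]
  · rw [if_neg hi] at h
    rw [h.1, h.2]

theorem rel_disjoint [FiniteDimensional F V] (δ : S.DetFamily) {i j : Fin (2 * n + 1 + 1)}
    {p q : Cover S} (hi : (p, q) ∈ rel δ i) (hj : (p, q) ∈ rel δ j) : i = j := by
  have h : (1 : ℤˣ) ≠ -1 := by decide
  rw [mem_rel_iff] at hi hj
  split_ifs at hi hj with h1 h2 h2
  · exact Fin.ext (hi.1.symm.trans hj.1)
  · exact absurd (hi.2.symm.trans hj.2) h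
  · exact absurd (hj.2.symm.trans hi.2) h
  · have := hi.1.symm.trans hj.1
    exact Fin.ext (by omega)

theorem rel_nonempty [FiniteDimensional F V] (h2 : (2 : F) ≠ 0) (δ : S.DetFamily)
    (i : Fin (2 * n + 1 + 1)) : (rel δ i).Nonempty := by
  have h : ∀ a : ℤˣ, 1 * a * a = 1 ∧ 1 * (-a) * a = -1 := by decide
  by_cases hi : (i : ℕ) ≤ n
  · obtain ⟨X, Y, hXY⟩ := exists_dist_eq (S := S) h2 hi
    refine ⟨((X, 1), (Y, maslov δ X Y)), ?_⟩
    rw [mem_rel_iff, if_pos hi]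
    exact ⟨hXY, (h _).1⟩
  · obtain ⟨X, Y, hXY⟩ := exists_dist_eq (S := S) h2 (k := 2 * n + 1 - i) (by omega)
    refine ⟨((X, 1), (Y, -maslov δ X Y)), ?_⟩
    rw [mem_rel_iff, if_neg hi]
    exact ⟨hXY, (h _).2⟩

theorem mem_schemeAut_iff [FiniteDimensional F V] (δ : S.DetFamily) (π : Equiv.Perm (Cover S)) :
    π ∈ schemeAut (rel δ) ↔ ∀ p q, S.dist (π p).1 (π q).1 = S.dist p.1 q.1 ∧
      relSign δ (π p) (π q) = relSign δ p q := by
  constructor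
  · intro h p q
    obtain ⟨i, hi⟩ := exists_mem_rel δ p q
    exact (mem_rel_iff_of_mem δ hi _ _).1 ((h i p q).2 hi)
  · intro h i p q
    rw [mem_rel_iff, mem_rel_iff, (h p q).1, (h p q).2]

/-! ### The groups -/

section Groups

variable [Finite F] [FiniteDimensional F V] (δ : S.DetFamily) (hq : Nat.card F % 4 = 1)

theorem twoPSigmaSpHom_apply (s : ℤˣ) (g : S.sigmaSp) (p : Cover S) :
    twoPSigmaSpHom δ hq (s, (g : S.PSigmaSp)) p =
      (S.genMap g p.1, s * (chi (multiplier δ g p.1) * p.2)) := rfl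

theorem twoPSpHom_apply (s : ℤˣ) (g : S.sp) (p : Cover S) :
    twoPSpHom δ hq (s, (g : S.PSp)) p =
      (S.genMap (Subgroup.inclusion S.sp_le_sigmaSp g) p.1,
        s * (chi (multiplier δ (Subgroup.inclusion S.sp_le_sigmaSp g) p.1) * p.2)) := rfl

theorem twoPSpHom_range_le : (twoPSpHom δ hq).range ≤ (twoPSigmaSpHom δ hq).range := by
  rintro _ ⟨x, rfl⟩
  exact ⟨_, rfl⟩

theorem twoPSigmaSpHom_range_le : (twoPSigmaSpHom δ hq).range ≤ schemeAut (rel δ) := by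
  rintro _ ⟨⟨s, g⟩, rfl⟩
  obtain ⟨g, rfl⟩ := QuotientGroup.mk_surjective g
  rw [mem_schemeAut_iff]
  intro p q
  refine ⟨dist_genMap g _ _, ?_⟩
  have h : ∀ s a b c d m : ℤˣ, s * (a * b) * (s * (c * d)) * (a * c * m) = b * d * m := by decide
  change s * (chi (multiplier δ g p.1) * p.2) * (s * (chi (multiplier δ g q.1) * q.2)) *
    maslov δ (S.genMap g p.1) (S.genMap g q.1) = _
  rw [maslov_genMap, h]
  rfl

/-- An isometry matches the underlying generators and the sign factor `s` is chosen to send `p` to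
`p'`; equality of the relative signs then forces `q` to go to `q'`. -/
theorem exists_mem_range_of_rel {p q p' q' : Cover S}
    (h1 : S.dist p'.1 q'.1 = S.dist p.1 q.1) (h2 : relSign δ p' q' = relSign δ p q) :
    ∃ π ∈ (twoPSpHom δ hq).range, π p = p' ∧ π q = q' := by
  obtain ⟨g, hg1, hg2⟩ := exists_sp_genMap (two_ne_zero_of_card hq) h1.symm
  set g' := Subgroup.inclusion S.sp_le_sigmaSp g with hg'
  have hm := maslov_genMap δ g' p.1 q.1
  rw [hg1, hg2] at hm
  have h : ∀ a b c d e f m : ℤˣ, e * f * (a * b * m) = c * d * m →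
      (e * (a * c)) * (a * c) = e ∧ (e * (a * c)) * (b * d) = f := by decide
  rw [relSign, relSign, hm] at h2
  obtain ⟨h3, h4⟩ := h _ _ _ _ _ _ _ h2
  refine ⟨_, ⟨(p'.2 * (chi (multiplier δ g' p.1) * p.2), (g : S.PSp)), rfl⟩, ?_, ?_⟩
  · rw [twoPSpHom_apply]
    exact Prod.ext hg1 h3
  · rw [twoPSpHom_apply]
    exact Prod.ext hg2 h4

section Orbits

variable {G : Subgroup (Equiv.Perm (Cover S))} (hG : (twoPSpHom δ hq).range ≤ G)
  (hG' : G ≤ schemeAut (rel δ))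

include hG hG'

theorem orbit_eq_rel {i : Fin (2 * n + 1 + 1)} {x : Cover S × Cover S} (hx : x ∈ rel δ i) :
    MulAction.orbit G x = rel δ i := by
  obtain ⟨p, q⟩ := x
  ext ⟨p', q'⟩
  constructor
  · rintro ⟨π, hπ⟩
    have h1 : π.1 p = p' := congrArg Prod.fst hπ
    have h2 : π.1 q = q' := congrArg Prod.snd hπ
    rw [← h1, ← h2]
    exact (hG' π.2 i p q).2 hx
  · intro h
    obtain ⟨h1, h2⟩ := (mem_rel_iff_of_mem δ hx _ _).1 h
    obtain ⟨π, hπ, h3, h4⟩ := exists_mem_range_of_rel δ hq h1 h2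
    exact ⟨⟨π, hG hπ⟩, Prod.ext h3 h4⟩

/-- The lower bound on `G` makes each relation a single orbit and the upper bound keeps orbits
inside relations, so one argument covers both `2 × PSp` and `2 × PΣSp`. -/
theorem areOrbitals_of_le : AreOrbitals G (rel δ) := by
  have h2 := two_ne_zero_of_card hq
  refine ⟨fun i j hij => ?_, Set.ext fun O => ⟨?_, ?_⟩⟩
  · obtain ⟨⟨p, q⟩, hpq⟩ := rel_nonempty h2 δ i
    exact rel_disjoint δ hpq (hij ▸ hpq)
  · rintro ⟨i, rfl⟩
    obtain ⟨x, hx⟩ := rel_nonempty h2 δ i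
    exact ⟨x, (orbit_eq_rel δ hq hG hG' hx).symm⟩
  · rintro ⟨x, rfl⟩
    obtain ⟨i, hi⟩ := exists_mem_rel δ x.1 x.2
    exact ⟨i, (orbit_eq_rel δ hq hG hG' hi).symm⟩

end Orbits

theorem isPretransitive_twoPSp :
    MulAction.IsPretransitive (twoPSpHom δ hq).range (Cover S) := by
  refine ⟨fun p q => ?_⟩
  obtain ⟨π, hπ, h, -⟩ := exists_mem_range_of_rel δ hq (p := p) (q := p) (p' := q) (q' := q)
    (by rw [dist_self, dist_self]) (by rw [relSign_self, relSign_self])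
  exact ⟨⟨π, hπ⟩, h⟩

include hq in
theorem isAssociationScheme_rel : IsAssociationScheme (2 * n + 1) (rel δ) := by
  have h2 := two_ne_zero_of_card hq
  have hV : Finite V := Module.finite_of_finite F
  refine ⟨inferInstance, rel_nonempty h2 δ, fun i j hij => ?_, ?_, ?_, fun i p q h => ?_, ?_⟩
  · rw [Set.disjoint_left]
    rintro ⟨p, q⟩ hi hj
    exact hij (rel_disjoint δ hi hj)
  · exact Set.eq_univ_of_forall fun x => Set.mem_iUnion.2 (exists_mem_rel δ x.1 x.2)
  · ext ⟨p, q⟩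
    rw [mem_rel_iff, if_pos (by simp)]
    constructor
    · rintro ⟨h3, h4⟩
      have h5 := eq_of_dist_eq_zero h3
      refine Prod.ext h5 ?_
      rw [relSign, h5, maslov_self, mul_one] at h4
      have : ∀ a b : ℤˣ, a * b = 1 → a = b := by decide
      exact this _ _ h4
    · rintro h
      obtain rfl : p = q := h
      exact ⟨dist_self _, relSign_self δ p⟩
  · rw [mem_rel_iff_of_mem δ h, dist_comm, relSign, relSign, maslov_comm hq, mul_comm p.2]
    exact ⟨rfl, rfl⟩
  -- The intersection numbers are counted at one representative pair of each relation and carried to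
  -- any other pair by an automorphism.
  · choose x hx using rel_nonempty h2 δ
    refine ⟨fun i j k => Set.ncard {z | ((x k).1, z) ∈ rel δ i ∧ (z, (x k).2) ∈ rel δ j},
      fun i j k p q hpq => ?_⟩
    obtain ⟨h3, h4⟩ := (mem_rel_iff_of_mem δ hpq _ _).1 (hx k)
    obtain ⟨π, hπ, h5, h6⟩ := exists_mem_range_of_rel δ hq h3 h4
    have hπ' := twoPSigmaSpHom_range_le δ hq (twoPSpHom_range_le δ hq hπ)
    change _ = Set.ncard _
    rw [← Set.ncard_image_of_injective _ π.injective]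
    congr 1
    ext z
    constructor
    · rintro ⟨z, ⟨h7, h8⟩, rfl⟩
      rw [← h5, ← h6]
      exact ⟨(hπ' i _ _).2 h7, (hπ' j _ _).2 h8⟩
    · rintro ⟨h7, h8⟩
      refine ⟨π.symm z, ⟨(hπ' i _ _).1 ?_, (hπ' j _ _).1 ?_⟩, π.apply_symm_apply z⟩
      · rwa [h5, Equiv.apply_symm_apply]
      · rwa [h6, Equiv.apply_symm_apply]

include hq in
theorem isSchurianScheme_rel : IsSchurianScheme (2 * n + 1) (rel δ) :=
  ⟨isAssociationScheme_rel δ hq, _, isPretransitive_twoPSp δ hq,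
    areOrbitals_of_le δ hq le_rfl ((twoPSpHom_range_le δ hq).trans (twoPSigmaSpHom_range_le δ hq))⟩

end Groups

end SymplecticForm

end SympCover

namespace SympCover

open Matrix

theorem chi_eq_quadraticChar {F : Type*} [Field F] [Fintype F] [DecidableEq F] {a : F}
    (ha : a ≠ 0) : ((chi a : ℤˣ) : ℤ) = quadraticChar F a := by
  rw [quadraticChar_apply, quadraticCharFun, if_neg ha, chi]
  split_ifs <;> rfl

/-- If `M` and `W` differ only in row `i` and the other rows are orthogonal to `u ≠ 0`, then their
determinants are proportional to the products of their rows `i` with `u`. -/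
theorem det_mul_dotProduct_eq {F : Type*} [Field F] {ι : Type*} [Fintype ι] [DecidableEq ι]
    {M W : Matrix ι ι F} {i : ι} {u : ι → F} (hu : u ≠ 0) (h : ∀ j, j ≠ i → M j = W j)
    (hW : ∀ j, j ≠ i → W j ⬝ᵥ u = 0) : (W i ⬝ᵥ u) * M.det = (M i ⬝ᵥ u) * W.det := by
  have hup : ∀ v, M.updateRow i v = W.updateRow i v := fun v => by
    ext j l
    by_cases hj : j = i
    · subst hj; simp
    · simp [updateRow_ne hj, h j hj]
  -- Here `N u` is supported at `i`, so `adj(N) N u = det(N) u` expresses `det N` through cofactors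
  -- along row `i`. These cofactors ignore row `i` and are shared by `M` and `W`.
  have key : ∀ N : Matrix ι ι F, (∀ j, j ≠ i → N j ⬝ᵥ u = 0) → ∀ l,
      N.det * u l = (N i ⬝ᵥ u) * (N.updateRow i (Pi.single l 1)).det := fun N hN l => by
    have h1 : N *ᵥ u = Pi.single i (N i ⬝ᵥ u) := by
      funext j
      by_cases hj : j = i
      · subst hj; simp [mulVec]
      · rw [Pi.single_eq_of_ne hj]; exact hN j hj
    have h2 := congrFun (congrArg (fun A => A *ᵥ u) (adjugate_mul N)) l
    simp only [← mulVec_mulVec, h1, mulVec_single, smul_mulVec, one_mulVec] at h2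
    simp only [Pi.smul_apply, smul_eq_mul, col_apply, adjugate_apply, MulOpposite.smul_eq_mul_unop,
      MulOpposite.unop_op] at h2
    rw [← h2, mul_comm]
  obtain ⟨l, hl⟩ := Function.ne_iff.1 hu
  have h1 := key M (fun j hj => by rw [h j hj, hW j hj]) l
  have h2 := key W hW l
  rw [hup] at h1
  apply mul_right_cancel₀ hl
  linear_combination (W i ⬝ᵥ u) * h1 - (M i ⬝ᵥ u) * h2

namespace SymplecticForm

variable {F V : Type*} [Field F] [AddCommGroup V] [Module F V] {n : ℕ}
  {S : SymplecticForm F V n}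

theorem dist_eq_iff_inf_eq_bot [FiniteDimensional F V] (X Y : S.Gen) :
    S.dist X Y = n ↔ X.1 ⊓ Y.1 = ⊥ := by
  have h : Module.finrank F (X.1 ⊓ Y.1 : Submodule F V) ≤ n :=
    (Submodule.finrank_mono inf_le_left).trans_eq (S.gen_finrank X)
  rw [← Submodule.finrank_eq_zero, dist]
  omega

theorem linearIndependent_of_det_ne_zero (δ : S.DetFamily) {X : S.Gen} {x : Fin n → X.1}
    (hx : δ.det X x ≠ 0) : LinearIndependent F x := by
  by_contra h
  exact hx ((δ.det X).map_linearDependent x h)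

theorem gram_det_ne_zero_of_opposite [FiniteDimensional F V] {X Y : S.Gen} (h : S.dist X Y = n)
    {x : Fin n → X.1} (hx : LinearIndependent F x) (y : Module.Basis (Fin n) F Y.1) :
    (Matrix.of fun i j => S.form (x i) (y j)).det ≠ 0 := by
  intro h0
  obtain ⟨c, hc, hc0⟩ := exists_vecMul_eq_zero_iff.2 h0
  let z : X.1 := ∑ i, c i • x i
  have hzy : ∀ j, S.form z (y j) = 0 := fun j => by
    have := congrFun hc0 j
    simpa [z, vecMul, dotProduct] using this
  have hz : (z : V) ∈ Y.1 := by
    rw [mem_gen_iff]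
    intro u hu
    have h2 : S.form z (⟨u, hu⟩ : Y.1) = 0 := by
      rw [← y.sum_repr ⟨u, hu⟩]
      simp only [Submodule.coe_sum, Submodule.coe_smul, map_sum, map_smul, hzy]
      simp
    rw [form_neg]
    simpa using h2
  have hz0 : (z : V) ∈ X.1 ⊓ Y.1 := ⟨z.2, hz⟩
  rw [(dist_eq_iff_inf_eq_bot X Y).1 h, Submodule.mem_bot] at hz0
  exact hc (funext (Fintype.linearIndependent_iff.1 hx c (Subtype.ext hz0)))

/-! ### Generators opposite and adjacent to a given one -/

/-- The graph of a matrix. -/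
def graphSubmodule (A : Matrix (Fin n) (Fin n) F) :
    Submodule F ((Fin n → F) × (Fin n → F)) where
  carrier := {m | m.1 = A *ᵥ m.2}
  zero_mem' := by simp
  add_mem' := fun {a b} ha hb => by
    change a.1 + b.1 = A *ᵥ (a.2 + b.2)
    rw [mulVec_add, ← ha.out, ← hb.out]
  smul_mem' := fun c {a} ha => by
    change c • a.1 = A *ᵥ (c • a.2)
    rw [mulVec_smul, ← ha.out]

theorem graphSubmodule_orthogonal {A : Matrix (Fin n) (Fin n) F} (hA : A.IsSymm)
    (m : (Fin n → F) × (Fin n → F)) : m ∈ graphSubmodule A ↔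
      ∀ m' ∈ graphSubmodule A, m'.1 ⬝ᵥ m.2 - m'.2 ⬝ᵥ m.1 = 0 := by
  have hs : ∀ x y : Fin n → F, A *ᵥ x ⬝ᵥ y = x ⬝ᵥ A *ᵥ y := fun x y => by
    rw [dotProduct_mulVec, ← mulVec_transpose, hA.eq]
  constructor
  · intro hm m' hm'
    rw [hm.out, hm'.out, hs, sub_self]
  · intro h
    change m.1 = A *ᵥ m.2
    refine (sub_eq_zero.1 (dotProduct_eq_zero _ fun w => ?_)).symm
    have := h (A *ᵥ w, w) rfl
    rw [hs] at this
    rw [sub_dotProduct, dotProduct_comm _ w, dotProduct_comm _ w]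
    exact this

/-- The generators at distance `1` from `{(a, 0)}` in coordinates. -/
def nbrSubmodule (u : Fin n → F) (c : F) : Submodule F ((Fin n → F) × (Fin n → F)) where
  carrier := {m | ∃ t : F, m.2 = t • u ∧ m.1 ⬝ᵥ u = t * c}
  zero_mem' := ⟨0, by simp⟩
  add_mem' := by
    rintro a b ⟨s, h1, h2⟩ ⟨t, h3, h4⟩
    exact ⟨s + t, by rw [Prod.snd_add, h1, h3, add_smul], by
      rw [Prod.fst_add, add_dotProduct, h2, h4, add_mul]⟩
  smul_mem' := by
    rintro r a ⟨s, h1, h2⟩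
    exact ⟨r * s, by rw [Prod.smul_snd, h1, smul_smul], by
      rw [Prod.smul_fst, smul_dotProduct, h2, smul_eq_mul, mul_assoc]⟩

theorem nbrSubmodule_orthogonal {u : Fin n → F} (hu : u ≠ 0) (c : F)
    (m : (Fin n → F) × (Fin n → F)) : m ∈ nbrSubmodule u c ↔
      ∀ m' ∈ nbrSubmodule u c, m'.1 ⬝ᵥ m.2 - m'.2 ⬝ᵥ m.1 = 0 := by
  constructor
  · rintro ⟨s, h1, h2⟩ m' ⟨t, h3, h4⟩
    rw [h1, h3, dotProduct_smul, smul_dotProduct, h4, dotProduct_comm u, h2, smul_eq_mul,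
      smul_eq_mul]
    ring
  · intro h
    obtain ⟨r, hr⟩ := exists_smul_eq_of_dotProduct (b := m.2) hu fun x hx => by
      have := h (x, 0) ⟨0, by simp, by rw [dotProduct_comm, hx, zero_mul]⟩
      rw [dotProduct_comm]
      simpa using this
    obtain ⟨y, hy⟩ := exists_dotProduct_ne_zero hu
    rw [dotProduct_comm] at hy
    refine ⟨r, hr, ?_⟩
    have := h ((c / (y ⬝ᵥ u)) • y, u) ⟨1, by simp, by
      rw [smul_dotProduct, smul_eq_mul]; field_simp⟩
    simp only [hr, smul_dotProduct, dotProduct_smul, smul_eq_mul, dotProduct_comm u] at this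
    field_simp at this
    linear_combination -this

section Coordinates

variable {φ : V ≃ₗ[F] (Fin n → F) × (Fin n → F)} (hφ : S.IsSymplCoord φ)

/-- The generator with equation `a = A b`. -/
def oppGen {A : Matrix (Fin n) (Fin n) F} (hA : A.IsSymm) : S.Gen :=
  genOfCoord hφ (graphSubmodule A) (graphSubmodule_orthogonal hA)

/-- The generator of all `(a, t u)` with `a · u = t c`. -/
def nbrGen {u : Fin n → F} (hu : u ≠ 0) (c : F) : S.Gen :=
  genOfCoord hφ (nbrSubmodule u c) (nbrSubmodule_orthogonal hu c)

theorem mem_oppGen {A : Matrix (Fin n) (Fin n) F} (hA : A.IsSymm) (v : V) :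
    v ∈ (oppGen hφ hA).1 ↔ (φ v).1 = A *ᵥ (φ v).2 := Iff.rfl

theorem mem_nbrGen {u : Fin n → F} (hu : u ≠ 0) (c : F) (v : V) :
    v ∈ (nbrGen hφ hu c).1 ↔ ∃ t : F, (φ v).2 = t • u ∧ (φ v).1 ⬝ᵥ u = t * c := Iff.rfl

theorem oppGen_injective {A B : Matrix (Fin n) (Fin n) F} (hA : A.IsSymm) (hB : B.IsSymm)
    (h : oppGen hφ hA = oppGen hφ hB) : A = B := by
  refine ext_of_mulVec_single fun i => ?_
  have h1 : φ.symm (A *ᵥ Pi.single i 1, Pi.single i 1) ∈ (oppGen hφ hA).1 := by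
    rw [mem_oppGen]; simp
  rw [h, mem_oppGen] at h1
  simpa using h1

/-- The parameters `(u, c)` of a neighbour matter only up to `(r u, r² c)`. -/
theorem nbrGen_smul {u : Fin n → F} (hu : u ≠ 0) {r : F} (hr : r ≠ 0) (hru : r • u ≠ 0) (c : F) :
    nbrGen hφ hru (r ^ 2 * c) = nbrGen hφ hu c := by
  refine gen_eq_of_le fun v => ?_
  rw [mem_nbrGen, mem_nbrGen]
  rintro ⟨t, h1, h2⟩
  refine ⟨t * r, by rw [h1, smul_smul], ?_⟩
  rw [dotProduct_smul, smul_eq_mul] at h2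
  apply mul_left_cancel₀ hr
  linear_combination h2

variable [FiniteDimensional F V] {E : S.Gen} (hE : ∀ v, v ∈ E.1 ↔ (φ v).2 = 0)

include hE

theorem dist_oppGen {A : Matrix (Fin n) (Fin n) F} (hA : A.IsSymm) :
    S.dist E (oppGen hφ hA) = n := by
  rw [dist_eq_iff_inf_eq_bot, eq_bot_iff]
  rintro v ⟨h1, h2⟩
  have h1' := (hE v).1 h1
  have h2' := (mem_oppGen hφ hA v).1 h2
  rw [h1', mulVec_zero] at h2'
  exact (Submodule.mem_bot F).2 (φ.map_eq_zero_iff.1 (Prod.ext h2' h1'))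

omit [FiniteDimensional F V] hE in
theorem isSymm_of_dotProduct {A : Matrix (Fin n) (Fin n) F}
    (h : ∀ x y, A *ᵥ x ⬝ᵥ y = x ⬝ᵥ A *ᵥ y) : A.IsSymm := by
  ext i j
  have := h (Pi.single i 1) (Pi.single j 1)
  simpa [eq_comm] using this

-- Projection to the second component is injective on `X` because `X ∩ E = 0`, so `X` is a graph;
-- isotropy of `X` is symmetry of its matrix.
include hφ in
theorem exists_eq_oppGen {X : S.Gen} (hX : S.dist E X = n) :
    ∃ (A : Matrix (Fin n) (Fin n) F) (hA : A.IsSymm), X = oppGen hφ hA := by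
  rw [dist_eq_iff_inf_eq_bot] at hX
  let T : X.1 →ₗ[F] (Fin n → F) := LinearMap.snd F _ _ ∘ₗ φ.toLinearMap ∘ₗ X.1.subtype
  have hT : Function.Injective T := by
    rw [← LinearMap.ker_eq_bot, LinearMap.ker_eq_bot']
    intro v hv
    have h1 : (v : V) ∈ E.1 ⊓ X.1 := ⟨(hE v).2 hv, v.2⟩
    rw [hX] at h1
    exact Subtype.ext h1
  let e := LinearEquiv.ofInjectiveOfFinrankEq T hT (by
    rw [S.gen_finrank, Module.finrank_fin_fun])
  have he : ∀ b, (φ (e.symm b)).2 = b := fun b => e.apply_symm_apply b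
  let A := LinearMap.toMatrix' (LinearMap.fst F _ _ ∘ₗ φ.toLinearMap ∘ₗ X.1.subtype ∘ₗ
    e.symm.toLinearMap)
  have hA1 : ∀ b, A *ᵥ b = (φ (e.symm b)).1 := fun b => by
    rw [LinearMap.toMatrix'_mulVec]; rfl
  have hA : A.IsSymm := isSymm_of_dotProduct fun x y => by
    have h1 := form_eq_zero X (e.symm x).2 (e.symm y).2
    rw [hφ, he, he, ← hA1, ← hA1] at h1
    exact sub_eq_zero.1 h1
  refine ⟨A, hA, gen_eq_of_le fun v hv => ?_⟩
  rw [mem_oppGen, hA1]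
  have : e.symm (φ v).2 = ⟨v, hv⟩ := e.symm_apply_apply ⟨v, hv⟩
  rw [this]

theorem finrank_inf_nbrGen {u : Fin n → F} (hu : u ≠ 0) (c : F) :
    Module.finrank F (E.1 ⊓ (nbrGen hφ hu c).1 : Submodule F V) + 1 = n := by
  let T : E.1 →ₗ[F] F := dotProductBilin F F u ∘ₗ LinearMap.fst F _ _ ∘ₗ φ.toLinearMap ∘ₗ
    E.1.subtype
  have hTv : ∀ v : E.1, T v = u ⬝ᵥ (φ v).1 := fun v => rfl
  have hT : T ≠ 0 := fun h => by
    obtain ⟨y, hy⟩ := exists_dotProduct_ne_zero hu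
    apply hy
    have := LinearMap.congr_fun h ⟨φ.symm (y, 0), (hE _).2 (by simp)⟩
    rw [hTv] at this
    simpa using this
  have hmap : (LinearMap.ker T).map E.1.subtype = E.1 ⊓ (nbrGen hφ hu c).1 := by
    ext v
    constructor
    · rintro ⟨w, hw, rfl⟩
      refine ⟨w.2, (mem_nbrGen hφ hu _ _).2 ⟨0, ?_, ?_⟩⟩
      · rw [zero_smul]; exact (hE _).1 w.2
      · rw [zero_mul, dotProduct_comm]; exact hw
    · rintro ⟨hvE, hvN⟩
      obtain ⟨t, h1, h2⟩ := (mem_nbrGen hφ hu _ _).1 hvN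
      rw [(hE v).1 hvE] at h1
      refine ⟨⟨v, hvE⟩, ?_, rfl⟩
      rw [SetLike.mem_coe, LinearMap.mem_ker, hTv, dotProduct_comm, h2,
        (smul_eq_zero.1 h1.symm).resolve_right hu, zero_mul]
  have h := LinearMap.finrank_range_add_finrank_ker T
  rw [LinearMap.range_eq_top.2 (LinearMap.surjective hT), finrank_top, Module.finrank_self,
    S.gen_finrank, add_comm] at h
  rw [← hmap, Submodule.finrank_map_subtype_eq]
  exact h

theorem dist_nbrGen {u : Fin n → F} (hu : u ≠ 0) (c : F) : S.dist E (nbrGen hφ hu c) = 1 := by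
  have := finrank_inf_nbrGen hφ hE hu c
  rw [dist]
  omega

-- For any `v ∈ X` outside `E`, the generator `X` is spanned by `v` and `E ∩ v^⊥`; this gives `u =
-- (φ v).2` and `c = (φ v).1 ⬝ᵥ (φ v).2`.
include hφ in
theorem exists_eq_nbrGen {X : S.Gen} (hX : S.dist E X = 1) :
    ∃ (u : Fin n → F) (hu : u ≠ 0) (c : F), X = nbrGen hφ hu c := by
  obtain ⟨v, hvX, hvE⟩ : ∃ v ∈ X.1, v ∉ E.1 := by
    by_contra! h
    rw [gen_eq_of_le (X := X) (Y := E) h, dist_self] at hX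
    omega
  have hu : (φ v).2 ≠ 0 := fun h => hvE ((hE v).2 h)
  refine ⟨(φ v).2, hu, (φ v).1 ⬝ᵥ (φ v).2, (gen_eq_of_le fun w => ?_).symm⟩
  have h1 := finrank_inf_nbrGen hφ hE hu ((φ v).1 ⬝ᵥ (φ v).2)
  have hle : E.1 ⊓ X.1 ≤ E.1 ⊓ (nbrGen hφ hu ((φ v).1 ⬝ᵥ (φ v).2)).1 := by
    rintro w ⟨hwE, hwX⟩
    refine ⟨hwE, (mem_nbrGen hφ hu _ _).2 ⟨0, by rw [(hE w).1 hwE, zero_smul], ?_⟩⟩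
    have := form_eq_zero X hwX hvX
    rw [hφ, (hE w).1 hwE, zero_dotProduct, sub_zero] at this
    rw [this, zero_mul]
  have heq := Submodule.eq_of_le_of_finrank_eq hle (by rw [dist] at hX; omega)
  rw [mem_nbrGen]
  rintro ⟨t, h2, h3⟩
  have h4 : w - t • v ∈ E.1 ⊓ (nbrGen hφ hu ((φ v).1 ⬝ᵥ (φ v).2)).1 := by
    refine ⟨(hE _).2 (by simp [h2]), (mem_nbrGen hφ hu _ _).2 ⟨0, by simp [h2], ?_⟩⟩
    simp [sub_dotProduct, h3]
  rw [← heq] at h4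
  have h5 := X.1.add_mem h4.2 (X.1.smul_mem t hvX)
  rwa [sub_add_cancel] at h5

omit hE in
theorem dist_nbrGen_oppGen {u : Fin n → F} (hu : u ≠ 0) (c : F) {A : Matrix (Fin n) (Fin n) F}
    (hA : A.IsSymm) : S.dist (nbrGen hφ hu c) (oppGen hφ hA) = n ↔ qform A u ≠ c := by
  rw [dist_eq_iff_inf_eq_bot]
  constructor
  · rintro h rfl
    have h1 : φ.symm (A *ᵥ u, u) ∈ (nbrGen hφ hu (qform A u)).1 ⊓ (oppGen hφ hA).1 :=
      ⟨(mem_nbrGen hφ hu _ _).2 ⟨1, by simp, by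
        simp [qform, dotProduct_comm]⟩, (mem_oppGen hφ hA _).2 (by simp)⟩
    rw [h, Submodule.mem_bot, LinearEquiv.map_eq_zero_iff] at h1
    exact hu (congrArg Prod.snd h1)
  · intro h
    rw [eq_bot_iff]
    rintro v ⟨h1, h2⟩
    obtain ⟨t, h3, h4⟩ := (mem_nbrGen hφ hu _ _).1 h1
    have h5 := (mem_oppGen hφ hA _).1 h2
    rw [h5, h3, mulVec_smul, smul_dotProduct, smul_eq_mul, dotProduct_comm] at h4
    have ht : t = 0 := by
      by_contra ht
      exact h (mul_left_cancel₀ ht h4)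
    rw [ht, zero_smul] at h3
    rw [h3, mulVec_zero] at h5
    exact (Submodule.mem_bot F).2 (φ.map_eq_zero_iff.1 (Prod.ext h5 h3))

/-- Bases of `E` and of its neighbour are chosen to differ in one vector, so their Gram matrices
`W`, `M` against the graph of `A` differ in one row. Then `det M` is `det W` times an explicit
factor containing `c - qform A u`; all else is a square, and so is `-1`. -/
theorem maslov_triple [Finite F] (hq : Nat.card F % 4 = 1) (δ : S.DetFamily) {u : Fin n → F}
    (hu : u ≠ 0) {c : F} {A : Matrix (Fin n) (Fin n) F} (hA : A.IsSymm) (hc : qform A u ≠ c) :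
    maslov δ E (nbrGen hφ hu c) * maslov δ E (oppGen hφ hA) *
      maslov δ (nbrGen hφ hu c) (oppGen hφ hA) = chi (qform A u - c) := by
  have hn : 1 ≤ n := by have := finrank_inf_nbrGen hφ hE hu c; omega
  have hd := dist_nbrGen hφ hE hu c
  obtain ⟨x, y, hx, hy, hxy, -⟩ := exists_adapted δ E (nbrGen hφ hu c)
  rw [hd] at hxy
  let i₀ : Fin n := ⟨0, hn⟩
  have hi₀ : ∀ i, i ≠ i₀ → 1 ≤ (i : ℕ) := fun i hi =>
    Nat.one_le_iff_ne_zero.2 fun h => hi (Fin.ext h)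
  -- the basis of the opposite generator
  let e : (oppGen hφ hA).1 ≃ₗ[F] (Fin n → F) :=
    { toFun := fun v => (φ v).2
      map_add' := fun v w => by simp
      map_smul' := fun r v => by simp
      invFun := fun b => ⟨φ.symm (A *ᵥ b, b), (mem_oppGen hφ hA _).2 (by simp)⟩
      left_inv := fun v => Subtype.ext (φ.injective (by
        rw [LinearEquiv.apply_symm_apply]
        exact Prod.ext ((mem_oppGen hφ hA _).1 v.2).symm rfl))
      right_inv := fun b => by simp }
  let z : Module.Basis (Fin n) F (oppGen hφ hA).1 := Module.Basis.ofEquivFun e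
  have hz : ∀ i, φ (z i) = (A *ᵥ Pi.single i 1, Pi.single i 1) := fun i => by
    rw [Module.Basis.coe_ofEquivFun]
    exact φ.apply_symm_apply _
  have hzδ := det_basis_ne_zero δ z
  have hform : ∀ v i, S.form v (z i) = ((φ v).1 - A *ᵥ (φ v).2) i := fun v i => by
    have hs : (φ v).2 ⬝ᵥ A *ᵥ Pi.single i 1 = (A *ᵥ (φ v).2) i := by
      rw [dotProduct_mulVec, ← mulVec_transpose, hA.eq]; simp
    rw [hφ, hz, hs]; simp
  rw [maslov_eq_maslovVal δ hd hn hx hy hxy,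
    maslov_eq_maslovVal δ (dist_oppGen hφ hE hA) le_rfl hx hzδ fun i hi => absurd i.2 (by omega),
    maslov_eq_maslovVal δ ((dist_nbrGen_oppGen hφ hu c hA).2 hc) le_rfl hy hzδ
      fun i hi => absurd i.2 (by omega), maslovVal, maslovVal, maslovVal]
  let W : Matrix (Fin n) (Fin n) F := Matrix.of fun i j => S.form (x i) (z j)
  let M : Matrix (Fin n) (Fin n) F := Matrix.of fun i j => S.form (y i) (z j)
  obtain ⟨t, ht1, ht2⟩ := (mem_nbrGen hφ hu _ _).1 (y i₀).2
  have hWi : ∀ i, W i = (φ (x i)).1 := fun i => by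
    funext j
    simp only [W, of_apply, hform]
    rw [(hE _).1 (x i).2, mulVec_zero, sub_zero]
  have hMi : M i₀ = (φ (y i₀)).1 - t • (A *ᵥ u) := by
    funext j
    simp only [M, of_apply, hform, ht1, mulVec_smul]
  have hMW : ∀ i, i ≠ i₀ → M i = W i := fun i hi => by
    funext j
    simp only [M, W, of_apply, hxy i (hi₀ i hi)]
  have hWu : ∀ i, i ≠ i₀ → W i ⬝ᵥ u = 0 := fun i hi => by
    have h1 : (x i : V) ∈ (nbrGen hφ hu c).1 := by rw [hxy i (hi₀ i hi)]; exact (y i).2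
    obtain ⟨s, hs1, hs2⟩ := (mem_nbrGen hφ hu _ _).1 h1
    rw [(hE _).1 (x i).2] at hs1
    have hs : s = 0 := (smul_eq_zero.1 hs1.symm).resolve_right hu
    rw [hWi, hs2, hs, zero_mul]
  -- The common rows are orthogonal to `u`, because the common basis vectors lie in the intersection
  -- of `E` with its neighbour.
  have hdet := det_mul_dotProduct_eq hu hMW hWu
  have hMu : M i₀ ⬝ᵥ u = t * (c - qform A u) := by
    rw [hMi, sub_dotProduct, ht2, smul_dotProduct, smul_eq_mul, dotProduct_comm]
    simp only [qform]; ring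
  have hg : (Matrix.of fun i j : Fin 1 => S.form (x (Fin.castLE hn i)) (y (Fin.castLE hn j))).det =
      t * (W i₀ ⬝ᵥ u) := by
    rw [det_unique, of_apply]
    change S.form (x i₀) (y i₀) = _
    rw [hφ, (hE _).1 (x i₀).2, zero_dotProduct, sub_zero, ht1, dotProduct_smul, hWi, smul_eq_mul]
  rw [hg]
  change chi (_ * (t * (W i₀ ⬝ᵥ u))) * chi (_ * W.det) * chi (_ * M.det) = _
  have hW0 : W.det ≠ 0 := gram_det_ne_zero_of_opposite (dist_oppGen hφ hE hA)
    (linearIndependent_of_det_ne_zero δ hx) z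
  have hM0 : M.det ≠ 0 := gram_det_ne_zero_of_opposite ((dist_nbrGen_oppGen hφ hu c hA).2 hc)
    (linearIndependent_of_det_ne_zero δ hy) z
  have hWu0 : W i₀ ⬝ᵥ u ≠ 0 := fun h => hu (eq_zero_of_mulVec_eq_zero hW0 (funext fun i => by
    by_cases hi : i = i₀
    · subst hi; exact h
    · exact hWu i hi))
  rw [hMu] at hdet
  have ht : t ≠ 0 := fun h => mul_ne_zero hWu0 hM0 (by rw [hdet, h]; ring)
  obtain ⟨i, hi⟩ := isSquare_neg_one_of_card hq
  have hi0 : i ≠ 0 := fun h => by rw [h] at hi; simp at hi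
  have h1 := mul_ne_zero (mul_ne_zero hx hy) (mul_ne_zero ht hWu0)
  have h2 := mul_ne_zero (mul_ne_zero hx hzδ) hW0
  have h3 := mul_ne_zero (mul_ne_zero hy hzδ) hM0
  rw [← chi_mul h1 h2, ← chi_mul (mul_ne_zero h1 h2) h3,
    ← chi_mul_sq (qform A u - c) (mul_ne_zero (mul_ne_zero hi0 (mul_ne_zero hx (mul_ne_zero hy hzδ)))
      (mul_ne_zero ht hW0))]
  congr 1
  linear_combination (δ.det E x ^ 2 * δ.det _ y ^ 2 * δ.det _ z ^ 2 * t * W.det) * hdet +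
    (qform A u - c) * (δ.det E x * (δ.det _ y * δ.det _ z) * (t * W.det)) ^ 2 * hi

end Coordinates

end SymplecticForm

end SympCover

namespace SympCover

open Matrix

namespace SymplecticForm

variable {F V : Type*} [Field F] [AddCommGroup V] [Module F V] {n : ℕ}
  {S : SymplecticForm F V n}

/-! ### Rigidity: permutations fixing everything opposite to a generator -/

section Rigidity

variable [FiniteDimensional F V]

/-- This neighbour of `E` is the span of `v` and `E ∩ v^⊥`; it contains `X ∩ E` and also `v`, so it
is closer to `X` than `E` is. -/
theorem dist_nbrGen_lt {φ : V ≃ₗ[F] (Fin n → F) × (Fin n → F)} (hφ : S.IsSymplCoord φ) {E X : S.Gen}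
    (hE : ∀ v, v ∈ E.1 ↔ (φ v).2 = 0) {v : V} (hv : v ∈ X.1) (hu : (φ v).2 ≠ 0) :
    S.dist X (nbrGen hφ hu ((φ v).1 ⬝ᵥ (φ v).2)) < S.dist X E := by
  have hlt : X.1 ⊓ E.1 < X.1 ⊓ (nbrGen hφ hu ((φ v).1 ⬝ᵥ (φ v).2)).1 := by
    refine lt_of_le_of_ne ?_ fun h => ?_
    · rintro w ⟨hwX, hwE⟩
      refine ⟨hwX, (mem_nbrGen hφ hu _ _).2 ⟨0, by rw [(hE w).1 hwE, zero_smul], ?_⟩⟩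
      have := form_eq_zero X hwX hv
      rw [hφ, (hE w).1 hwE, zero_dotProduct, sub_zero] at this
      rw [this, zero_mul]
    · have h1 : v ∈ X.1 ⊓ (nbrGen hφ hu ((φ v).1 ⬝ᵥ (φ v).2)).1 :=
        ⟨hv, (mem_nbrGen hφ hu _ _).2 ⟨1, by simp, by simp⟩⟩
      rw [← h] at h1
      exact hu ((hE v).1 h1.2)
  have h1 := Submodule.finrank_lt_finrank_of_lt hlt
  have h2 : Module.finrank F
      (X.1 ⊓ (nbrGen hφ hu ((φ v).1 ⬝ᵥ (φ v).2)).1 : Submodule F V) ≤ n :=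
    (Submodule.finrank_mono inf_le_left).trans_eq (S.gen_finrank X)
  rw [dist, dist]
  omega

theorem exists_mem_of_dist_lt {X Y E : S.Gen} (h : S.dist X Y < S.dist X E) :
    ∃ w ∈ X.1, w ∈ Y.1 ∧ w ∉ E.1 := by
  by_contra! hall
  have hle : X.1 ⊓ Y.1 ≤ X.1 ⊓ E.1 := fun w hw => ⟨hw.1, hall w hw.1 hw.2⟩
  have h1 := Submodule.finrank_mono hle
  rw [dist, dist] at h
  omega

/-- A distance-preserving permutation of the generators that fixes a generator and all generators
opposite to it is the identity. -/
theorem eq_one_of_fixes_opposite (h2 : (2 : F) ≠ 0) {p : Equiv.Perm S.Gen}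
    (hp : ∀ X Y, S.dist (p X) (p Y) = S.dist X Y) {E : S.Gen} (hpE : p E = E)
    (hopp : ∀ X, S.dist E X = n → p X = X) : p = 1 := by
  -- A neighbour is recovered from the fixed generators opposite to `E` that are not opposite to it,
  -- that is, from the matrices `A` with `qform A u = c`.
  have hnbr : ∀ N, S.dist E N = 1 → p N = N := by
    intro N hN
    obtain ⟨φ, hφ, hE, -⟩ := exists_symplCoord h2 E E
    obtain ⟨u, hu, c, rfl⟩ := exists_eq_nbrGen hφ hE hN
    obtain ⟨u', hu', c', hN'⟩ := exists_eq_nbrGen hφ hE (X := p (nbrGen hφ hu c))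
      ((congrArg (fun Z => S.dist Z _) hpE.symm).trans ((hp E _).trans hN))
    have key : ∀ A : Matrix (Fin n) (Fin n) F, A.IsSymm → (qform A u = c ↔ qform A u' = c') :=
      fun A hA => by
        have h1 := hp (nbrGen hφ hu c) (oppGen hφ hA)
        rw [hopp _ (dist_oppGen hφ hE hA), hN'] at h1
        have h3 := dist_nbrGen_oppGen hφ hu c hA
        rw [← h1, dist_nbrGen_oppGen hφ hu' c' hA] at h3
        exact not_iff_not.1 h3.symm
    obtain ⟨r, rfl⟩ : ∃ r : F, u' = r • u := by
      by_contra! h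
      obtain ⟨A, hA, h3, h4⟩ := exists_isSymm_qform_eq hu hu' h c (c' + 1)
      rw [(key A hA).1 h3] at h4
      simp at h4
    have hr : r ≠ 0 := fun h => hu' (by rw [h, zero_smul])
    obtain ⟨A, hA, h3⟩ := exists_isSymm_qform_eq₁ hu c
    have h4 := (key A hA).1 h3
    rw [qform_smul, h3] at h4
    subst h4
    rw [hN', nbrGen_smul hφ hu hr hu']
  refine Equiv.ext fun X => ?_
  obtain ⟨φ, hφ, hE, hX⟩ := exists_symplCoord h2 E X
  have hd : ∀ N, S.dist E N = 1 → S.dist (p X) N = S.dist X N := fun N hN => by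
    rw [← hp X N, hnbr N hN]
  have hdE : S.dist (p X) E = S.dist X E := by rw [← hp X E, hpE]
  have hX1 : ∀ w ∈ X.1, ∀ v ∈ X.1, (φ w).1 ⬝ᵥ (φ v).2 = 0 := fun w hw v hv =>
    Finset.sum_eq_zero fun i _ => by
      by_cases hi : (i : ℕ) < S.dist E X
      · rw [((hX w).1 hw i).1 hi, zero_mul]
      · rw [((hX v).1 hv i).2 (not_lt.1 hi), mul_zero]
  -- The neighbour through `v` is closer to `p X` than `E` is, hence also closer to `X`, and so
  -- meets `X` outside `E`. On `X` the product of first and second components is zero in these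
  -- coordinates.
  have h1 : ∀ v ∈ (p X).1, (φ v).1 ⬝ᵥ (φ v).2 = 0 ∧ ∃ w ∈ X.1, (φ w).2 = (φ v).2 := by
    intro v hv
    by_cases hu : (φ v).2 = 0
    · exact ⟨by rw [hu, dotProduct_zero], 0, X.1.zero_mem, by simp [hu]⟩
    have h3 := dist_nbrGen_lt hφ hE hv hu
    rw [hd _ (dist_nbrGen hφ hE hu _), hdE] at h3
    obtain ⟨w, hwX, hwN, hwE⟩ := exists_mem_of_dist_lt h3
    obtain ⟨t, h4, h5⟩ := (mem_nbrGen hφ hu _ _).1 hwN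
    have ht : t ≠ 0 := fun h => hwE ((hE w).2 (by rw [h4, h, zero_smul]))
    have h6 := hX1 w hwX w hwX
    rw [h4, dotProduct_smul, h5, smul_eq_mul] at h6
    refine ⟨by simpa [ht] using h6, t⁻¹ • w, X.1.smul_mem _ hwX, ?_⟩
    rw [map_smul, Prod.smul_snd, h4, smul_smul, inv_mul_cancel₀ ht, one_smul]
  -- Polarisation of `h1` gives the sum of the two mixed products, isotropy of `p X` their
  -- difference.
  have h3 : ∀ v ∈ (p X).1, ∀ w ∈ (p X).1, (φ v).1 ⬝ᵥ (φ w).2 = 0 := by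
    intro v hv w hw
    have h4 := (h1 _ ((p X).1.add_mem hv hw)).1
    have h5 := form_eq_zero (p X) hv hw
    rw [hφ] at h5
    simp only [map_add, Prod.fst_add, Prod.snd_add, add_dotProduct, dotProduct_add, (h1 v hv).1,
      (h1 w hw).1] at h4
    rw [dotProduct_comm (φ v).2] at h5
    apply mul_left_cancel₀ h2
    linear_combination h4 + h5
  change p X = X
  refine gen_eq_of_le fun v hv => ?_
  -- It suffices that `p X` be orthogonal to `X`. Both terms of the form vanish: one by replacing
  -- `v` with a vector of `X` having the same second component, the other by replacing `x` with a
  -- vector of `p X` whose second component is proportional.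
  rw [mem_gen_iff]
  intro x hx
  obtain ⟨w, hw, hwv⟩ := (h1 v hv).2
  rw [hφ, ← hwv, hX1 x hx w hw, zero_sub, neg_eq_zero]
  by_cases hu : (φ x).2 = 0
  · rw [hu, zero_dotProduct]
  have h4 := dist_nbrGen_lt hφ hE hx hu
  rw [← hd _ (dist_nbrGen hφ hE hu _), ← hdE] at h4
  obtain ⟨y, hyX, hyN, hyE⟩ := exists_mem_of_dist_lt h4
  obtain ⟨t, h5, -⟩ := (mem_nbrGen hφ hu _ _).1 hyN
  have ht : t ≠ 0 := fun h => hyE ((hE y).2 (by rw [h5, h, zero_smul]))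
  have h6 := h3 v hv y hyX
  rw [h5, dotProduct_smul, smul_eq_mul] at h6
  rw [dotProduct_comm]
  exact (mul_eq_zero.1 h6).resolve_left ht

end Rigidity

/-! ### Permutations of the generators -/

variable (S) in
/-- The action of `ΣSp(2n,q)` on the generators. -/
def genPerm : S.sigmaSp →* Equiv.Perm S.Gen where
  toFun g :=
    { toFun := S.genMap g
      invFun := S.genMap g⁻¹
      left_inv := fun X => by rw [← genMap_mul, inv_mul_cancel, genMap_one]
      right_inv := fun X => by rw [← genMap_mul, mul_inv_cancel, genMap_one] }
  map_one' := Equiv.ext S.genMap_one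
  map_mul' g h := Equiv.ext (S.genMap_mul g h)

@[simp] theorem genPerm_apply (g : S.sigmaSp) (X : S.Gen) : S.genPerm g X = S.genMap g X := rfl

/-! ### Permutations preserving distances and triple signs -/

section TripleAut

variable [FiniteDimensional F V]

/-- The product of the Maslov indices of the pairs from a triple. -/
noncomputable def tripleSign (δ : S.DetFamily) (X Y Z : S.Gen) : ℤˣ :=
  maslov δ X Y * maslov δ X Z * maslov δ Y Z

/-- The permutations of the generators that preserve distances and signs of triples. -/
def tripleAut (δ : S.DetFamily) : Subgroup (Equiv.Perm S.Gen) where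
  carrier := {p | (∀ X Y, S.dist (p X) (p Y) = S.dist X Y) ∧
    ∀ X Y Z, tripleSign δ (p X) (p Y) (p Z) = tripleSign δ X Y Z}
  one_mem' := ⟨fun _ _ => rfl, fun _ _ _ => rfl⟩
  mul_mem' := fun {a b} ha hb => ⟨fun X Y => (ha.1 _ _).trans (hb.1 _ _),
    fun X Y Z => (ha.2 _ _ _).trans (hb.2 _ _ _)⟩
  inv_mem' := fun {a} ha => ⟨fun X Y => by
    have := ha.1 (a⁻¹ X) (a⁻¹ Y)
    simpa using this.symm, fun X Y Z => by
    have := ha.2 (a⁻¹ X) (a⁻¹ Y) (a⁻¹ Z)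
    simpa using this.symm⟩

theorem genPerm_mem_tripleAut [Finite F] (δ : S.DetFamily) (g : S.sigmaSp) :
    S.genPerm g ∈ tripleAut δ := by
  refine ⟨fun X Y => dist_genMap g X Y, fun X Y Z => ?_⟩
  have h : ∀ a b c x y z : ℤˣ, a * b * x * (a * c * y) * (b * c * z) = x * y * z := by decide
  rw [tripleSign, tripleSign, genPerm_apply, genPerm_apply, genPerm_apply, maslov_genMap,
    maslov_genMap, maslov_genMap, h]

omit [FiniteDimensional F V] in
/-- The semi-isometry acting on coordinates by `(a, b) ↦ (W θ(a), W⁻ᵀ θ(b))`. -/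
theorem exists_sigmaSp_coord {φ : V ≃ₗ[F] (Fin n → F) × (Fin n → F)} (hφ : S.IsSymplCoord φ)
    {W : Matrix (Fin n) (Fin n) F} (hW : IsUnit W) (θ : F ≃+* F) :
    ∃ g : S.sigmaSp, ∀ v, φ (g.1 v) =
      (W *ᵥ (fun i => θ ((φ v).1 i)), W⁻¹ᵀ *ᵥ (fun i => θ ((φ v).2 i))) := by
  have hdet := (isUnit_iff_isUnit_det _).1 hW
  have hW1 : ∀ x, W *ᵥ W⁻¹ *ᵥ x = x := fun x => by
    rw [mulVec_mulVec, mul_nonsing_inv _ hdet, one_mulVec]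
  have hW2 : ∀ x, W⁻¹ *ᵥ W *ᵥ x = x := fun x => by
    rw [mulVec_mulVec, nonsing_inv_mul _ hdet, one_mulVec]
  have hW3 : ∀ x, W⁻¹ᵀ *ᵥ Wᵀ *ᵥ x = x := fun x => by
    rw [mulVec_mulVec, ← transpose_mul, mul_nonsing_inv _ hdet, transpose_one, one_mulVec]
  have hW4 : ∀ x, Wᵀ *ᵥ W⁻¹ᵀ *ᵥ x = x := fun x => by
    rw [mulVec_mulVec, ← transpose_mul, nonsing_inv_mul _ hdet, transpose_one, one_mulVec]
  let g : Equiv.Perm V :=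
    { toFun := fun v => φ.symm
        (W *ᵥ (fun i => θ ((φ v).1 i)), W⁻¹ᵀ *ᵥ (fun i => θ ((φ v).2 i)))
      invFun := fun v => φ.symm
        (fun i => θ.symm ((W⁻¹ *ᵥ (φ v).1) i), fun i => θ.symm ((Wᵀ *ᵥ (φ v).2) i))
      left_inv := fun v => by simp [hW2, hW4]
      right_inv := fun v => by simp [hW1, hW3] }
  have hg : ∀ v, φ (g v) =
      (W *ᵥ (fun i => θ ((φ v).1 i)), W⁻¹ᵀ *ᵥ (fun i => θ ((φ v).2 i))) := fun v =>
    φ.apply_symm_apply _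
  have hadd : ∀ x y : Fin n → F, (fun i => θ ((x + y) i)) =
      (fun i => θ (x i)) + fun i => θ (y i) := fun x y => funext fun i => map_add θ _ _
  have hsmul : ∀ (c : F) (x : Fin n → F), (fun i => θ ((c • x) i)) =
      θ c • fun i => θ (x i) := fun c x => funext fun i => map_mul θ _ _
  have hdot : ∀ x y : Fin n → F, (W *ᵥ fun i => θ (x i)) ⬝ᵥ (W⁻¹ᵀ *ᵥ fun i => θ (y i)) =
      θ (x ⬝ᵥ y) := fun x y => by
    rw [dotProduct_comm, dotProduct_mulVec, ← mulVec_transpose, hW4]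
    simp [dotProduct, mul_comm]
  refine ⟨⟨g, ⟨fun v w => φ.injective ?_, θ, fun c v => φ.injective ?_⟩, θ, fun v w => ?_⟩, hg⟩
  · rw [map_add φ, hg, hg, hg, map_add, Prod.fst_add, Prod.snd_add, hadd, hadd, mulVec_add,
      mulVec_add]
    rfl
  · rw [map_smul φ, hg, hg, map_smul, Prod.smul_fst, Prod.smul_snd, hsmul, hsmul, mulVec_smul,
      mulVec_smul]
    rfl
  · rw [hφ, hφ, hg, hg, dotProduct_comm (W⁻¹ᵀ *ᵥ _), hdot, hdot, map_sub, dotProduct_comm (φ w).1]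

/-- Every permutation of the generators that preserves distances and signs of triples is induced
by a semi-isometry. -/
theorem exists_genPerm_eq [Finite F] (hq : Nat.card F % 4 = 1) (hn : 1 ≤ n) (δ : S.DetFamily)
    {p : Equiv.Perm S.Gen} (hp : p ∈ tripleAut δ) : ∃ g, S.genPerm g = p := by
  classical
  have := Fintype.ofFinite F
  have h2 := two_ne_zero_of_card hq
  obtain ⟨E, Y₀, hEY⟩ := exists_dist_eq (S := S) h2 (le_refl n)
  obtain ⟨g₁, hg₁, hg₁'⟩ := exists_sp_genMap h2 (hp.1 E Y₀)
  set g₁' := Subgroup.inclusion S.sp_le_sigmaSp g₁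
  -- Correcting `p` by an isometry makes it fix `E` and the graph `Y₀` of the zero matrix, so that
  -- `f 0 = 0` below.
  set p₁ := S.genPerm g₁' * p with hp₁
  have hpt : p₁ ∈ tripleAut δ := mul_mem (genPerm_mem_tripleAut δ g₁') hp
  have hpE : p₁ E = E := hg₁
  have hpY : p₁ Y₀ = Y₀ := hg₁'
  obtain ⟨φ, hφ, hE, hY⟩ := exists_symplCoord h2 E Y₀
  have h0s : (0 : Matrix (Fin n) (Fin n) F).IsSymm := by simp [IsSymm]
  have hY0 : oppGen hφ h0s = Y₀ := gen_eq_of_le fun v hv => (hY v).2 fun i => by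
    rw [mem_oppGen, zero_mulVec] at hv
    rw [hv]
    exact ⟨fun _ => rfl, fun hi => absurd i.2 (by omega)⟩
  have hdE : ∀ X, S.dist E (p₁ X) = S.dist E X := fun X => by
    conv_lhs => rw [← hpE]
    exact hpt.1 E X
  have hdE' : ∀ X, S.dist E (p₁.symm X) = S.dist E X := fun X => by
    rw [← hdE, Equiv.apply_symm_apply]
  have hf : ∀ A : Matrix (Fin n) (Fin n) F, ∃ B : Matrix (Fin n) (Fin n) F, ∃ hB : B.IsSymm,
      ∀ hA : A.IsSymm, p₁ (oppGen hφ hA) = oppGen hφ hB := fun A => by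
    by_cases hA : A.IsSymm
    · obtain ⟨B, hB, h⟩ := exists_eq_oppGen hφ hE (X := p₁ (oppGen hφ hA)) (by
        rw [hdE, dist_oppGen hφ hE])
      exact ⟨B, hB, fun _ => h⟩
    · exact ⟨0, h0s, fun h => absurd h hA⟩
  choose f hfs hf using hf
  have hf0 : f 0 = 0 := by
    have := hf 0 h0s
    rw [hY0, hpY, ← hY0] at this
    exact (oppGen_injective hφ h0s (hfs 0) this).symm
  have hfinj : ∀ A B : Matrix (Fin n) (Fin n) F, A.IsSymm → B.IsSymm → f A = f B → A = B := by
    intro A B hA hB h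
    refine oppGen_injective hφ hA hB (p₁.injective ?_)
    rw [hf, hf]
    congr 1
  have hfsurj : ∀ B : Matrix (Fin n) (Fin n) F, B.IsSymm → ∃ A, A.IsSymm ∧ f A = B := by
    intro B hB
    obtain ⟨A, hA, h⟩ := exists_eq_oppGen hφ hE (X := p₁.symm (oppGen hφ hB)) (by
        rw [hdE', dist_oppGen hφ hE])
    refine ⟨A, hA, oppGen_injective hφ (hfs A) hB ?_⟩
    rw [← hf A hA, ← h, Equiv.apply_symm_apply]
  have hform : IsFormMap f := by
    refine ⟨fun A _ => hfs A, exists_ringEquiv_qform hq hf0 hfsurj fun u hu c => ?_⟩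
    obtain ⟨u', hu', c', hN⟩ := exists_eq_nbrGen hφ hE (X := p₁.symm (nbrGen hφ hu c)) (by
      rw [hdE', dist_nbrGen hφ hE])
    refine ⟨u', hu', c', fun A hA => ?_⟩
    have hN' : p₁ (nbrGen hφ hu' c') = nbrGen hφ hu c := by
      rw [← hN, Equiv.apply_symm_apply]
    have hd := hpt.1 (nbrGen hφ hu' c') (oppGen hφ hA)
    have ht := hpt.2 E (nbrGen hφ hu' c') (oppGen hφ hA)
    rw [hN', hf A hA] at hd
    rw [hN', hf A hA, hpE, tripleSign, tripleSign] at ht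
    have h1 := dist_nbrGen_oppGen hφ hu c (hfs A)
    rw [hd, dist_nbrGen_oppGen hφ hu' c' hA] at h1
    -- Preservation of distances settles the zeros of the two quadratic characters; the triple sign
    -- is available only for opposite generators and settles the nonzero values.
    by_cases h3 : qform A u' = c'
    · have h4 : qform (f A) u = c := by
        by_contra h4
        exact h1.2 h4 h3
      rw [h3, h4, sub_self, sub_self]
    · have h4 := h1.1 h3
      rw [maslov_triple hφ hE hq δ hu (hfs A) h4, maslov_triple hφ hE hq δ hu' hA h3] at ht
      rw [← chi_eq_quadraticChar (sub_ne_zero.2 h4), ht, chi_eq_quadraticChar (sub_ne_zero.2 h3)]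
  have : Nonempty (Fin n) := ⟨⟨0, hn⟩⟩
  obtain ⟨W, θ, hW, hfW⟩ := hform.exists_eq_mul_map_mul hq hfinj
  obtain ⟨g₂, hg₂⟩ := exists_sigmaSp_coord hφ hW θ
  have hgE : S.genPerm g₂ E = E := gen_eq_of_le (by
    rintro _ ⟨v, hv, rfl⟩
    rw [hE, hg₂, (hE v).1 hv]
    funext i
    simp [mulVec, dotProduct])
  have hgopp : ∀ (A : Matrix (Fin n) (Fin n) F) (hA : A.IsSymm),
      S.genPerm g₂ (oppGen hφ hA) = oppGen hφ (hfs A) := fun A hA => gen_eq_of_le (by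
    rintro _ ⟨v, hv, rfl⟩
    rw [mem_oppGen] at hv ⊢
    rw [hg₂, hfW A hA, hv]
    have h3 : Wᵀ * W⁻¹ᵀ = 1 := by
      rw [← transpose_mul, nonsing_inv_mul _ ((isUnit_iff_isUnit_det _).1 hW), transpose_one]
    have h4 : (fun i => θ ((A *ᵥ (φ v).2) i)) = A.map θ *ᵥ (fun i => θ ((φ v).2 i)) := by
      funext i
      simp [mulVec, dotProduct, map_sum]
    simp only [mulVec_mulVec, h4, Matrix.mul_assoc, h3, Matrix.mul_one])
  have hone : (S.genPerm g₂)⁻¹ * p₁ = 1 := by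
    have hmem := mul_mem (inv_mem (genPerm_mem_tripleAut δ g₂)) hpt
    refine eq_one_of_fixes_opposite h2 hmem.1 (E := E) ?_ fun X hX => ?_
    · rw [Equiv.Perm.mul_apply, hpE, Equiv.Perm.inv_eq_iff_eq, hgE]
    · obtain ⟨A, hA, rfl⟩ := exists_eq_oppGen hφ hE hX
      rw [Equiv.Perm.mul_apply, hf A hA, Equiv.Perm.inv_eq_iff_eq, hgopp A hA]
  refine ⟨g₁'⁻¹ * g₂, ?_⟩
  rw [map_mul, map_inv, eq_of_inv_mul_eq_one hone, hp₁, inv_mul_cancel_left]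

end TripleAut

end SymplecticForm

end SympCover

namespace SympCover

open Matrix

namespace SymplecticForm

variable {F V : Type*} [Field F] [AddCommGroup V] [Module F V] {n : ℕ}
  {S : SymplecticForm F V n} [Finite F] [FiniteDimensional F V]

/-! ### Automorphisms of the scheme -/

-- Points over the same generator are exactly those at distance `0`, so `π` permutes the fibres; on
-- a fibre, relative signs force it to be multiplication by a sign.
omit [Finite F] in
theorem exists_perm_of_mem_schemeAut (δ : S.DetFamily) {π : Equiv.Perm (Cover S)}
    (hπ : π ∈ schemeAut (rel δ)) : ∃ (p : Equiv.Perm S.Gen) (s : S.Gen → ℤˣ),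
      (∀ x, π x = (p x.1, s x.1 * x.2)) ∧
      (∀ X Y, S.dist (p X) (p Y) = S.dist X Y) ∧
      ∀ X Y, s X * s Y * maslov δ (p X) (p Y) = maslov δ X Y := by
  have hfst : ∀ ρ ∈ schemeAut (rel δ), ∀ x : Cover S, (ρ (x.1, 1)).1 = (ρ x).1 :=
    fun ρ hρ x => eq_of_dist_eq_zero (by
      rw [((mem_schemeAut_iff δ ρ).1 hρ _ _).1, dist_self])
  have hinv := inv_mem hπ
  rw [mem_schemeAut_iff] at hπ
  let p : Equiv.Perm S.Gen :=
    { toFun := fun X => (π (X, 1)).1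
      invFun := fun X => (π⁻¹ (X, 1)).1
      left_inv := fun X => (hfst _ hinv (π (X, 1))).trans
        (congrArg Prod.fst (π.symm_apply_apply (X, 1)))
      right_inv := fun X => (hfst _ ((mem_schemeAut_iff δ π).2 hπ) (π⁻¹ (X, 1))).trans
        (congrArg Prod.fst (π.apply_symm_apply (X, 1))) }
  have hp : ∀ x : Cover S, (π x).1 = p x.1 := fun x =>
    (hfst _ ((mem_schemeAut_iff δ π).2 hπ) x).symm
  have h1 : ∀ a b c : ℤˣ, a * b * 1 = 1 * c * 1 → b = a * c := by decide
  refine ⟨p, fun X => (π (X, 1)).2, fun x => Prod.ext (hp x) ?_, fun X Y =>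
    (hπ (X, 1) (Y, 1)).1, fun X Y => ?_⟩
  · have := (hπ (x.1, 1) x).2
    rw [relSign, relSign, hp, hp, maslov_self, maslov_self] at this
    exact h1 _ _ _ this
  · have := (hπ (X, 1) (Y, 1)).2
    rw [relSign, relSign, one_mul, one_mul] at this
    exact this

/-- The fibre signs `s` occur twice in every triple product and cancel, so the induced permutation
comes from a semi-isometry `g`. -/
theorem schemeAut_le_range (hq : Nat.card F % 4 = 1) (hn : 1 ≤ n) (δ : S.DetFamily) :
    schemeAut (rel δ) ≤ (twoPSigmaSpHom δ hq).range := by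
  intro π hπ
  obtain ⟨p, s, hps, hdist, hs⟩ := exists_perm_of_mem_schemeAut δ hπ
  have hpt : p ∈ tripleAut δ := by
    refine ⟨hdist, fun X Y Z => ?_⟩
    have h : ∀ a b c x y z : ℤˣ, x * y * z = a * b * x * (a * c * y) * (b * c * z) := by decide
    rw [tripleSign, tripleSign, h (s X) (s Y) (s Z), hs, hs, hs]
  obtain ⟨g, hg⟩ := exists_genPerm_eq hq hn δ hpt
  obtain ⟨X₀⟩ := nonempty_gen S
  set t : S.Gen → ℤˣ := fun X => s X * chi (multiplier δ g X) with ht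
  -- The signs `s` and `χ(λ_{g,X})` transform the same Maslov indices in the same way, so they
  -- differ by a global sign, which is the `ζ` component.
  have hconst : ∀ X, t X = t X₀ := fun X => by
    have h1 := hs X X₀
    have h2 := maslov_genMap δ g X X₀
    rw [← genPerm_apply, ← genPerm_apply, hg] at h2
    rw [h2] at h1
    have h : ∀ a b c d m : ℤˣ, a * b * (c * d * m) = m → a * c = b * d := by decide
    exact h _ _ _ _ _ h1
  refine ⟨(t X₀, (g : S.PSigmaSp)), Equiv.ext fun x => ?_⟩
  rw [twoPSigmaSpHom_apply, hps, ← hconst x.1, ht, ← genPerm_apply, hg]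
  have h : ∀ a b c : ℤˣ, a * b * (b * c) = a * c := by decide
  exact Prod.ext rfl (h _ _ _)

/-! ### Faithfulness -/

omit [Finite F] in
/-- A semi-isometry that fixes all generators is `±I`. -/
theorem eq_one_or_eq_negI (h2 : (2 : F) ≠ 0) (hn : 1 ≤ n) {g : S.sigmaSp}
    (hg : ∀ X, S.genMap g X = X) : g.1 = 1 ∨ g.1 = negI := by
  classical
  obtain ⟨E, Y₀, hEY⟩ := exists_dist_eq (S := S) h2 (le_refl n)
  obtain ⟨φ, hφ, hE, hY⟩ := exists_symplCoord h2 E Y₀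
  have hmem : ∀ (X : S.Gen) v, v ∈ X.1 → g.1 v ∈ X.1 := fun X v hv => by
    have h := (genMap_apply_mem_iff g X v).2 hv
    rwa [hg] at h
  have hadd := g.2.1.1
  have hE' : ∀ a, (φ (g.1 (φ.symm (a, 0)))).2 = 0 := fun a =>
    (hE _).1 (hmem E _ ((hE _).2 (by simp)))
  have hY' : ∀ b, (φ (g.1 (φ.symm (0, b)))).1 = 0 := fun b => by
    have h1 := hmem Y₀ (φ.symm (0, b)) ((hY _).2 fun i => ⟨fun _ => by simp,
      fun hi => absurd i.2 (by omega)⟩)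
    funext i
    exact ((hY _).1 h1 i).1 (by omega)
  let h₁ : (Fin n → F) → Fin n → F := fun a => (φ (g.1 (φ.symm (a, 0)))).1
  let h : (Fin n → F) → Fin n → F := fun b => (φ (g.1 (φ.symm (0, b)))).2
  have hsplit : ∀ a b, φ (g.1 (φ.symm (a, b))) = (h₁ a, h b) := fun a b => by
    have h3 : φ.symm (a, b) = φ.symm (a, 0) + φ.symm (0, b) := by rw [← map_add]; simp
    rw [h3, hadd, map_add]
    exact Prod.ext (by simp [h₁, hY']) (by simp [h, hE'])
  have hmat : ∀ A : Matrix (Fin n) (Fin n) F, A.IsSymm → ∀ b, h₁ (A *ᵥ b) = A *ᵥ h b :=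
    fun A hA b => by
      have h3 := hmem (oppGen hφ hA) (φ.symm (A *ᵥ b, b)) ((mem_oppGen hφ hA _).2 (by simp))
      rw [mem_oppGen, hsplit] at h3
      exact h3
  have h₁h : ∀ b, h₁ b = h b := fun b => by
    have := hmat 1 isSymm_one b
    simpa using this
  have hh : ∀ a b, h (a + b) = h a + h b := fun a b => by
    have h3 : φ.symm (0, a + b) = φ.symm (0, a) + φ.symm (0, b) := by rw [← map_add]; simp
    simp only [h]
    rw [h3, hadd, map_add]; rfl
  -- The graphs are fixed too, so `h` commutes with every symmetric matrix. Scalar matrices make it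
  -- linear, `e eᵀ` makes `e` an eigenvector, and `x eᵀ + e xᵀ` carries the eigenvalue to all `x`.
  have hcomm : ∀ A : Matrix (Fin n) (Fin n) F, A.IsSymm → ∀ b, h (A *ᵥ b) = A *ᵥ h b :=
    fun A hA b => by rw [← h₁h, hmat A hA]
  have hsmul : ∀ (t : F) b, h (t • b) = t • h b := fun t b => by
    have := hcomm (t • 1) (isSymm_one.smul t) b
    simpa [smul_mulVec] using this
  let e : Fin n → F := Pi.single ⟨0, hn⟩ 1
  have hee : e ⬝ᵥ e = 1 := by simp [e]
  have hvm : ∀ x z b : Fin n → F, vecMulVec x z *ᵥ b = (z ⬝ᵥ b) • x := fun x z b => by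
    rw [vecMulVec_mulVec]; simp
  obtain ⟨r, hr⟩ : ∃ r : F, h e = r • e := by
    have := hcomm _ (isSymm_vecMulVec_self e) e
    rw [hvm, hvm, hee, one_smul] at this
    exact ⟨_, this⟩
  have hall : ∀ x, h x = r • x := fun x => by
    have := hcomm _ (isSymm_vecMulVec_add x e) e
    rw [add_mulVec, add_mulVec, hvm, hvm, hvm, hvm, hr, hee, one_smul, hh, hsmul, hr,
      dotProduct_smul, dotProduct_smul, hee, smul_eq_mul, smul_eq_mul, mul_one, mul_smul,
      smul_comm r] at this
    exact add_right_cancel this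
  have hgv : ∀ v, g.1 v = r • v := fun v => φ.injective (by
    have h3 := hsplit (φ v).1 (φ v).2
    rw [Prod.mk.eta, LinearEquiv.symm_apply_apply, h₁h, hall, hall] at h3
    rw [h3, map_smul]
    rfl)
  obtain ⟨τ, hτ⟩ := g.2.2
  have hform : S.form (φ.symm (e, 0)) (φ.symm (0, e)) = 1 := by
    rw [hφ]; simp [hee]
  -- The form value `1` is fixed by the field automorphism and is multiplied by `r²`.
  have hr2 : r * r = 1 := by
    have := hτ (φ.symm (e, 0)) (φ.symm (0, e))
    rw [hgv, hgv, map_smul, map_smul, LinearMap.smul_apply, hform, map_one] at this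
    simpa using this
  rcases mul_self_eq_one_iff.1 hr2 with rfl | rfl
  · exact Or.inl (Equiv.ext fun v => by rw [hgv, one_smul]; rfl)
  · exact Or.inr (Equiv.ext fun v => by rw [hgv, neg_smul, one_smul]; rfl)

theorem twoPSigmaSpHom_injective (hq : Nat.card F % 4 = 1) (hn : 1 ≤ n) (δ : S.DetFamily) :
    Function.Injective (twoPSigmaSpHom δ hq) := by
  rw [injective_iff_map_eq_one]
  rintro ⟨s, g⟩ hsg
  obtain ⟨g, rfl⟩ := QuotientGroup.mk_surjective g
  have hg : ∀ X, S.genMap g X = X := fun X =>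
    congrArg Prod.fst (Equiv.congr_fun hsg (X, 1))
  have hone : (g : S.PSigmaSp) = 1 := by
    rw [QuotientGroup.eq_one_iff]
    rcases eq_one_or_eq_negI (two_ne_zero_of_card hq) hn hg with h | h
    · rw [show g = 1 from Subtype.ext h]
      exact one_mem _
    · rw [show g = ⟨negI, S.sp_le_sigmaSp S.negI_mem⟩ from Subtype.ext h]
      exact Subgroup.mem_zpowers _
  obtain ⟨X₀⟩ := nonempty_gen S
  have h1 := congrArg Prod.snd (Equiv.congr_fun hsg (X₀, 1))
  change ((s, (g : S.PSigmaSp)) : ℤˣ × S.PSigmaSp) = (1, 1)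
  rw [hone]
  rw [show ((g : S.sigmaSp) : S.PSigmaSp) = ((1 : S.sigmaSp) : S.PSigmaSp) from hone,
    twoPSigmaSpHom_apply] at h1
  simp only [chi_multiplier_one, mul_one] at h1
  rw [h1]
  rfl

end SymplecticForm

end SympCover

theorem theorem6p3 {F V : Type*} [Field F] [Finite F] (hq : Nat.card F % 4 = 1)
    [AddCommGroup V] [Module F V] [FiniteDimensional F V] {n : ℕ} (hn : 1 ≤ n)
    (S : SympCover.SymplecticForm F V n) (δ : S.DetFamily) :
    SympCover.AreOrbitals (SympCover.SymplecticForm.twoPSpHom δ hq).range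
        (SympCover.SymplecticForm.rel δ) ∧
      SympCover.AreOrbitals (SympCover.SymplecticForm.twoPSigmaSpHom δ hq).range
        (SympCover.SymplecticForm.rel δ) ∧
      SympCover.IsSchurianScheme (2 * n + 1) (SympCover.SymplecticForm.rel δ) ∧
      Function.Injective (SympCover.SymplecticForm.twoPSigmaSpHom δ hq) ∧
      (SympCover.SymplecticForm.twoPSigmaSpHom δ hq).range =
        SympCover.schemeAut (SympCover.SymplecticForm.rel δ) :=
  have h1 := SympCover.SymplecticForm.twoPSpHom_range_le δ hq
  have h2 := SympCover.SymplecticForm.twoPSigmaSpHom_range_le δ hq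
  ⟨SympCover.SymplecticForm.areOrbitals_of_le δ hq le_rfl (h1.trans h2),
    SympCover.SymplecticForm.areOrbitals_of_le δ hq h1 h2,
    SympCover.SymplecticForm.isSchurianScheme_rel δ hq,
    SympCover.SymplecticForm.twoPSigmaSpHom_injective hq hn δ,
    le_antisymm h2 (SympCover.SymplecticForm.schemeAut_le_range hq hn δ)⟩
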